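/- Let $n(t)$ be standard Gaussian white noise on $[-1/2,1/2]$, and for $0<\varepsilon<1$ observe $x^\varepsilon(t)=f(t-\theta)+\varepsilon n(t)$, $t\in[-1/2,1/2]$. Let $\Theta=[-\tau_0,\tau_0]$ with $0<\tau_0<1/4$. For $\rho,C_0>0$ let $F=F(\rho,C_0)$ be the class of functions $f(t)=\sqrt2\sum_{k\ge1}f_k\cos(2\pi kt)$ (the series converging for all $t$), with $f_k=\sqrt2\int_{-1/2}^{1/2}f(t)\cos(2\pi kt)\,dt$, such that $f_1^2\ge\rho$ and $\|f''\|^2\le C_0$. For a sequence $a=(a_k)_{k\ge1}$ we write $\|a'\|^2=\sum_{k\ge1}(2\pi k)^2a_k^2$ and $\|a''\|^2=\sum_{k\ge1}(2\pi k)^4a_k^2$, and $\|f'\|,\|f''\|$ are these quantities for $a=(f_k)$. Let $I^\varepsilon(f)=\varepsilon^{-2}\int_{-1/2}^{1/2}f'(t)^2\,dt$ be the Fisher information. Let $h=(h_k)_{k\ge1}$, $h_k=h_k(\varepsilon)$, be real weights such that for every $\varepsilon\in(0,1)$ only finitely many $h_k$ are nonzero, $h_1=1$, $0\le h_k\le1$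 for all $k$, $$\|h'\|\ge\rho_1\log^2(\varepsilon^{-2})\max_k h_k(2\pi k),\qquad \varepsilon^2\sum_{k\ge1}h_k(2\pi k)^4\le C_1,$$ with constants $\rho_1>0$ and $C_1$ independent of $\varepsilon$, and such that, as $\varepsilon\to0$ and uniformly in $f\in F$, $$\Big[\sum_{k\ge1}(1-h_k)(2\pi k)^2f_k^2\Big]^2=o\Big(\sum_{k\ge1}(1-h_k)^2(2\pi k)^2f_k^2\Big).$$ Let $$\hat\theta_{AD}\in\arg\max_{\tau\in\Theta}\sum_{k\ge1}h_k\Big(\int_{-1/2}^{1/2}\cos[2\pi k(t-\tau)]\,x^\varepsilon(t)\,dt\Big)^2$$ be a measurable function of the observation, and let $\delta_\varepsilon$ be any function of $\varepsilon$ with $\delta_\varepsilon/\big(\varepsilon\sqrt{\log(\varepsilon^{-2})}\big)\to\infty$ as $\varepsilon\to0$ (for instance a positive constant). Then, as $\varepsilon\to0$, uniformly in $f\in F$ and in $|\theta|\le\tau_0-\delta_\varepsilon$, $$\mathbf E_{\theta,f}\big[(\hat\theta_{AD}-\theta)^2I^\varepsilon(f)\big]=1+(1+o(1))\frac{R^\varepsilon[f,h]}{\|f'\|^2},\qquad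 R^\varepsilon[f,h]=\sum_{k\ge1}(2\pi k)^2\big[(1-h_k)^2f_k^2+\varepsilon^2h_k^2\big].$$ In particular $\hat\theta_{AD}$ is $S$-adaptive (first-order efficient) in the sense that, uniformly in $f\in F$ and $|\theta|\le\tau_0-\delta_\varepsilon$, $\mathbf E_{\theta,f}[(\hat\theta_{AD}-\theta)^2I^\varepsilon(f)]\to1$, the first-order asymptotic risk of the efficient maximum likelihood estimator for known $f$. -/

import Mathlib

open Set Filter Topology MeasureTheory ProbabilityTheory

namespace ShiftModel

noncomputable section

/-- The observation interval `[-1/2, 1/2]` with Lebesgue measure. -/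
abbrev μI : Measure ℝ := volume.restrict (Icc (-1 / 2 : ℝ) (1 / 2))

/-- The Hilbert space `L²([-1/2, 1/2])` of real functions. -/
abbrev L2I : Type := Lp ℝ 2 μI

/-! ### The class of signals -/

/-- The Fourier coefficient `f_k = √2 ∫_{-1/2}^{1/2} f(t) cos(2πkt) dt`. -/
def coeff (f : ℝ → ℝ) (k : ℕ+) : ℝ :=
  √2 * ∫ t in (-1 / 2 : ℝ)..(1 / 2), f t * Real.cos (2 * Real.pi * k * t)

/-- `‖a'‖² = ∑_{k ≥ 1} a_k² (2πk)²`. -/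
def normSqD1 (a : ℕ+ → ℝ) : ℝ := ∑' k : ℕ+, a k ^ 2 * (2 * Real.pi * k) ^ 2

/-- `‖a''‖² = ∑_{k ≥ 1} a_k² (2πk)⁴`. -/
def normSqD2 (a : ℕ+ → ℝ) : ℝ := ∑' k : ℕ+, a k ^ 2 * (2 * Real.pi * k) ^ 4

/-- The class `F(ρ, C₀)`: functions with `f(t) = √2 ∑_{k ≥ 1} f_k cos(2πkt)` for all real `t`
(so `f` is even and `1`-periodic), `f_1² ≥ ρ` and `‖f''‖² ≤ C₀` (in particular finite). -/
def signalClass (ρ C₀ : ℝ) : Set (ℝ → ℝ) :=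
  {f | (∀ t : ℝ, HasSum (fun k : ℕ+ => √2 * coeff f k * Real.cos (2 * Real.pi * k * t)) (f t)) ∧
    ρ ≤ coeff f 1 ^ 2 ∧
    Summable (fun k : ℕ+ => coeff f k ^ 2 * (2 * Real.pi * k) ^ 4) ∧
    normSqD2 (coeff f) ≤ C₀}

/-- The Fisher information `I^ε(f) = ε⁻² ∫_{-1/2}^{1/2} f'(t)² dt`. -/
def fisherInfo (ε : ℝ) (f : ℝ → ℝ) : ℝ :=
  (ε ^ 2)⁻¹ * ∫ t in (-1 / 2 : ℝ)..(1 / 2), deriv f t ^ 2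

/-! ### The Gaussian white noise model -/

/-- `n` is a standard Gaussian white noise on `[-1/2, 1/2]` under `P`; `n φ` stands for
`∫ φ(t) n(t) dt`. It is a random linear functional on `L²([-1/2, 1/2])` with `n φ ∼ N(0, ‖φ‖²)`.
By linearity every finite family `n φ₁, …, n φ_m` is then jointly Gaussian, with
`E[n φ n ψ] = ⟨φ, ψ⟩`. -/
structure IsWhiteNoise {Ω : Type*} [MeasurableSpace Ω] (P : Measure Ω) (n : L2I → Ω → ℝ) :
    Prop where
  measurable : ∀ φ, Measurable (n φ)
  linear : ∀ ω, IsLinearMap ℝ (fun φ => n φ ω)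
  law : ∀ φ, P.map (n φ) = gaussianReal 0 (‖φ‖₊ ^ 2)

/-- The sample space: `X φ` stands for `∫_{-1/2}^{1/2} φ(t) x^ε(t) dt`. It carries the product
`σ`-algebra, generated by the evaluations `X ↦ X φ`. -/
abbrev Observation : Type := L2I → ℝ

/-- The observation in the model `x^ε(t) = f(t - θ) + ε n(t)`, `t ∈ [-1/2, 1/2]`. -/
def observe {Ω : Type*} (n : L2I → Ω → ℝ) (ε : ℝ) (f : ℝ → ℝ) (θ : ℝ) (ω : Ω) : Observation :=
  fun φ => (∫ t, φ t * f (t - θ) ∂μI) + ε * n φ ω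

theorem memLp_cos (k : ℕ+) (τ : ℝ) :
    MemLp (fun t : ℝ => Real.cos (2 * Real.pi * k * (t - τ))) 2 μI := by
  refine MemLp.of_bound (by fun_prop) 1 (Eventually.of_forall fun t => ?_)
  simpa using Real.abs_cos_le_one _

/-- The test function `t ↦ cos(2πk(t - τ))` on `[-1/2, 1/2]`. -/
def cosTest (k : ℕ+) (τ : ℝ) : L2I := (memLp_cos k τ).toLp _

/-! ### The estimator -/

/-- The criterion `τ ↦ ∑_{k ≥ 1} h_k (∫ cos[2πk(t - τ)] x^ε(t) dt)²`. -/
def contrast (h : ℕ+ → ℝ) (X : Observation) (τ : ℝ) : ℝ :=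
  ∑' k : ℕ+, h k * X (cosTest k τ) ^ 2

/-- `T` is a version of the estimator `θ̂_AD = argmax_{τ ∈ Θ} ∑ h_k (∫ cos[2πk(t - τ)] x^ε(t) dt)²`:
a measurable function of the observation which is a maximizer of the criterion over
`Θ = [-τ₀, τ₀]`. -/
structure IsEstimatorAD (τ₀ : ℝ) (h : ℕ+ → ℝ) (T : Observation → ℝ) : Prop where
  measurable : Measurable T
  mem : ∀ X, IsLinearMap ℝ X → T X ∈ Icc (-τ₀) τ₀
  isMaxOn : ∀ X, IsLinearMap ℝ X → IsMaxOn (contrast h X) (Icc (-τ₀) τ₀) (T X)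

/-- The normalized quadratic risk `E_{θ,f}[(T - θ)² I^ε(f)]`. -/
def risk {Ω : Type*} [MeasurableSpace Ω] (P : Measure Ω) (n : L2I → Ω → ℝ) (ε : ℝ)
    (T : Observation → ℝ) (f : ℝ → ℝ) (θ : ℝ) : ℝ :=
  ∫ ω, (T (observe n ε f θ ω) - θ) ^ 2 * fisherInfo ε f ∂P

/-- The functional `R^ε[f, h] = ∑_{k ≥ 1} (2πk)² [(1 - h_k)² f_k² + ε² h_k²]`. -/
def secondOrder (ε : ℝ) (f : ℝ → ℝ) (h : ℕ+ → ℝ) : ℝ :=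
  ∑' k : ℕ+, (2 * Real.pi * k) ^ 2 * ((1 - h k) ^ 2 * coeff f k ^ 2 + ε ^ 2 * h k ^ 2)

/-! ### Assumptions on the weights -/

/-- Assumption B on the weights `h = {h_k(ε)}`, together with the standing assumption that for
each `ε` only finitely many weights are nonzero (so that the maximum and the sums below are
finite). -/
structure AssumptionB (ρ₁ C₁ : ℝ) (h : ℝ → ℕ+ → ℝ) : Prop where
  finite : ∀ ε ∈ Ioo (0 : ℝ) 1, {k | h ε k ≠ 0}.Finite
  one : ∀ ε ∈ Ioo (0 : ℝ) 1, h ε 1 = 1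
  mem : ∀ ε ∈ Ioo (0 : ℝ) 1, ∀ k, h ε k ∈ Icc (0 : ℝ) 1
  b1 : ∀ ε ∈ Ioo (0 : ℝ) 1,
    ρ₁ * Real.log (ε ^ (-2 : ℤ)) ^ 2 * (⨆ k : ℕ+, h ε k * (2 * Real.pi * k)) ≤ √(normSqD1 (h ε))
  b2 : ∀ ε ∈ Ioo (0 : ℝ) 1, ε ^ 2 * ∑' k : ℕ+, h ε k * (2 * Real.pi * k) ^ 4 ≤ C₁

/-- Assumption C: as `ε → 0`, uniformly in `f ∈ F(ρ, C₀)`,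
`[∑ (1 - h_k) (2πk)² f_k²]² = o(∑ (1 - h_k)² (2πk)² f_k²)`. -/
def AssumptionC (ρ C₀ : ℝ) (h : ℝ → ℕ+ → ℝ) : Prop :=
  ∀ η > (0 : ℝ), ∀ᶠ ε in 𝓝[>] (0 : ℝ), ∀ f ∈ signalClass ρ C₀,
    (∑' k : ℕ+, (1 - h ε k) * (2 * Real.pi * k) ^ 2 * coeff f k ^ 2) ^ 2 ≤
      η * ∑' k : ℕ+, (1 - h ε k) ^ 2 * (2 * Real.pi * k) ^ 2 * coeff f k ^ 2

end

end ShiftModel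

/-! Testing the observation against normalized cosines and sines centred at the true shift turns the
noise into independent standard normal pairs `(ξ_k, ζ_k)`. Write `w_k = 2πk`. With `u = τ - θ`,
twice the criterion is `crit`, namely `∑ h_k ((f_k + ε ξ_k) cos(w_k u) + ε ζ_k sin(w_k u))²`. Half
its derivative is `ε N - (D + ε Z) u - 2 ε u² V` up to `|u|³ Q`, where `N`, `D`, `Z`, `V`, `Q` are
`score`, `filteredInfo`, `curvature`, `thirdDeriv` and `fourthBound`.

Put `l² = log ε⁻²`. Comparing the values of the criterion at the maximizer and at the true shift,
and using only the signal at frequency one, gives `|u| = O(ε |N|) = O(ε l)` outside an event of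
probability `O(ε²⁴)` (`abs_le_of_crit_zero_le`, `measureReal_badEvent_le`). The margin `δ` then
makes the maximizer interior, so the derivative vanishes there. Solving the root equation to second
order gives (`abs_sq_root_expansion_le`) `D² u² = ε² N² - (2ε³/D) N² Z - (4ε⁴/D²) N³ V + O(ε⁴ l⁴)`,
where the last term carries a random factor of bounded mean.

Independence gives `E N² = ∑ h_k² w_k² (f_k² + ε²)`, `E N³ V = O(1)` and `E N² Z = O(ε)`, the last
by a parity cancellation. On the exceptional event a polynomial bound in the noise suffices. Hence
`D² E u² = ε² ∑ h_k² w_k² (f_k² + ε²) + O(ε⁴ l⁴)` (`IsAdmissible.abs_integral_sq_sub_le`).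

Finally let `A = ‖f'‖²`, `B = A - D = ∑ (1 - h_k) w_k² f_k²`, `C = ∑ (1 - h_k)² w_k² f_k²` and `S =
∑ h_k² w_k²`. The sum above is `A - 2B + C + ε² S`, and `A (A - 2B) = D² - B²`. Dividing by `D²`,
the normalized risk is `1 + (C + ε² S)/A` plus errors governed by `B`, by `B²` and by `ε² l⁴`.
Assumption C makes `B² = o(C)` and, since `C ≤ B`, also `B = o(1)`. Assumption B makes `S` at least
of order `l⁸`, so `ε² l⁴ = o(ε² S)` (`exists_risk_ratio`, `eventually_risk_expansion`). -/

namespace ShiftModel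

/-! ### Random variables with moments of all orders -/

section Moments

open scoped NNReal ENNReal

variable {Ω : Type*} [MeasurableSpace Ω] {P : Measure Ω}

/-- Real random variables with finite absolute moments of all orders. -/
def HasMoments (P : Measure Ω) (X : Ω → ℝ) : Prop := ∀ p : ℝ≥0, MemLp X p P

namespace HasMoments

variable {X Y : Ω → ℝ}

theorem const [IsFiniteMeasure P] (c : ℝ) : HasMoments P (fun _ => c) := fun _ => memLp_const c

theorem add (hX : HasMoments P X) (hY : HasMoments P Y) :
    HasMoments P (fun ω => X ω + Y ω) := fun p => (hX p).add (hY p)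

theorem sub (hX : HasMoments P X) (hY : HasMoments P Y) :
    HasMoments P (fun ω => X ω - Y ω) := fun p => (hX p).sub (hY p)

theorem mul (hX : HasMoments P X) (hY : HasMoments P Y) :
    HasMoments P (fun ω => X ω * Y ω) := fun p => by
  have : ENNReal.HolderTriple ((2 * p : ℝ≥0) : ℝ≥0∞) ((2 * p : ℝ≥0) : ℝ≥0∞) (p : ℝ≥0∞) := by
    constructor
    rw [ENNReal.coe_mul, ENNReal.mul_inv (by simp) (by simp), ← add_mul]
    simp [ENNReal.inv_two_add_inv_two]
  exact (hY (2 * p)).mul' (hX (2 * p))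

theorem const_mul (hX : HasMoments P X) (c : ℝ) : HasMoments P (fun ω => c * X ω) :=
  fun p => (hX p).const_mul c

theorem pow [IsFiniteMeasure P] (hX : HasMoments P X) (n : ℕ) :
    HasMoments P (fun ω => X ω ^ n) := by
  induction n with
  | zero => simpa using const (P := P) 1
  | succ n ih => simpa only [pow_succ] using ih.mul hX

theorem sum {ι : Type*} {X : ι → Ω → ℝ} (s : Finset ι) (hX : ∀ i ∈ s, HasMoments P (X i)) :
    HasMoments P (fun ω => ∑ i ∈ s, X i ω) := fun p => memLp_finsetSum s fun i hi => hX i hi p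

theorem abs (hX : HasMoments P X) : HasMoments P (fun ω => |X ω|) := fun p => (hX p).abs

theorem integrable (hX : HasMoments P X) : Integrable X P :=
  memLp_one_iff_integrable.1 (by simpa using hX 1)

end HasMoments

theorem integral_monomial_of_indepFun {A B X Y : Ω → ℝ}
    (h : IndepFun (fun ω => (A ω, B ω)) (fun ω => (X ω, Y ω)) P)
    (hA : Measurable A) (hB : Measurable B) (hX : Measurable X) (hY : Measurable Y) (a b c d : ℕ) :
    ∫ ω, A ω ^ a * B ω ^ b * (X ω ^ c * Y ω ^ d) ∂P =
      (∫ ω, A ω ^ a * B ω ^ b ∂P) * ∫ ω, X ω ^ c * Y ω ^ d ∂P := by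
  have := (h.comp (φ := fun p : ℝ × ℝ => p.1 ^ a * p.2 ^ b)
    (ψ := fun p : ℝ × ℝ => p.1 ^ c * p.2 ^ d) (by fun_prop) (by fun_prop))
  exact this.integral_fun_mul_eq_mul_integral (by simp only [Function.comp_def]; fun_prop)
    (by simp only [Function.comp_def]; fun_prop)

end Moments

/-! ### Mixed moments of sums of independent centred pairs -/

section IndependentSums

variable {Ω ι : Type*} [MeasurableSpace Ω] {P : Measure Ω} {X Y : ι → Ω → ℝ}

/-- A family of independent pairs of centred random variables with moments of all orders. -/
structure IndepCentredPairs (P : Measure Ω) (X Y : ι → Ω → ℝ) : Prop where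
  measurable_fst : ∀ i, Measurable (X i)
  measurable_snd : ∀ i, Measurable (Y i)
  indep : iIndepFun (fun i ω => (X i ω, Y i ω)) P
  moments_fst : ∀ i, HasMoments P (X i)
  moments_snd : ∀ i, HasMoments P (Y i)
  centred_fst : ∀ i, ∫ ω, X i ω ∂P = 0
  centred_snd : ∀ i, ∫ ω, Y i ω ∂P = 0

namespace IndepCentredPairs

theorem indepFun_sum (h : IndepCentredPairs P X Y) {s : Finset ι} {i : ι} (hi : i ∉ s) :
    IndepFun (fun ω => (∑ j ∈ s, X j ω, ∑ j ∈ s, Y j ω)) (fun ω => (X i ω, Y i ω)) P := by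
  have := h.indep.indepFun_finsetSum_of_notMem
    (fun i => (h.measurable_fst i).prodMk (h.measurable_snd i)) hi
  convert! this using 1
  ext ω <;> simp [Prod.fst_sum, Prod.snd_sum]

theorem integral_monomial (h : IndepCentredPairs P X Y) {s : Finset ι} {i : ι} (hi : i ∉ s)
    (a b c d : ℕ) :
    ∫ ω, (∑ j ∈ s, X j ω) ^ a * (∑ j ∈ s, Y j ω) ^ b * (X i ω ^ c * Y i ω ^ d) ∂P =
      (∫ ω, (∑ j ∈ s, X j ω) ^ a * (∑ j ∈ s, Y j ω) ^ b ∂P) * ∫ ω, X i ω ^ c * Y i ω ^ d ∂P :=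
  integral_monomial_of_indepFun (h.indepFun_sum hi)
    (Finset.measurable_fun_sum _ fun i _ => h.measurable_fst i)
    (Finset.measurable_fun_sum _ fun i _ => h.measurable_snd i)
    (h.measurable_fst i) (h.measurable_snd i) a b c d

theorem integrable_monomial [IsFiniteMeasure P] (h : IndepCentredPairs P X Y) (s : Finset ι) (i : ι)
    (a b c d : ℕ) :
    Integrable (fun ω => (∑ j ∈ s, X j ω) ^ a * (∑ j ∈ s, Y j ω) ^ b * (X i ω ^ c * Y i ω ^ d)) P :=
  ((((HasMoments.sum s fun j _ => h.moments_fst j).pow a).mul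
    ((HasMoments.sum s fun j _ => h.moments_snd j).pow b)).mul
    (((h.moments_fst i).pow c).mul ((h.moments_snd i).pow d))).integrable

theorem integral_sum_fst (h : IndepCentredPairs P X Y) (s : Finset ι) :
    ∫ ω, ∑ j ∈ s, X j ω ∂P = 0 := by
  rw [integral_finsetSum _ fun j _ => (h.moments_fst j).integrable]
  exact Finset.sum_eq_zero fun j _ => h.centred_fst j

theorem integral_sum_snd (h : IndepCentredPairs P X Y) (s : Finset ι) :
    ∫ ω, ∑ j ∈ s, Y j ω ∂P = 0 := by
  rw [integral_finsetSum _ fun j _ => (h.moments_snd j).integrable]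
  exact Finset.sum_eq_zero fun j _ => h.centred_snd j

variable [IsProbabilityMeasure P]

theorem integral_sum_mul_sum (h : IndepCentredPairs P X Y) (s : Finset ι) :
    ∫ ω, (∑ j ∈ s, X j ω) * ∑ j ∈ s, Y j ω ∂P = ∑ j ∈ s, ∫ ω, X j ω * Y j ω ∂P := by
  classical
  induction s using Finset.induction_on with
  | empty => simp
  | insert i s hi ih =>
    have I := h.integrable_monomial s i
    have M := h.integral_monomial hi
    have e : ∀ ω, (∑ j ∈ insert i s, X j ω) * (∑ j ∈ insert i s, Y j ω) =
        ((∑ j ∈ s, X j ω) ^ 0 * (∑ j ∈ s, Y j ω) ^ 0 * (X i ω ^ 1 * Y i ω ^ 1) +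
        (∑ j ∈ s, X j ω) ^ 1 * (∑ j ∈ s, Y j ω) ^ 1 * (X i ω ^ 0 * Y i ω ^ 0)) +
        ((∑ j ∈ s, X j ω) ^ 1 * (∑ j ∈ s, Y j ω) ^ 0 * (X i ω ^ 0 * Y i ω ^ 1) +
        (∑ j ∈ s, X j ω) ^ 0 * (∑ j ∈ s, Y j ω) ^ 1 * (X i ω ^ 1 * Y i ω ^ 0)) := fun ω => by
      rw [Finset.sum_insert hi, Finset.sum_insert hi]; ring
    simp_rw [e]
    rw [integral_add ((I 0 0 1 1).fun_add (I 1 1 0 0)) ((I 1 0 0 1).fun_add (I 0 1 1 0)),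
      integral_add (I 0 0 1 1) (I 1 1 0 0), integral_add (I 1 0 0 1) (I 0 1 1 0),
      M, M, M, M, Finset.sum_insert hi]
    simp [ih, h.integral_sum_fst, h.integral_sum_snd]

/-- In a product of three centred factors with indices not all equal, some index occurs exactly
once, and independence kills that term. -/
theorem integral_sum_sq_mul_sum (h : IndepCentredPairs P X Y) (s : Finset ι) :
    ∫ ω, (∑ j ∈ s, X j ω) ^ 2 * ∑ j ∈ s, Y j ω ∂P = ∑ j ∈ s, ∫ ω, X j ω ^ 2 * Y j ω ∂P := by
  classical
  induction s using Finset.induction_on with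
  | empty => simp
  | insert i s hi ih =>
    have I := h.integrable_monomial s i
    have M := h.integral_monomial hi
    have e : ∀ ω, (∑ j ∈ insert i s, X j ω) ^ 2 * (∑ j ∈ insert i s, Y j ω) =
        ((∑ j ∈ s, X j ω) ^ 0 * (∑ j ∈ s, Y j ω) ^ 0 * (X i ω ^ 2 * Y i ω ^ 1) +
        (∑ j ∈ s, X j ω) ^ 2 * (∑ j ∈ s, Y j ω) ^ 1 * (X i ω ^ 0 * Y i ω ^ 0)) +
        (((∑ j ∈ s, X j ω) ^ 0 * (∑ j ∈ s, Y j ω) ^ 1 * (X i ω ^ 2 * Y i ω ^ 0) +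
        2 * ((∑ j ∈ s, X j ω) ^ 1 * (∑ j ∈ s, Y j ω) ^ 0 * (X i ω ^ 1 * Y i ω ^ 1))) +
        (2 * ((∑ j ∈ s, X j ω) ^ 1 * (∑ j ∈ s, Y j ω) ^ 1 * (X i ω ^ 1 * Y i ω ^ 0)) +
        (∑ j ∈ s, X j ω) ^ 2 * (∑ j ∈ s, Y j ω) ^ 0 * (X i ω ^ 0 * Y i ω ^ 1))) := fun ω => by
      rw [Finset.sum_insert hi, Finset.sum_insert hi]; ring
    simp_rw [e]
    rw [integral_add ((I 0 0 2 1).fun_add (I 2 1 0 0))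
        (((I 0 1 2 0).fun_add ((I 1 0 1 1).const_mul 2)).fun_add
          (((I 1 1 1 0).const_mul 2).fun_add (I 2 0 0 1))),
      integral_add (I 0 0 2 1) (I 2 1 0 0),
      integral_add ((I 0 1 2 0).fun_add ((I 1 0 1 1).const_mul 2))
        (((I 1 1 1 0).const_mul 2).fun_add (I 2 0 0 1)),
      integral_add (I 0 1 2 0) ((I 1 0 1 1).const_mul 2),
      integral_add ((I 1 1 1 0).const_mul 2) (I 2 0 0 1), integral_const_mul, integral_const_mul,
      M, M, M, M, M, M, Finset.sum_insert hi]
    simp [ih, h.integral_sum_fst, h.integral_sum_snd, h.centred_fst, h.centred_snd]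

theorem integral_sum_sq (h : IndepCentredPairs P X Y) (s : Finset ι) :
    ∫ ω, (∑ j ∈ s, X j ω) ^ 2 ∂P = ∑ j ∈ s, ∫ ω, X j ω ^ 2 ∂P := by
  have h' : IndepCentredPairs P X X :=
    ⟨h.measurable_fst, h.measurable_fst,
      h.indep.comp (fun _ p => (p.1, p.1)) (fun _ => by fun_prop),
      h.moments_fst, h.moments_fst, h.centred_fst, h.centred_fst⟩
  simpa only [sq] using h'.integral_sum_mul_sum s

/-- With four centred factors the surviving index patterns are all equal, or two distinct pairs.
There are three pairings of the fourth factor with one of the first three. The bound sums the pairs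
over all indices, including the diagonal, which only enlarges it. -/
theorem abs_integral_sum_cube_mul_sum_le (h : IndepCentredPairs P X Y) (s : Finset ι) :
    |∫ ω, (∑ j ∈ s, X j ω) ^ 3 * ∑ j ∈ s, Y j ω ∂P| ≤
      (∑ j ∈ s, ∫ ω, |X j ω ^ 3 * Y j ω| ∂P) +
        3 * (∑ j ∈ s, ∫ ω, X j ω ^ 2 ∂P) * ∑ j ∈ s, ∫ ω, |X j ω * Y j ω| ∂P := by
  classical
  induction s using Finset.induction_on with
  | empty => simp
  | insert i s hi ih =>
    have I := h.integrable_monomial s i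
    have M := h.integral_monomial hi
    have e : ∀ ω, (∑ j ∈ insert i s, X j ω) ^ 3 * (∑ j ∈ insert i s, Y j ω) =
        ((∑ j ∈ s, X j ω) ^ 0 * (∑ j ∈ s, Y j ω) ^ 0 * (X i ω ^ 3 * Y i ω ^ 1) +
        (∑ j ∈ s, X j ω) ^ 3 * (∑ j ∈ s, Y j ω) ^ 1 * (X i ω ^ 0 * Y i ω ^ 0)) +
        (((∑ j ∈ s, X j ω) ^ 0 * (∑ j ∈ s, Y j ω) ^ 1 * (X i ω ^ 3 * Y i ω ^ 0) +
        (∑ j ∈ s, X j ω) ^ 3 * (∑ j ∈ s, Y j ω) ^ 0 * (X i ω ^ 0 * Y i ω ^ 1)) +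
        3 * (((∑ j ∈ s, X j ω) ^ 2 * (∑ j ∈ s, Y j ω) ^ 0 * (X i ω ^ 1 * Y i ω ^ 1) +
        (∑ j ∈ s, X j ω) ^ 1 * (∑ j ∈ s, Y j ω) ^ 1 * (X i ω ^ 2 * Y i ω ^ 0)) +
        ((∑ j ∈ s, X j ω) ^ 2 * (∑ j ∈ s, Y j ω) ^ 1 * (X i ω ^ 1 * Y i ω ^ 0) +
        (∑ j ∈ s, X j ω) ^ 1 * (∑ j ∈ s, Y j ω) ^ 0 * (X i ω ^ 2 * Y i ω ^ 1)))) := fun ω => by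
      rw [Finset.sum_insert hi, Finset.sum_insert hi]; ring
    simp_rw [e]
    rw [integral_add ((I 0 0 3 1).fun_add (I 3 1 0 0))
        (((I 0 1 3 0).fun_add (I 3 0 0 1)).fun_add
          ((((I 2 0 1 1).fun_add (I 1 1 2 0)).fun_add ((I 2 1 1 0).fun_add (I 1 0 2 1))).const_mul 3)),
      integral_add (I 0 0 3 1) (I 3 1 0 0),
      integral_add ((I 0 1 3 0).fun_add (I 3 0 0 1))
        ((((I 2 0 1 1).fun_add (I 1 1 2 0)).fun_add ((I 2 1 1 0).fun_add (I 1 0 2 1))).const_mul 3),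
      integral_add (I 0 1 3 0) (I 3 0 0 1), integral_const_mul,
      integral_add ((I 2 0 1 1).fun_add (I 1 1 2 0)) ((I 2 1 1 0).fun_add (I 1 0 2 1)),
      integral_add (I 2 0 1 1) (I 1 1 2 0), integral_add (I 2 1 1 0) (I 1 0 2 1),
      M, M, M, M, M, M, M, M, Finset.sum_insert hi, Finset.sum_insert hi, Finset.sum_insert hi]
    simp only [pow_zero, pow_one, one_mul, mul_one, integral_const, probReal_univ, smul_eq_mul,
      h.integral_sum_fst, h.integral_sum_snd, h.centred_fst, h.centred_snd, mul_zero, zero_mul,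
      add_zero, zero_add, h.integral_sum_sq, h.integral_sum_mul_sum]
    set a := ∑ j ∈ s, ∫ ω, X j ω ^ 2 ∂P
    set b := ∫ ω, X i ω ^ 2 ∂P
    set c := ∑ j ∈ s, ∫ ω, |X j ω * Y j ω| ∂P
    set d := ∫ ω, |X i ω * Y i ω| ∂P
    have ha : 0 ≤ a := Finset.sum_nonneg fun j _ => integral_nonneg fun ω => sq_nonneg _
    have hb : 0 ≤ b := integral_nonneg fun ω => sq_nonneg _
    have hd : |∫ ω, X i ω * Y i ω ∂P| ≤ d := abs_integral_le_integral_abs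
    have hd0 : 0 ≤ d := (abs_nonneg _).trans hd
    have hc : |∑ j ∈ s, ∫ ω, X j ω * Y j ω ∂P| ≤ c :=
      (Finset.abs_sum_le_sum_abs _ _).trans
        (Finset.sum_le_sum fun j _ => abs_integral_le_integral_abs)
    have h3 : |∫ ω, X i ω ^ 3 * Y i ω ∂P| ≤ ∫ ω, |X i ω ^ 3 * Y i ω| ∂P :=
      abs_integral_le_integral_abs
    have t1 : |a * ∫ ω, X i ω * Y i ω ∂P| ≤ a * d := by
      rw [abs_mul, abs_of_nonneg ha]; gcongr
    have t2 : |(∑ j ∈ s, ∫ ω, X j ω * Y j ω ∂P) * b| ≤ c * b := by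
      rw [abs_mul, abs_of_nonneg hb]; gcongr
    rw [abs_le] at *
    -- The diagonal product occurs on the right only, so its sign is all that matters.
    have : 0 ≤ b * d := mul_nonneg hb hd0
    constructor <;> nlinarith

end IndepCentredPairs

end IndependentSums

/-! ### Taylor bounds for one rotated summand of the criterion -/

section TrigExpansion

theorem abs_sub_sin_two_mul_half_le (v : ℝ) : |v - Real.sin (2 * v) / 2| ≤ |v| ^ 3 := by
  have key : ∀ t : ℝ, 0 ≤ t → |t - Real.sin (2 * t) / 2| ≤ t ^ 3 := fun t ht => by
    have h1 := Real.sin_ge_sub_cube (x := 2 * t) (by linarith)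
    have h2 := Real.sin_le (x := 2 * t) (by linarith)
    have h3 : 0 ≤ t ^ 3 := by positivity
    rw [abs_le]; constructor <;> nlinarith
  rcases le_total 0 v with hv | hv
  · rw [abs_of_nonneg hv]; exact key v hv
  · rw [abs_of_nonpos hv]
    have := key (-v) (by linarith)
    rwa [mul_neg, Real.sin_neg, neg_div, sub_neg_eq_add, ← abs_neg, neg_add, neg_neg,
      ← sub_eq_add_neg] at this

theorem abs_cos_two_mul_sub_le (v : ℝ) : |Real.cos (2 * v) - 1 + 2 * v ^ 2| ≤ 8 * |v| ^ 3 := by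
  have h1 := Real.one_sub_sq_div_two_le_cos (x := 2 * v)
  rw [abs_of_nonneg (by nlinarith)]
  have h3 : |v| ^ 3 = |v| * v ^ 2 := by rw [pow_succ', sq_abs]
  rcases le_total |2 * v| 1 with hv | hv
  · have h2 := Real.cos_bound hv
    have h4 : |2 * v| ^ 4 = 16 * (|v| * |v| ^ 3) := by rw [abs_mul]; norm_num; ring
    have h5 : |v| ≤ 1 := by rw [abs_mul] at hv; norm_num at hv; linarith
    have h6 : |v| * |v| ^ 3 ≤ 1 * |v| ^ 3 := by gcongr
    have h7 := (abs_le.1 h2).2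
    nlinarith [pow_nonneg (abs_nonneg v) 3]
  · have h2 := Real.cos_le_one (2 * v)
    rw [abs_mul] at hv; norm_num at hv
    nlinarith [sq_nonneg v]

/-- The localization argument treats all `u` at once, so the error must be comparable with the
quadratic drift even for large `v`. There the cubic bound is too weak and boundedness of the sine
takes over. -/
theorem abs_sub_sin_two_mul_half_le_sq (v : ℝ) : |v - Real.sin (2 * v) / 2| ≤ 2 * v ^ 2 := by
  rcases le_total |v| 1 with hv | hv
  · refine (abs_sub_sin_two_mul_half_le v).trans ?_
    rw [pow_succ, sq_abs]
    nlinarith [sq_nonneg v]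
  · have h1 := abs_sub v (Real.sin (2 * v) / 2)
    have h2 : |Real.sin (2 * v) / 2| ≤ 1 / 2 := by
      rw [abs_div, abs_two]; linarith [Real.abs_sin_le_one (2 * v)]
    nlinarith [sq_abs v]

variable {ε w f x z : ℝ}

theorem abs_curvature_noise_le (hε : 0 ≤ ε) :
    |2 * f * x + ε * (x ^ 2 - z ^ 2)| ≤ (|f| + ε) * (1 + x ^ 2 + z ^ 2) := by
  set H := 1 + x ^ 2 + z ^ 2 with hH
  have hx : 2 * |x| ≤ H := by nlinarith [sq_abs x, sq_nonneg (|x| - 1), sq_nonneg z]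
  have h1 := abs_add_le (2 * f * x) (ε * (x ^ 2 - z ^ 2))
  have h2 : |2 * f * x| ≤ |f| * H := by
    rw [abs_mul, abs_mul, abs_two]; nlinarith [abs_nonneg f]
  have h3 : |ε * (x ^ 2 - z ^ 2)| ≤ ε * H := by
    rw [abs_mul, abs_of_nonneg hε]
    gcongr
    rw [abs_le]; constructor <;> nlinarith
  linarith

theorem abs_score_noise_le (hε : 0 ≤ ε) :
    |(f + ε * x) * z| ≤ (|f| + ε) * (1 + x ^ 2 + z ^ 2) / 2 := by
  set H := 1 + x ^ 2 + z ^ 2 with hH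
  have hz : 2 * |z| ≤ H := by nlinarith [sq_abs z, sq_nonneg (|z| - 1), sq_nonneg x]
  have hxz : 2 * (|x| * |z|) ≤ H := by nlinarith [sq_abs x, sq_abs z, sq_nonneg (|x| - |z|)]
  rw [abs_mul]
  have h1 : |f + ε * x| ≤ |f| + ε * |x| := by
    refine (abs_add_le _ _).trans ?_
    rw [abs_mul ε, abs_of_nonneg hε]
  have h2 : |f + ε * x| * |z| ≤ (|f| + ε * |x|) * |z| := by gcongr
  nlinarith [abs_nonneg f]

/-- The increment of one summand of the criterion: a quadratic main term, a part that is linear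
in the noise, and a remainder of second order in `u`. -/
theorem sq_sub_sq_rotation_ge (hε : 0 ≤ ε) (u : ℝ) :
    f ^ 2 * Real.sin (w * u) ^ 2 - 2 * ε * u * (w * ((f + ε * x) * z))
        - 4 * ε * u ^ 2 * (w ^ 2 * (|f| + ε) * (1 + x ^ 2 + z ^ 2)) ≤
      (f + ε * x) ^ 2 -
        ((f + ε * x) * Real.cos (w * u) + ε * z * Real.sin (w * u)) ^ 2 := by
  set H := 1 + x ^ 2 + z ^ 2 with hH
  have hS := Real.sin_sq_le_sq (x := w * u)
  have hr := abs_sub_sin_two_mul_half_le_sq (w * u)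
  rw [Real.sin_two_mul] at hr
  have hcs := Real.sin_sq_add_cos_sq (w * u)
  set S := Real.sin (w * u)
  set c := Real.cos (w * u)
  set v := w * u with hv
  -- Replacing `S c` by `v` isolates the part linear in `u`. What remains carries `S²` or `v - S c`,
  -- both of order `v²`.
  have e : (f + ε * x) ^ 2 - ((f + ε * x) * c + ε * z * S) ^ 2 =
      f ^ 2 * S ^ 2 - 2 * ε * u * (w * ((f + ε * x) * z)) +
        (ε * (S ^ 2 * (2 * f * x + ε * (x ^ 2 - z ^ 2))) +
          2 * ε * ((f + ε * x) * z * (v - 2 * S * c / 2))) := by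
    rw [hv]; linear_combination -(f + ε * x) ^ 2 * hcs
  rw [e]
  have b1 := abs_curvature_noise_le (f := f) (x := x) (z := z) hε
  have b2 := abs_score_noise_le (f := f) (x := x) (z := z) hε
  rw [← hH] at b1 b2
  have hfH : 0 ≤ (|f| + ε) * H := by positivity
  have c1 : |S ^ 2 * (2 * f * x + ε * (x ^ 2 - z ^ 2))| ≤ v ^ 2 * ((|f| + ε) * H) := by
    rw [abs_mul, abs_of_nonneg (sq_nonneg S)]; gcongr
  have c2 : |(f + ε * x) * z * (v - 2 * S * c / 2)| ≤ (|f| + ε) * H / 2 * (2 * v ^ 2) := by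
    rw [abs_mul]; gcongr
  have d1 := mul_le_mul_of_nonneg_left (neg_le_of_abs_le c1) hε
  have d2 := mul_le_mul_of_nonneg_left (neg_le_of_abs_le c2) hε
  have hpos : 0 ≤ ε * (v ^ 2 * ((|f| + ε) * H)) := by positivity
  have e3 : 4 * ε * u ^ 2 * (w ^ 2 * (|f| + ε) * H) = 4 * (ε * (v ^ 2 * ((|f| + ε) * H))) := by
    rw [hv]; ring
  rw [e3]
  nlinarith

/-- Third-order Taylor expansion of half the derivative of one summand of the criterion. -/
theorem abs_deriv_rotation_sub_le (hw : 0 ≤ w) (u : ℝ) :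
    |w * (((f + ε * x) * Real.cos (w * u) + ε * z * Real.sin (w * u)) *
          (-(f + ε * x) * Real.sin (w * u) + ε * z * Real.cos (w * u))) -
        (ε * (w * ((f + ε * x) * z))
          - (w ^ 2 * f ^ 2 + ε * (w ^ 2 * (2 * f * x + ε * (x ^ 2 - z ^ 2)))) * u
          - 2 * ε * u ^ 2 * (w ^ 3 * ((f + ε * x) * z)))| ≤
      |u| ^ 3 * (10 * (w ^ 4 * (f ^ 2 + ε ^ 2) * (1 + x ^ 2 + z ^ 2))) := by
  set H := 1 + x ^ 2 + z ^ 2 with hH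
  have hs := abs_sub_sin_two_mul_half_le (w * u)
  have hc := abs_cos_two_mul_sub_le (w * u)
  rw [Real.sin_two_mul] at hs
  rw [Real.cos_two_mul] at hc
  have hcs := Real.sin_sq_add_cos_sq (w * u)
  set S := Real.sin (w * u)
  set c := Real.cos (w * u)
  set y := f + ε * x with hy
  -- By the double-angle formulas the product is `-(y² - (εz)²) sin(2wu)/2 + y ε z cos(2wu)`, so
  -- only the Taylor remainders of these two functions are left.
  have e : w * ((y * c + ε * z * S) * (-y * S + ε * z * c)) -
        (ε * (w * (y * z))
          - (w ^ 2 * f ^ 2 + ε * (w ^ 2 * (2 * f * x + ε * (x ^ 2 - z ^ 2)))) * u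
          - 2 * ε * u ^ 2 * (w ^ 3 * (y * z))) =
      w * ((y ^ 2 - (ε * z) ^ 2) * (w * u - 2 * S * c / 2)
        + y * (ε * z) * (2 * c ^ 2 - 1 - 1 + 2 * (w * u) ^ 2)) := by
    rw [hy]; linear_combination (-(f + ε * x) * (ε * z) * w) * hcs
  rw [e, abs_mul, abs_of_nonneg hw]
  have hq : y ^ 2 + (ε * z) ^ 2 ≤ 2 * ((f ^ 2 + ε ^ 2) * H) := by
    have : y ^ 2 ≤ 2 * f ^ 2 + 2 * (ε * x) ^ 2 := by
      rw [hy]; nlinarith [sq_nonneg (f - ε * x)]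
    nlinarith [mul_nonneg (sq_nonneg f) (add_nonneg (sq_nonneg x) (sq_nonneg z)),
      sq_nonneg (ε * z), sq_nonneg (ε * x), sq_nonneg ε]
  have h1 : |y ^ 2 - (ε * z) ^ 2| ≤ y ^ 2 + (ε * z) ^ 2 := by
    rw [abs_le]; constructor <;> nlinarith [sq_nonneg y, sq_nonneg (ε * z)]
  have h2 : |y * (ε * z)| ≤ (y ^ 2 + (ε * z) ^ 2) / 2 := by
    rw [abs_le]
    constructor <;> nlinarith [sq_nonneg (y + ε * z), sq_nonneg (y - ε * z)]
  have hwu : |w * u| = w * |u| := by rw [abs_mul, abs_of_nonneg hw]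
  rw [hwu] at hs hc
  have hq0 : 0 ≤ y ^ 2 + (ε * z) ^ 2 := by positivity
  have h3 : |(y ^ 2 - (ε * z) ^ 2) * (w * u - 2 * S * c / 2)
        + y * (ε * z) * (2 * c ^ 2 - 1 - 1 + 2 * (w * u) ^ 2)| ≤
      (y ^ 2 + (ε * z) ^ 2) * (w * |u|) ^ 3
        + (y ^ 2 + (ε * z) ^ 2) / 2 * (8 * (w * |u|) ^ 3) := by
    refine (abs_add_le _ _).trans (add_le_add ?_ ?_)
    · rw [abs_mul]; gcongr
    · rw [abs_mul]; gcongr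
  have h4 : 0 ≤ w * (w * |u|) ^ 3 := by positivity
  calc w * |_| ≤ w * ((y ^ 2 + (ε * z) ^ 2) * (w * |u|) ^ 3
        + (y ^ 2 + (ε * z) ^ 2) / 2 * (8 * (w * |u|) ^ 3)) := by gcongr
    _ = 5 * (w * (w * |u|) ^ 3) * (y ^ 2 + (ε * z) ^ 2) := by ring
    _ ≤ 5 * (w * (w * |u|) ^ 3) * (2 * ((f ^ 2 + ε ^ 2) * H)) := by gcongr
    _ = _ := by ring

end TrigExpansion

/-! ### Standard normal pairs and envelope moments -/

section GaussianPairs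

variable {Ω ι : Type*} [MeasurableSpace Ω] {P : Measure Ω} {ξ ζ : ι → Ω → ℝ}

/-- The law of a pair of independent standard normal variables. -/
noncomputable abbrev stdPair : Measure (ℝ × ℝ) := (gaussianReal 0 1).prod (gaussianReal 0 1)

/-- Independent pairs of independent standard normal variables. -/
structure IsGaussianPairs (P : Measure Ω) (ξ ζ : ι → Ω → ℝ) : Prop where
  measurable_fst : ∀ i, Measurable (ξ i)
  measurable_snd : ∀ i, Measurable (ζ i)
  indep : iIndepFun (fun i ω => (ξ i ω, ζ i ω)) P
  map_eq : ∀ i, P.map (fun ω => (ξ i ω, ζ i ω)) = stdPair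

/-- The moments of `1 + x² + z²` under `stdPair`. -/
noncomputable def momentConst (p : ℕ) : ℝ := ∫ q, (1 + q.1 ^ 2 + q.2 ^ 2) ^ p ∂stdPair

theorem hasMoments_fst_stdPair : HasMoments stdPair Prod.fst := fun p =>
  (memLp_id_gaussianReal p).comp_measurePreserving measurePreserving_fst

theorem hasMoments_snd_stdPair : HasMoments stdPair Prod.snd := fun p =>
  (memLp_id_gaussianReal p).comp_measurePreserving measurePreserving_snd

theorem integral_fst_mul_sq_snd_stdPair : ∫ q, q.1 * q.2 ^ 2 ∂stdPair = 0 := by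
  rw [integral_prod_mul (fun x : ℝ => x) (fun x => x ^ 2)]
  simp

theorem integral_sq_gaussianReal : ∫ x, x ^ 2 ∂(gaussianReal 0 1) = 1 := by
  have h := variance_fun_id_gaussianReal (μ := 0) (v := 1)
  rw [variance_eq_integral measurable_id'.aemeasurable] at h
  simpa using h

theorem one_le_momentConst (p : ℕ) : 1 ≤ momentConst p := by
  have h : Integrable (fun q : ℝ × ℝ => (1 + q.1 ^ 2 + q.2 ^ 2) ^ p) stdPair :=
    ((((HasMoments.const 1).add (hasMoments_fst_stdPair.pow 2)).add
      (hasMoments_snd_stdPair.pow 2)).pow p).integrable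
  calc (1 : ℝ) = ∫ _, (1 : ℝ) ∂stdPair := by simp
    _ ≤ _ := integral_mono (integrable_const _) h fun q =>
      one_le_pow₀ (by nlinarith [sq_nonneg q.1, sq_nonneg q.2])

namespace IsGaussianPairs

theorem integral_comp (h : IsGaussianPairs P ξ ζ) (i : ι) {g : ℝ × ℝ → ℝ} (hg : Measurable g) :
    ∫ ω, g (ξ i ω, ζ i ω) ∂P = ∫ q, g q ∂stdPair := by
  rw [← h.map_eq i, integral_map ((h.measurable_fst i).prodMk (h.measurable_snd i)).aemeasurable
    hg.aestronglyMeasurable]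

theorem hasMoments_fst (h : IsGaussianPairs P ξ ζ) (i : ι) : HasMoments P (ξ i) := fun p =>
  (hasMoments_fst_stdPair p).comp_measurePreserving
    (f := fun ω => (ξ i ω, ζ i ω)) ⟨(h.measurable_fst i).prodMk (h.measurable_snd i), h.map_eq i⟩

theorem hasMoments_snd (h : IsGaussianPairs P ξ ζ) (i : ι) : HasMoments P (ζ i) := fun p =>
  (hasMoments_snd_stdPair p).comp_measurePreserving
    (f := fun ω => (ξ i ω, ζ i ω)) ⟨(h.measurable_fst i).prodMk (h.measurable_snd i), h.map_eq i⟩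

theorem integral_envelope_pow (h : IsGaussianPairs P ξ ζ) (i : ι) (p : ℕ) :
    ∫ ω, (1 + ξ i ω ^ 2 + ζ i ω ^ 2) ^ p ∂P = momentConst p :=
  h.integral_comp i (g := fun q => (1 + q.1 ^ 2 + q.2 ^ 2) ^ p) (by fun_prop)

variable [IsProbabilityMeasure P]

theorem hasMoments_envelope (h : IsGaussianPairs P ξ ζ) (i : ι) :
    HasMoments P (fun ω => 1 + ξ i ω ^ 2 + ζ i ω ^ 2) :=
  ((HasMoments.const 1).add ((h.hasMoments_fst i).pow 2)).add ((h.hasMoments_snd i).pow 2)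

/-- Jensen's inequality with the normalized weights `w i / W`; independence between frequencies
plays no role. A vanishing total weight has to be treated apart. -/
theorem integral_weighted_envelope_pow_le (h : IsGaussianPairs P ξ ζ) (s : Finset ι) {w : ι → ℝ}
    (hw : ∀ i ∈ s, 0 ≤ w i) (p : ℕ) :
    ∫ ω, (∑ i ∈ s, w i * (1 + ξ i ω ^ 2 + ζ i ω ^ 2)) ^ p ∂P ≤
      (∑ i ∈ s, w i) ^ p * momentConst p := by
  rcases (Finset.sum_nonneg hw).eq_or_lt with h0 | h0
  · have hz := (Finset.sum_eq_zero_iff_of_nonneg hw).1 h0.symm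
    have e : ∀ ω, ∑ i ∈ s, w i * (1 + ξ i ω ^ 2 + ζ i ω ^ 2) = 0 := fun ω =>
      Finset.sum_eq_zero fun i hi => by rw [hz i hi, zero_mul]
    simp only [e, ← h0, integral_const, probReal_univ, one_smul]
    exact le_mul_of_one_le_right (by positivity) (one_le_momentConst p)
  · set W := ∑ i ∈ s, w i
    have key : ∀ ω, (∑ i ∈ s, w i * (1 + ξ i ω ^ 2 + ζ i ω ^ 2)) ^ p ≤
        W ^ p * ∑ i ∈ s, w i / W * (1 + ξ i ω ^ 2 + ζ i ω ^ 2) ^ p := fun ω => by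
      have := Real.pow_arith_mean_le_arith_mean_pow s (fun i => w i / W)
        (fun i => 1 + ξ i ω ^ 2 + ζ i ω ^ 2) (fun i hi => div_nonneg (hw i hi) h0.le)
        (by rw [← Finset.sum_div, div_self h0.ne']) (fun i _ => by positivity) p
      calc _ = W ^ p * (∑ i ∈ s, w i / W * (1 + ξ i ω ^ 2 + ζ i ω ^ 2)) ^ p := by
            rw [← mul_pow, Finset.mul_sum]
            congr 1
            exact Finset.sum_congr rfl fun i _ => by field_simp
        _ ≤ _ := by gcongr
    have hI : ∀ i, Integrable (fun ω => w i / W * (1 + ξ i ω ^ 2 + ζ i ω ^ 2) ^ p) P := fun i =>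
      (((h.hasMoments_envelope i).pow p).const_mul _).integrable
    calc _ ≤ ∫ ω, W ^ p * ∑ i ∈ s, w i / W * (1 + ξ i ω ^ 2 + ζ i ω ^ 2) ^ p ∂P :=
          integral_mono (((HasMoments.sum s fun i _ =>
            (h.hasMoments_envelope i).const_mul (w i)).pow p).integrable)
            ((integrable_finsetSum _ fun i _ => hI i).const_mul _) key
      _ = W ^ p * momentConst p := by
          rw [integral_const_mul, integral_finsetSum _ fun i _ => hI i]
          simp_rw [integral_const_mul, h.integral_envelope_pow]
          rw [← Finset.sum_mul, ← Finset.sum_div, div_self h0.ne', one_mul]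

end IsGaussianPairs

end GaussianPairs

/-! ### Moments and tails of score and curvature sums -/

section ModelMoments

variable {Ω ι : Type*} [MeasurableSpace Ω] {P : Measure Ω} {ξ ζ : ι → Ω → ℝ}

theorem integral_affine_mul_stdPair (f ε : ℝ) : ∫ q, (f + ε * q.1) * q.2 ∂stdPair = 0 := by
  rw [integral_prod_mul (fun x : ℝ => f + ε * x) (fun x => x)]
  simp

theorem integral_affine_sq_mul_sq_stdPair (f ε : ℝ) :
    ∫ q, ((f + ε * q.1) * q.2) ^ 2 ∂stdPair = f ^ 2 + ε ^ 2 := by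
  simp_rw [mul_pow _ _ 2]
  rw [integral_prod_mul (fun x : ℝ => (f + ε * x) ^ 2) (fun x => x ^ 2), integral_sq_gaussianReal,
    mul_one]
  have hid : HasMoments (gaussianReal 0 1) (fun x : ℝ => x) := fun p => memLp_id_gaussianReal p
  have e : ∀ x : ℝ, (f + ε * x) ^ 2 = (f ^ 2 + 2 * f * ε * x) + ε ^ 2 * x ^ 2 := fun x => by ring
  simp_rw [e]
  rw [integral_add ((HasMoments.const (f ^ 2)).add (hid.const_mul _)).integrable
    ((hid.pow 2).const_mul _).integrable,
    integral_add (HasMoments.const (f ^ 2)).integrable (hid.const_mul _).integrable,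
    integral_const_mul, integral_const_mul, integral_sq_gaussianReal]
  simp

theorem integral_curvature_stdPair (f ε : ℝ) :
    ∫ q, (2 * f * q.1 + ε * (q.1 ^ 2 - q.2 ^ 2)) ∂stdPair = 0 := by
  have h1 := hasMoments_fst_stdPair
  have h2 := hasMoments_snd_stdPair
  have e1 : ∫ q, q.1 ∂stdPair = 0 := by
    have := integral_prod_mul (μ := gaussianReal 0 1) (ν := gaussianReal 0 1)
      (fun x : ℝ => x) (fun _ => (1 : ℝ))
    simpa using this
  have e2 : ∫ q, q.1 ^ 2 ∂stdPair = 1 := by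
    have := integral_prod_mul (μ := gaussianReal 0 1) (ν := gaussianReal 0 1)
      (fun x : ℝ => x ^ 2) (fun _ => (1 : ℝ))
    simpa [integral_sq_gaussianReal] using this
  have e3 : ∫ q, q.2 ^ 2 ∂stdPair = 1 := by
    have := integral_prod_mul (μ := gaussianReal 0 1) (ν := gaussianReal 0 1)
      (fun _ => (1 : ℝ)) (fun x : ℝ => x ^ 2)
    simpa [integral_sq_gaussianReal] using this
  rw [integral_add (h1.const_mul _).integrable (((h1.pow 2).sub (h2.pow 2)).const_mul _).integrable,
    integral_const_mul, integral_const_mul,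
    integral_sub (h1.pow 2).integrable (h2.pow 2).integrable, e1, e2, e3]
  simp

theorem sq_abs_add_le (f ε : ℝ) : (|f| + ε) ^ 2 ≤ 2 * (f ^ 2 + ε ^ 2) := by
  nlinarith [sq_abs f, sq_nonneg (|f| - ε)]

/-- The only term without a factor `ε` is `2 f³ x z²`, which is odd in `x` and has mean zero. This
extra `ε` brings the correction `ε³ E N² Z` down to the order `ε⁴`. -/
theorem abs_integral_score_sq_mul_curvature_le (f : ℝ) {ε : ℝ} (hε : 0 ≤ ε) :
    |∫ q, ((f + ε * q.1) * q.2) ^ 2 * (2 * f * q.1 + ε * (q.1 ^ 2 - q.2 ^ 2)) ∂stdPair| ≤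
      ε * (9 * (f ^ 2 + ε ^ 2) * momentConst 3) := by
  have h1 := hasMoments_fst_stdPair
  have h2 := hasMoments_snd_stdPair
  set R : ℝ × ℝ → ℝ := fun q => f ^ 2 * q.2 ^ 2 * (q.1 ^ 2 - q.2 ^ 2)
    + (2 * f * q.1 + ε * q.1 ^ 2) * q.2 ^ 2 * (2 * f * q.1 + ε * (q.1 ^ 2 - q.2 ^ 2)) with hR
  have e : ∀ q : ℝ × ℝ, ((f + ε * q.1) * q.2) ^ 2 * (2 * f * q.1 + ε * (q.1 ^ 2 - q.2 ^ 2)) =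
      2 * f ^ 3 * (q.1 * q.2 ^ 2) + ε * R q := fun q => by simp only [hR]; ring
  have mR : HasMoments stdPair R :=
    (((h2.pow 2).const_mul _).mul ((h1.pow 2).sub (h2.pow 2))).add
      ((((h1.const_mul _).add ((h1.pow 2).const_mul _)).mul (h2.pow 2)).mul
        ((h1.const_mul _).add (((h1.pow 2).sub (h2.pow 2)).const_mul _)))
  simp_rw [e]
  rw [integral_add ((h1.mul (h2.pow 2)).const_mul _).integrable (mR.const_mul _).integrable,
    integral_const_mul, integral_fst_mul_sq_snd_stdPair, mul_zero, zero_add, integral_const_mul,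
    abs_mul, abs_of_nonneg hε]
  gcongr
  have hb : ∀ q, |R q| ≤ 9 * (f ^ 2 + ε ^ 2) * (1 + q.1 ^ 2 + q.2 ^ 2) ^ 3 := fun q => by
    simp only [hR]
    obtain ⟨x, z⟩ := q
    simp only
    set H := 1 + x ^ 2 + z ^ 2 with hH
    have hH1 : 1 ≤ H := by nlinarith [sq_nonneg x, sq_nonneg z]
    have hz2 : z ^ 2 ≤ H := by nlinarith [sq_nonneg x]
    have hx : 2 * |x| ≤ H := by nlinarith [sq_abs x, sq_nonneg (|x| - 1), sq_nonneg z]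
    have hxz : |x ^ 2 - z ^ 2| ≤ H := by rw [abs_le]; constructor <;> nlinarith [sq_nonneg x]
    have hc := abs_curvature_noise_le (f := f) (x := x) (z := z) hε
    have ha : |2 * f * x + ε * x ^ 2| ≤ (|f| + ε) * H := by
      refine (abs_add_le _ _).trans ?_
      rw [abs_mul, abs_mul, abs_two, abs_mul, abs_of_nonneg hε, abs_of_nonneg (sq_nonneg x)]
      have : x ^ 2 ≤ H := by nlinarith [sq_nonneg z]
      nlinarith [abs_nonneg f, mul_le_mul_of_nonneg_left this hε]
    have t1 : |f ^ 2 * z ^ 2 * (x ^ 2 - z ^ 2)| ≤ f ^ 2 * H * H := by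
      rw [abs_mul, abs_mul, abs_of_nonneg (sq_nonneg f), abs_of_nonneg (sq_nonneg z)]; gcongr
    have t2 : |(2 * f * x + ε * x ^ 2) * z ^ 2 * (2 * f * x + ε * (x ^ 2 - z ^ 2))| ≤
        (|f| + ε) * H * H * ((|f| + ε) * H) := by
      rw [abs_mul, abs_mul, abs_of_nonneg (sq_nonneg z)]; gcongr
    have t3 := sq_abs_add_le f ε
    have t4 : (|f| + ε) ^ 2 * H ^ 3 ≤ 2 * (f ^ 2 + ε ^ 2) * H ^ 3 := by gcongr
    have t5 : f ^ 2 * H * H ≤ (f ^ 2 + ε ^ 2) * H ^ 3 := by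
      calc f ^ 2 * H * H = f ^ 2 * H ^ 2 := by ring
        _ ≤ (f ^ 2 + ε ^ 2) * H ^ 3 := by
          gcongr
          · exact le_add_of_nonneg_right (sq_nonneg ε)
          · norm_num
    have t6 : 0 ≤ (f ^ 2 + ε ^ 2) * H ^ 3 := by positivity
    refine (abs_add_le _ _).trans ?_
    nlinarith
  calc |∫ q, R q ∂stdPair| ≤ ∫ q, |R q| ∂stdPair := abs_integral_le_integral_abs
    _ ≤ ∫ q, 9 * (f ^ 2 + ε ^ 2) * (1 + q.1 ^ 2 + q.2 ^ 2) ^ 3 ∂stdPair :=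
      integral_mono mR.abs.integrable
        (((((HasMoments.const 1).add (h1.pow 2)).add (h2.pow 2)).pow 3).const_mul _).integrable hb
    _ = _ := by rw [integral_const_mul]; rfl

namespace IsGaussianPairs

theorem integral_score (h : IsGaussianPairs P ξ ζ) (a f ε : ℝ) (i : ι) :
    ∫ ω, a * ((f + ε * ξ i ω) * ζ i ω) ∂P = 0 := by
  rw [integral_const_mul, h.integral_comp i (g := fun q => (f + ε * q.1) * q.2) (by fun_prop),
    integral_affine_mul_stdPair, mul_zero]

variable [IsProbabilityMeasure P]

theorem hasMoments_score (h : IsGaussianPairs P ξ ζ) (a f ε : ℝ) (i : ι) :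
    HasMoments P (fun ω => a * ((f + ε * ξ i ω) * ζ i ω)) :=
  (((HasMoments.const f).add ((h.hasMoments_fst i).const_mul ε)).mul
    (h.hasMoments_snd i)).const_mul a

theorem hasMoments_curvature (h : IsGaussianPairs P ξ ζ) (c f ε : ℝ) (i : ι) :
    HasMoments P (fun ω => c * (2 * f * ξ i ω + ε * (ξ i ω ^ 2 - ζ i ω ^ 2))) :=
  (((h.hasMoments_fst i).const_mul _).add
    ((((h.hasMoments_fst i).pow 2).sub ((h.hasMoments_snd i).pow 2)).const_mul ε)).const_mul c

theorem indepCentredPairs_score_curvature (h : IsGaussianPairs P ξ ζ) (a c f : ι → ℝ) (ε : ℝ) :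
    IndepCentredPairs P (fun i ω => a i * ((f i + ε * ξ i ω) * ζ i ω))
      (fun i ω => c i * (2 * f i * ξ i ω + ε * (ξ i ω ^ 2 - ζ i ω ^ 2))) where
  measurable_fst i := by have := h.measurable_fst i; have := h.measurable_snd i; fun_prop
  measurable_snd i := by have := h.measurable_fst i; have := h.measurable_snd i; fun_prop
  indep := h.indep.comp (fun i q => (a i * ((f i + ε * q.1) * q.2),
    c i * (2 * f i * q.1 + ε * (q.1 ^ 2 - q.2 ^ 2)))) fun i => by fun_prop
  moments_fst i := h.hasMoments_score _ _ _ _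
  moments_snd i := h.hasMoments_curvature _ _ _ _
  centred_fst i := h.integral_score ..
  centred_snd i := by
    rw [integral_const_mul, h.integral_comp i
      (g := fun q => 2 * f i * q.1 + ε * (q.1 ^ 2 - q.2 ^ 2)) (by fun_prop),
      integral_curvature_stdPair, mul_zero]

theorem indepCentredPairs_score_score (h : IsGaussianPairs P ξ ζ) (a b f : ι → ℝ) (ε : ℝ) :
    IndepCentredPairs P (fun i ω => a i * ((f i + ε * ξ i ω) * ζ i ω))
      (fun i ω => b i * ((f i + ε * ξ i ω) * ζ i ω)) where
  measurable_fst i := by have := h.measurable_fst i; have := h.measurable_snd i; fun_prop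
  measurable_snd i := by have := h.measurable_fst i; have := h.measurable_snd i; fun_prop
  indep := h.indep.comp (fun i q => (a i * ((f i + ε * q.1) * q.2),
    b i * ((f i + ε * q.1) * q.2))) fun i => by fun_prop
  moments_fst i := h.hasMoments_score _ _ _ _
  moments_snd i := h.hasMoments_score _ _ _ _
  centred_fst i := h.integral_score ..
  centred_snd i := h.integral_score ..

theorem integral_sum_score_sq (h : IsGaussianPairs P ξ ζ) (s : Finset ι) (a f : ι → ℝ) (ε : ℝ) :
    ∫ ω, (∑ i ∈ s, a i * ((f i + ε * ξ i ω) * ζ i ω)) ^ 2 ∂P =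
      ∑ i ∈ s, a i ^ 2 * (f i ^ 2 + ε ^ 2) := by
  rw [(h.indepCentredPairs_score_score a a f ε).integral_sum_sq]
  refine Finset.sum_congr rfl fun i _ => ?_
  simp_rw [mul_pow (a i)]
  rw [integral_const_mul, h.integral_comp i (g := fun q => ((f i + ε * q.1) * q.2) ^ 2)
    (by fun_prop), integral_affine_sq_mul_sq_stdPair]

theorem abs_integral_sum_score_sq_mul_curvature_le (h : IsGaussianPairs P ξ ζ) (s : Finset ι)
    (a c f : ι → ℝ) {ε : ℝ} (hε : 0 ≤ ε) :
    |∫ ω, (∑ i ∈ s, a i * ((f i + ε * ξ i ω) * ζ i ω)) ^ 2 *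
        ∑ i ∈ s, c i * (2 * f i * ξ i ω + ε * (ξ i ω ^ 2 - ζ i ω ^ 2)) ∂P| ≤
      ε * (9 * momentConst 3 * ∑ i ∈ s, a i ^ 2 * |c i| * (f i ^ 2 + ε ^ 2)) := by
  rw [(h.indepCentredPairs_score_curvature a c f ε).integral_sum_sq_mul_sum, Finset.mul_sum,
    Finset.mul_sum]
  refine (Finset.abs_sum_le_sum_abs _ _).trans (Finset.sum_le_sum fun i _ => ?_)
  have e : ∀ ω, (a i * ((f i + ε * ξ i ω) * ζ i ω)) ^ 2 *
      (c i * (2 * f i * ξ i ω + ε * (ξ i ω ^ 2 - ζ i ω ^ 2))) = a i ^ 2 * c i *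
        (((f i + ε * ξ i ω) * ζ i ω) ^ 2 * (2 * f i * ξ i ω + ε * (ξ i ω ^ 2 - ζ i ω ^ 2))) :=
    fun ω => by ring
  simp_rw [e]
  rw [integral_const_mul, h.integral_comp i (g := fun q => ((f i + ε * q.1) * q.2) ^ 2 *
    (2 * f i * q.1 + ε * (q.1 ^ 2 - q.2 ^ 2))) (by fun_prop), abs_mul, abs_mul,
    abs_of_nonneg (sq_nonneg (a i))]
  calc _ ≤ a i ^ 2 * |c i| * (ε * (9 * (f i ^ 2 + ε ^ 2) * momentConst 3)) := by
        gcongr; exact abs_integral_score_sq_mul_curvature_le (f i) hε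
    _ = _ := by ring

theorem integral_sum_curvature_sq_le (h : IsGaussianPairs P ξ ζ) (s : Finset ι)
    (c f : ι → ℝ) {ε : ℝ} (hε : 0 ≤ ε) :
    ∫ ω, (∑ i ∈ s, c i * (2 * f i * ξ i ω + ε * (ξ i ω ^ 2 - ζ i ω ^ 2))) ^ 2 ∂P ≤
      2 * momentConst 2 * ∑ i ∈ s, c i ^ 2 * (f i ^ 2 + ε ^ 2) := by
  have h' := h.indepCentredPairs_score_curvature 0 c f ε
  have h'' : IndepCentredPairs P
      (fun i ω => c i * (2 * f i * ξ i ω + ε * (ξ i ω ^ 2 - ζ i ω ^ 2))) _ :=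
    ⟨h'.measurable_snd, h'.measurable_fst, h'.indep.comp (fun _ p => (p.2, p.1))
      (fun _ => by fun_prop), h'.moments_snd, h'.moments_fst, h'.centred_snd, h'.centred_fst⟩
  rw [h''.integral_sum_sq, Finset.mul_sum]
  refine Finset.sum_le_sum fun i _ => ?_
  calc _ ≤ ∫ ω, 2 * c i ^ 2 * (f i ^ 2 + ε ^ 2) * (1 + ξ i ω ^ 2 + ζ i ω ^ 2) ^ 2 ∂P := by
        refine integral_mono ((h.hasMoments_curvature _ _ _ _).pow 2).integrable
          (((h.hasMoments_envelope i).pow 2).const_mul _).integrable fun ω => ?_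
        have hb := abs_curvature_noise_le (f := f i) (x := ξ i ω) (z := ζ i ω) hε
        have hb2 : (2 * f i * ξ i ω + ε * (ξ i ω ^ 2 - ζ i ω ^ 2)) ^ 2 ≤
            ((|f i| + ε) * (1 + ξ i ω ^ 2 + ζ i ω ^ 2)) ^ 2 := by
          rw [← sq_abs]; gcongr
        simp only [mul_pow]
        calc _ ≤ c i ^ 2 * ((|f i| + ε) ^ 2 * (1 + ξ i ω ^ 2 + ζ i ω ^ 2) ^ 2) := by
              rw [← mul_pow (|f i| + ε)]; gcongr
          _ ≤ c i ^ 2 * (2 * (f i ^ 2 + ε ^ 2) * (1 + ξ i ω ^ 2 + ζ i ω ^ 2) ^ 2) := by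
              gcongr; exact sq_abs_add_le _ _
          _ = _ := by ring
    _ = _ := by rw [integral_const_mul, h.integral_envelope_pow]; ring

theorem abs_integral_sum_score_cube_mul_le (h : IsGaussianPairs P ξ ζ) (s : Finset ι)
    (a b f : ι → ℝ) {ε : ℝ} (hε : 0 ≤ ε) :
    |∫ ω, (∑ i ∈ s, a i * ((f i + ε * ξ i ω) * ζ i ω)) ^ 3 *
        ∑ i ∈ s, b i * ((f i + ε * ξ i ω) * ζ i ω) ∂P| ≤
      momentConst 4 * (∑ i ∈ s, |a i ^ 3 * b i| * (f i ^ 2 + ε ^ 2) ^ 2) +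
        3 * (∑ i ∈ s, a i ^ 2 * (f i ^ 2 + ε ^ 2)) *
          (∑ i ∈ s, |a i * b i| * (f i ^ 2 + ε ^ 2)) := by
  have h' := h.indepCentredPairs_score_score a b f ε
  refine (h'.abs_integral_sum_cube_mul_sum_le s).trans ?_
  rw [← h'.integral_sum_sq, h.integral_sum_score_sq]
  have hp : 0 ≤ 3 * ∑ i ∈ s, a i ^ 2 * (f i ^ 2 + ε ^ 2) :=
    mul_nonneg (by norm_num) (Finset.sum_nonneg fun i _ => by positivity)
  refine add_le_add ?_ (mul_le_mul_of_nonneg_left (Finset.sum_le_sum fun i _ => ?_) hp)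
  · rw [Finset.mul_sum]
    refine Finset.sum_le_sum fun i _ => ?_
    calc _ ≤ ∫ ω, |a i ^ 3 * b i| * (f i ^ 2 + ε ^ 2) ^ 2 *
          (1 + ξ i ω ^ 2 + ζ i ω ^ 2) ^ 4 ∂P := by
          refine integral_mono ((((h.hasMoments_score _ _ _ _).pow 3).mul
            (h.hasMoments_score _ _ _ _)).abs).integrable
            (((h.hasMoments_envelope i).pow 4).const_mul _).integrable fun ω => ?_
          have hb := abs_score_noise_le (f := f i) (x := ξ i ω) (z := ζ i ω) hε
          have e : (a i * ((f i + ε * ξ i ω) * ζ i ω)) ^ 3 * (b i * ((f i + ε * ξ i ω) * ζ i ω)) =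
            a i ^ 3 * b i * ((f i + ε * ξ i ω) * ζ i ω) ^ 4 := by ring
          simp only [e]
          rw [abs_mul, abs_pow ((f i + ε * ξ i ω) * ζ i ω), mul_assoc]
          gcongr
          calc _ ≤ ((|f i| + ε) * (1 + ξ i ω ^ 2 + ζ i ω ^ 2) / 2) ^ 4 := by gcongr
            _ = ((|f i| + ε) ^ 2) ^ 2 * (1 + ξ i ω ^ 2 + ζ i ω ^ 2) ^ 4 / 16 := by ring
            _ ≤ (2 * (f i ^ 2 + ε ^ 2)) ^ 2 * (1 + ξ i ω ^ 2 + ζ i ω ^ 2) ^ 4 / 16 := by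
              gcongr; exact sq_abs_add_le _ _
            _ ≤ _ := by
              have : 0 ≤ (f i ^ 2 + ε ^ 2) ^ 2 * (1 + ξ i ω ^ 2 + ζ i ω ^ 2) ^ 4 := by positivity
              nlinarith
      _ = _ := by rw [integral_const_mul, h.integral_envelope_pow]; ring
  · have e : ∀ ω, |a i * ((f i + ε * ξ i ω) * ζ i ω) * (b i * ((f i + ε * ξ i ω) * ζ i ω))| =
        |a i * b i| * ((f i + ε * ξ i ω) * ζ i ω) ^ 2 := fun ω => by
      rw [← abs_of_nonneg (sq_nonneg ((f i + ε * ξ i ω) * ζ i ω)), ← abs_mul]; congr 1; ring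
    simp_rw [e]
    rw [integral_const_mul, h.integral_comp i (g := fun q => ((f i + ε * q.1) * q.2) ^ 2)
      (by fun_prop), integral_affine_sq_mul_sq_stdPair]

/-- Gaussian tail bound for the linear part of the score. -/
theorem measureReal_abs_sum_snd_ge_le (h : IsGaussianPairs P ξ ζ) (s : Finset ι) (c : ι → ℝ)
    {v t : ℝ} (hv : 0 < v) (hc : ∑ i ∈ s, c i ^ 2 ≤ v) (ht : 0 ≤ t) :
    P.real {ω | t ≤ |∑ i ∈ s, c i * ζ i ω|} ≤ 2 * Real.exp (-t ^ 2 / (2 * v)) := by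
  have hmap : ∀ i, P.map (ζ i) = gaussianReal 0 1 := fun i => by
    have := congrArg (Measure.map Prod.snd) (h.map_eq i)
    rw [Measure.map_map _root_.measurable_snd ((h.measurable_fst i).prodMk (h.measurable_snd i)),
      measurePreserving_snd.map_eq] at this
    exact this
  have hz : ∀ i, HasSubgaussianMGF (ζ i) 1 P := fun i => by
    have hg : HasSubgaussianMGF id 1 (P.map (ζ i)) := by
      rw [hmap i]
      exact ⟨fun t => integrable_exp_mul_gaussianReal t, fun t => by
        rw [mgf_id_gaussianReal]; simp⟩
    exact (HasSubgaussianMGF.id_map_iff (h.measurable_snd i).aemeasurable).1 hg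
  have hind : iIndepFun (fun i ω => c i * ζ i ω) P :=
    h.indep.comp (fun i q => c i * q.2) fun i => by fun_prop
  have hsub := HasSubgaussianMGF.sum_of_iIndepFun hind (s := s) fun i _ => (hz i).const_mul (c i)
  set V : NNReal := ∑ i ∈ s, ⟨c i ^ 2, sq_nonneg _⟩ * 1 with hV
  have hVv : (V : ℝ) ≤ v := by
    rw [hV, NNReal.coe_sum]
    exact (Finset.sum_congr rfl fun i _ => mul_one (c i ^ 2)).trans_le hc
  -- The variance proxy is enlarged to `v`, so that the exponent no longer depends on the
  -- coefficients.
  have hsub' : HasSubgaussianMGF (fun ω => ∑ i ∈ s, c i * ζ i ω) ⟨v, hv.le⟩ P :=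
    ⟨hsub.integrable_exp_mul, fun r => (hsub.mgf_le r).trans (by
      apply Real.exp_le_exp.2
      have : (V : ℝ) * r ^ 2 ≤ v * r ^ 2 := by gcongr
      change (V : ℝ) * r ^ 2 / 2 ≤ v * r ^ 2 / 2
      linarith)⟩
  have h1 := hsub'.measure_ge_le ht
  have h2 := hsub'.neg.measure_ge_le ht
  have hsubset : {ω | t ≤ |∑ i ∈ s, c i * ζ i ω|} ⊆
      {ω | t ≤ ∑ i ∈ s, c i * ζ i ω} ∪ {ω | t ≤ (-fun ω => ∑ i ∈ s, c i * ζ i ω) ω} :=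
    fun ω hω => by simpa [le_abs] using hω
  calc _ ≤ P.real _ := measureReal_mono hsubset
    _ ≤ _ := measureReal_union_le _ _
    _ ≤ _ := by
      rw [two_mul]; exact add_le_add h1 h2

end IsGaussianPairs

end ModelMoments

/-! ### Second-order solution of the likelihood equation -/

set_option maxHeartbeats 1000000 in
/-- Second-order expansion of the square of an approximate root `u` of the likelihood equation
`ε N = (D + ε Z) u + 2 ε u² V`, where `ε = e²`. -/
theorem abs_sq_root_expansion_le {A B d D N Z V Q u e l : ℝ} (hd : 0 < d) (hD : d ≤ D)
    (he : 0 < e) (hl : 1 ≤ l) (hel : e * l ≤ 1) (hA : 0 ≤ A) (hB : 0 ≤ B) (hQ : 0 ≤ Q)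
    (hN : |N| ≤ A * l) (hu : |u| ≤ B * (e ^ 2 * l))
    (hroot : |e ^ 2 * N - (D + e ^ 2 * Z) * u - 2 * e ^ 2 * u ^ 2 * V| ≤ |u| ^ 3 * Q) :
    |D ^ 2 * u ^ 2 - (e ^ 2) ^ 2 * N ^ 2 + 2 * (e ^ 2) ^ 3 / D * (N ^ 2 * Z)
        + 4 * (e ^ 2) ^ 4 / D ^ 2 * (N ^ 3 * V)| ≤
      (3 * (2 * A * (B + 2 * B ^ 2 + B ^ 3) / d
          + 4 * A * (B + 2 * B ^ 2 + B ^ 3) * (B + A / d) / d + (B + 2 * B ^ 2 + B ^ 3) ^ 2)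
        + 2 * A * B ^ 3) * ((e ^ 2) ^ 4 * l ^ 4) * (1 + Z ^ 2 + e ^ 2 * V ^ 2 + Q ^ 2) := by
  set B' := B + 2 * B ^ 2 + B ^ 3 with hB'
  have hB'0 : 0 ≤ B' := by positivity
  have hDp : 0 < D := hd.trans_le hD
  set ε := e ^ 2 with hε
  have hε0 : 0 < ε := by positivity
  have hl0 : 0 < l := by linarith
  set R := ε * N - (D + ε * Z) * u - 2 * ε * u ^ 2 * V with hR
  -- The deviation from the first-order root `ε N / D`; the equation forces it to be of order `ε²
  -- l`.
  set w := D * u - ε * N with hw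
  -- Here `V` is damped by `e = √ε`, since its second moment is controlled only at order `1/ε`.
  set S := |Z| + e * |V| + Q with hS
  have hS0 : 0 ≤ S := by positivity
  have hel2 : ε * l ^ 2 ≤ 1 := by
    calc ε * l ^ 2 = (e * l) ^ 2 := by rw [hε]; ring
      _ ≤ 1 := pow_le_one₀ (by positivity) hel
  have hu3 : |u| ^ 3 * Q ≤ ε ^ 2 * l * (B ^ 3 * Q) := by
    calc |u| ^ 3 * Q ≤ (B * (ε * l)) ^ 3 * Q := by gcongr
      _ = ε ^ 2 * l * (B ^ 3 * Q) * (ε * l ^ 2) := by ring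
      _ ≤ ε ^ 2 * l * (B ^ 3 * Q) * 1 := by gcongr
      _ = _ := mul_one _
  have hu2V : u ^ 2 * |V| ≤ ε * l * (B ^ 2 * (e * |V|)) := by
    calc u ^ 2 * |V| = |u| ^ 2 * |V| := by rw [sq_abs]
      _ ≤ (B * (ε * l)) ^ 2 * |V| := by gcongr
      _ = ε * l * (B ^ 2 * (e * |V|)) * (e * l) := by rw [hε]; ring
      _ ≤ ε * l * (B ^ 2 * (e * |V|)) * 1 := by gcongr
      _ = _ := mul_one _
  have hwb : |w| ≤ ε ^ 2 * l * (B' * S) := by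
    have e1 : w = -(ε * (Z * u)) - 2 * ε * (u ^ 2 * V) - R := by rw [hw, hR]; ring
    have a1 : |ε * (Z * u)| ≤ ε ^ 2 * l * (B * |Z|) := by
      rw [abs_mul, abs_mul, abs_of_pos hε0]
      calc ε * (|Z| * |u|) ≤ ε * (|Z| * (B * (ε * l))) := by gcongr
        _ = _ := by ring
    have a2 : |2 * ε * (u ^ 2 * V)| ≤ ε ^ 2 * l * (2 * B ^ 2 * (e * |V|)) := by
      rw [abs_mul, abs_mul _ V, abs_of_pos (by positivity : 0 < 2 * ε),
        abs_of_nonneg (sq_nonneg u)]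
      calc 2 * ε * (u ^ 2 * |V|) ≤ 2 * ε * (ε * l * (B ^ 2 * (e * |V|))) := by gcongr
        _ = _ := by ring
    have a3 := hroot.trans hu3
    calc |w| ≤ |ε * (Z * u)| + |2 * ε * (u ^ 2 * V)| + |R| := by
          rw [e1]
          refine (abs_sub _ _).trans ?_
          gcongr
          refine (abs_sub _ _).trans ?_
          rw [abs_neg]
      _ ≤ ε ^ 2 * l * (B * |Z|) + ε ^ 2 * l * (2 * B ^ 2 * (e * |V|))
            + ε ^ 2 * l * (B ^ 3 * Q) := by gcongr
      _ = ε ^ 2 * l * (B * |Z| + 2 * B ^ 2 * (e * |V|) + B ^ 3 * Q) := by ring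
      _ ≤ ε ^ 2 * l * (B' * S) := by
          gcongr
          rw [hB', hS]
          have : 0 ≤ e * |V| := by positivity
          nlinarith [abs_nonneg Z, mul_nonneg hB (abs_nonneg Z), mul_nonneg hB this,
            mul_nonneg hB hQ, mul_nonneg (pow_nonneg hB 2) (abs_nonneg Z),
            mul_nonneg (pow_nonneg hB 2) this, mul_nonneg (pow_nonneg hB 2) hQ,
            mul_nonneg (pow_nonneg hB 3) (abs_nonneg Z),
            mul_nonneg (pow_nonneg hB 3) this, mul_nonneg (pow_nonneg hB 3) hQ]
  -- Start from `(ε N + w)²`. In the cross term `2 ε N w`, substitute the root equation for `w`.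
  -- Then write `u = (ε N + w)/D` and `u² = (ε N/D)² + (w/D)(u + ε N/D)`; the leading parts are the
  -- two correction terms.
  have key : D ^ 2 * u ^ 2 - ε ^ 2 * N ^ 2 + 2 * ε ^ 3 / D * (N ^ 2 * Z)
        + 4 * ε ^ 4 / D ^ 2 * (N ^ 3 * V) =
      -(2 * ε ^ 2 * (N * Z * w / D)) - 4 * ε ^ 2 * (N * V * (w / D) * (u + ε * N / D))
        - 2 * ε * (N * R) + w ^ 2 := by
    rw [hw, hR]; field_simp; ring
  have hZS : |Z| ≤ S := by rw [hS]; have : 0 ≤ e * |V| := by positivity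
                           linarith
  have hVS : e * |V| ≤ S := by rw [hS]; have := abs_nonneg Z; linarith
  have hQS : Q ≤ 1 + Q ^ 2 := by nlinarith [sq_nonneg (Q - 1)]
  have hwD : |w / D| ≤ ε ^ 2 * l * (B' * S) / d := by
    rw [abs_div, abs_of_pos hDp]; gcongr
  have t1 : |2 * ε ^ 2 * (N * Z * w / D)| ≤ 2 * A * B' / d * (ε ^ 4 * l ^ 2 * S ^ 2) := by
    rw [mul_div_assoc, abs_mul (2 * ε ^ 2), abs_mul (N * Z), abs_mul N,
      abs_of_pos (by positivity : 0 < 2 * ε ^ 2)]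
    calc 2 * ε ^ 2 * (|N| * |Z| * |w / D|) ≤
          2 * ε ^ 2 * (A * l * S * (ε ^ 2 * l * (B' * S) / d)) := by gcongr
      _ = _ := by ring
  have hfac : |u + ε * N / D| ≤ (B + A / d) * (ε * l) := by
    refine (abs_add_le _ _).trans ?_
    rw [abs_div, abs_mul, abs_of_pos hε0, abs_of_pos hDp]
    calc |u| + ε * |N| / D ≤ B * (ε * l) + ε * (A * l) / d := by gcongr
      _ = _ := by ring
  have t2 : |4 * ε ^ 2 * (N * V * (w / D) * (u + ε * N / D))| ≤
      4 * A * B' * (B + A / d) / d * (ε ^ 4 * l ^ 2 * S ^ 2) := by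
    rw [abs_mul (4 * ε ^ 2), abs_mul (N * V * (w / D)), abs_mul (N * V), abs_mul N,
      abs_of_pos (by positivity : 0 < 4 * ε ^ 2)]
    calc 4 * ε ^ 2 * (|N| * |V| * |w / D| * |u + ε * N / D|) ≤
          4 * ε ^ 2 * (A * l * |V| * (ε ^ 2 * l * (B' * S) / d) * ((B + A / d) * (ε * l))) := by
            gcongr
      _ = 4 * A * B' * (B + A / d) / d * (ε ^ 4 * l ^ 2 * (e * l * (e * |V|) * S)) := by
            rw [hε]; ring
      _ ≤ 4 * A * B' * (B + A / d) / d * (ε ^ 4 * l ^ 2 * (1 * S * S)) := by gcongr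
      _ = _ := by ring
  have t3 : |2 * ε * (N * R)| ≤ 2 * A * B ^ 3 * (ε ^ 4 * l ^ 4 * Q) := by
    rw [abs_mul (2 * ε), abs_mul N, abs_of_pos (by positivity : 0 < 2 * ε)]
    calc 2 * ε * (|N| * |R|) ≤ 2 * ε * (A * l * ((B * (ε * l)) ^ 3 * Q)) := by
          gcongr
          exact hroot.trans (by gcongr)
      _ = _ := by ring
  have t4 : |w ^ 2| ≤ B' ^ 2 * (ε ^ 4 * l ^ 2 * S ^ 2) := by
    rw [abs_pow]
    calc |w| ^ 2 ≤ (ε ^ 2 * l * (B' * S)) ^ 2 := by gcongr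
      _ = _ := by ring
  have hS2 : S ^ 2 ≤ 3 * (Z ^ 2 + ε * V ^ 2 + Q ^ 2) := by
    have : S ^ 2 ≤ 3 * (|Z| ^ 2 + (e * |V|) ^ 2 + Q ^ 2) := by
      rw [hS]
      nlinarith [sq_nonneg (|Z| - e * |V|), sq_nonneg (|Z| - Q), sq_nonneg (e * |V| - Q)]
    rwa [mul_pow, sq_abs, sq_abs] at this
  obtain ⟨T, hT⟩ : ∃ T, T = Z ^ 2 + ε * V ^ 2 + Q ^ 2 := ⟨_, rfl⟩
  have hT0 : 0 ≤ T := by rw [hT]; positivity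
  rw [← hT] at hS2
  have hll : l ^ 2 ≤ l ^ 4 := pow_le_pow_right₀ hl (by norm_num)
  have hm : ε ^ 4 * l ^ 2 * S ^ 2 ≤ 3 * (ε ^ 4 * l ^ 4 * (1 + T)) := by
    calc ε ^ 4 * l ^ 2 * S ^ 2 ≤ ε ^ 4 * l ^ 4 * (3 * (1 + T)) := by
          gcongr; linarith
      _ = _ := by ring
  have hm' : ε ^ 4 * l ^ 4 * Q ≤ ε ^ 4 * l ^ 4 * (1 + T) := by
    gcongr
    refine hQS.trans ?_
    have : 0 ≤ ε * V ^ 2 := by positivity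
    linarith [sq_nonneg Z]
  have c1 : 0 ≤ 2 * A * B' / d := by positivity
  have c2 : 0 ≤ 4 * A * B' * (B + A / d) / d := by positivity
  rw [key]
  calc _ ≤ |2 * ε ^ 2 * (N * Z * w / D)| + |4 * ε ^ 2 * (N * V * (w / D) * (u + ε * N / D))|
        + |2 * ε * (N * R)| + |w ^ 2| := by
        refine (abs_add_le _ _).trans ?_
        gcongr
        refine (abs_sub _ _).trans ?_
        gcongr
        refine (abs_sub _ _).trans ?_
        rw [abs_neg]
    _ ≤ 2 * A * B' / d * (3 * (ε ^ 4 * l ^ 4 * (1 + T)))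
        + 4 * A * B' * (B + A / d) / d * (3 * (ε ^ 4 * l ^ 4 * (1 + T)))
        + 2 * A * B ^ 3 * (ε ^ 4 * l ^ 4 * (1 + T))
        + B' ^ 2 * (3 * (ε ^ 4 * l ^ 4 * (1 + T))) := by
        gcongr
        · exact t1.trans (by gcongr)
        · exact t2.trans (by gcongr)
        · exact t3.trans (by gcongr)
        · exact t4.trans (by gcongr)
    _ = _ := by rw [hT]; ring

/-! ### The criterion in rotated coordinates -/

section Criterion

/-- The angular frequency `2πk`. -/
noncomputable def freq (k : ℕ+) : ℝ := 2 * Real.pi * k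

theorem le_freq (k : ℕ+) : (k : ℝ) ≤ freq k := by
  have h1 : (1 : ℝ) ≤ 2 * Real.pi := by linarith [Real.pi_gt_three]
  exact le_mul_of_one_le_left (by positivity) h1

theorem one_le_freq (k : ℕ+) : 1 ≤ freq k :=
  le_trans (by exact_mod_cast k.pos) (le_freq k)

theorem freq_pos (k : ℕ+) : 0 < freq k := zero_lt_one.trans_le (one_le_freq k)

variable (s : Finset ℕ+) (h f : ℕ+ → ℝ) (ε : ℝ) (x z : ℕ+ → ℝ)

/-- Twice the criterion at the shift `θ + u`, in terms of the rotated noise. -/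
noncomputable def crit (u : ℝ) : ℝ :=
  ∑ k ∈ s, h k * ((f k + ε * x k) * Real.cos (freq k * u) + ε * z k * Real.sin (freq k * u)) ^ 2

/-- The filtered information `∑ h_k (2πk)² f_k²`. -/
noncomputable def filteredInfo : ℝ := ∑ k ∈ s, h k * freq k ^ 2 * f k ^ 2

/-- The normalized score at the true shift. -/
noncomputable def score : ℝ := ∑ k ∈ s, h k * freq k * ((f k + ε * x k) * z k)

/-- The normalized fluctuation of the second derivative of the criterion. -/
noncomputable def curvature : ℝ :=
  ∑ k ∈ s, h k * freq k ^ 2 * (2 * f k * x k + ε * (x k ^ 2 - z k ^ 2))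

/-- The normalized third derivative of the criterion. -/
noncomputable def thirdDeriv : ℝ := ∑ k ∈ s, h k * freq k ^ 3 * ((f k + ε * x k) * z k)

/-- A bound for the fourth derivative of the criterion. -/
noncomputable def fourthBound : ℝ :=
  ∑ k ∈ s, 10 * (h k * freq k ^ 4 * (f k ^ 2 + ε ^ 2)) * (1 + x k ^ 2 + z k ^ 2)

/-- A crude bound for all noise terms. -/
noncomputable def noiseBound : ℝ := ∑ k ∈ s, h k * freq k ^ 4 * (1 + x k ^ 2 + z k ^ 2)

/-- The bound for the noise terms that controls the localization of the maximizer. -/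
noncomputable def localBound : ℝ :=
  ∑ k ∈ s, (h k * freq k + h k * freq k ^ 2 * (|f k| + ε)) * (1 + x k ^ 2 + z k ^ 2)

theorem hasDerivAt_crit (u : ℝ) : HasDerivAt (crit s h f ε x z)
    (2 * ∑ k ∈ s, h k * (freq k *
      (((f k + ε * x k) * Real.cos (freq k * u) + ε * z k * Real.sin (freq k * u)) *
          (-(f k + ε * x k) * Real.sin (freq k * u) + ε * z k * Real.cos (freq k * u))))) u := by
  unfold crit
  rw [Finset.mul_sum]
  refine HasDerivAt.fun_sum fun k _ => ?_
  have h1 : HasDerivAt (fun u => freq k * u) (freq k) u := by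
    simpa using (hasDerivAt_id u).const_mul (freq k)
  convert! ((((h1.cos.const_mul (f k + ε * x k)).add
    (h1.sin.const_mul (ε * z k))).pow 2).const_mul (h k)) using 1
  simp only [Pi.add_apply]
  push_cast
  ring

variable {s h f ε x z}

/-- The weighted sum over the frequencies of `abs_deriv_rotation_sub_le`, at a critical point.
Nonnegative weights let the remainders add up to `fourthBound`. -/
theorem abs_root_equation_le (h0 : ∀ k, 0 ≤ h k) {u : ℝ}
    (hu : deriv (crit s h f ε x z) u = 0) :
    |ε * score s h f ε x z - (filteredInfo s h f + ε * curvature s h f ε x z) * u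
        - 2 * ε * u ^ 2 * thirdDeriv s h f ε x z| ≤ |u| ^ 3 * fourthBound s h f ε x z := by
  rw [(hasDerivAt_crit s h f ε x z u).deriv] at hu
  have hu' := (mul_eq_zero.1 hu).resolve_left two_ne_zero
  rw [abs_sub_comm, abs_sub_comm] at *
  have e : ε * score s h f ε x z - (filteredInfo s h f + ε * curvature s h f ε x z) * u
        - 2 * ε * u ^ 2 * thirdDeriv s h f ε x z =
      -∑ k ∈ s, h k * (freq k * (((f k + ε * x k) * Real.cos (freq k * u)
            + ε * z k * Real.sin (freq k * u)) *
          (-(f k + ε * x k) * Real.sin (freq k * u) + ε * z k * Real.cos (freq k * u))) -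
        (ε * (freq k * ((f k + ε * x k) * z k))
          - (freq k ^ 2 * f k ^ 2
              + ε * (freq k ^ 2 * (2 * f k * x k + ε * (x k ^ 2 - z k ^ 2)))) * u
          - 2 * ε * u ^ 2 * (freq k ^ 3 * ((f k + ε * x k) * z k)))) := by
    simp_rw [mul_sub]
    rw [Finset.sum_sub_distrib, hu', zero_sub, neg_neg, Finset.sum_sub_distrib,
      Finset.sum_sub_distrib, score, filteredInfo, curvature, thirdDeriv, add_mul, Finset.mul_sum,
      Finset.mul_sum, Finset.mul_sum, Finset.sum_mul, Finset.sum_mul, ← Finset.sum_add_distrib]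
    congr 1
    · congr 1
      · exact Finset.sum_congr rfl fun k _ => by ring
      · exact Finset.sum_congr rfl fun k _ => by ring
    · exact Finset.sum_congr rfl fun k _ => by ring
  rw [e, abs_neg, fourthBound, Finset.mul_sum]
  refine (Finset.abs_sum_le_sum_abs _ _).trans (Finset.sum_le_sum fun k _ => ?_)
  rw [abs_mul, abs_of_nonneg (h0 k)]
  calc _ ≤ h k * (|u| ^ 3 * (10 * (freq k ^ 4 * (f k ^ 2 + ε ^ 2) * (1 + x k ^ 2 + z k ^ 2)))) :=
        mul_le_mul_of_nonneg_left (abs_deriv_rotation_sub_le (freq_pos k).le u) (h0 k)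
    _ = _ := by ring

/-- All signal drifts are nonnegative, so the first one alone supplies `ρ c u²`. The hypothesis `hW`
lets the quadratic noise absorb at most half of it, and the other half is dominated by the linear
term `2 ε u N`. Neither criticality nor smallness of `u` is required. -/
theorem abs_le_of_crit_zero_le (hε : 0 ≤ ε) (h0 : ∀ k, 0 ≤ h k) (h1s : 1 ∈ s) (h1 : h 1 = 1)
    {ρ c u : ℝ} (hρ : 0 < ρ) (hc : 0 < c) (hf : ρ ≤ f 1 ^ 2)
    (hsin : c * u ^ 2 ≤ Real.sin (freq 1 * u) ^ 2)
    (hmax : crit s h f ε x z 0 ≤ crit s h f ε x z u)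
    (hW : 8 * (ε * localBound s h f ε x z) ≤ ρ * c) :
    |u| ≤ 4 / (ρ * c) * (ε * |score s h f ε x z|) := by
  have hρc : 0 < ρ * c := mul_pos hρ hc
  have key : ρ * c * u ^ 2 - 2 * ε * u * score s h f ε x z
      - 4 * ε * u ^ 2 * localBound s h f ε x z ≤ 0 := by
    have hsum : ∑ k ∈ s, h k * (f k ^ 2 * Real.sin (freq k * u) ^ 2
        - 2 * ε * u * (freq k * ((f k + ε * x k) * z k))
        - 4 * ε * u ^ 2 * (freq k ^ 2 * (|f k| + ε) * (1 + x k ^ 2 + z k ^ 2))) ≤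
        crit s h f ε x z 0 - crit s h f ε x z u := by
      rw [crit, crit, ← Finset.sum_sub_distrib]
      refine Finset.sum_le_sum fun k _ => ?_
      rw [← mul_sub]
      refine mul_le_mul_of_nonneg_left ?_ (h0 k)
      simpa using sq_sub_sq_rotation_ge (w := freq k) (f := f k) (x := x k) (z := z k) hε u
    have hfirst : ρ * c * u ^ 2 ≤ ∑ k ∈ s, h k * (f k ^ 2 * Real.sin (freq k * u) ^ 2) := by
      calc ρ * c * u ^ 2 = ρ * (c * u ^ 2) := by ring
        _ ≤ f 1 ^ 2 * Real.sin (freq 1 * u) ^ 2 := by gcongr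
        _ = h 1 * (f 1 ^ 2 * Real.sin (freq 1 * u) ^ 2) := by rw [h1, one_mul]
        _ ≤ _ := Finset.single_le_sum
          (f := fun k => h k * (f k ^ 2 * Real.sin (freq k * u) ^ 2))
          (fun k _ => mul_nonneg (h0 k) (by positivity)) h1s
    have hloc : ∑ k ∈ s, h k * (4 * ε * u ^ 2 *
        (freq k ^ 2 * (|f k| + ε) * (1 + x k ^ 2 + z k ^ 2))) ≤
        4 * ε * u ^ 2 * localBound s h f ε x z := by
      rw [localBound, Finset.mul_sum]
      refine Finset.sum_le_sum fun k _ => ?_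
      have h3 : 0 ≤ 4 * ε * u ^ 2 * (h k * freq k * (1 + x k ^ 2 + z k ^ 2)) := by
        have := h0 k; have := (freq_pos k).le; positivity
      nlinarith
    have hsc : ∑ k ∈ s, h k * (2 * ε * u * (freq k * ((f k + ε * x k) * z k))) =
        2 * ε * u * score s h f ε x z := by
      rw [score, Finset.mul_sum]
      exact Finset.sum_congr rfl fun k _ => by ring
    simp_rw [mul_sub] at hsum
    rw [Finset.sum_sub_distrib, Finset.sum_sub_distrib, hsc] at hsum
    linarith
  have h2 : ρ * c * u ^ 2 ≤ 4 * (ε * (u * score s h f ε x z)) := by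
    nlinarith [mul_le_mul_of_nonneg_left hW (sq_nonneg u)]
  have h3 : u * score s h f ε x z ≤ |u| * |score s h f ε x z| := by
    rw [← abs_mul]; exact le_abs_self _
  rcases (abs_nonneg u).eq_or_lt with hu | hu
  · rw [← hu]; positivity
  · rw [div_mul_eq_mul_div, le_div_iff₀ hρc]
    have : |u| * (|u| * (ρ * c)) ≤ |u| * (4 * (ε * |score s h f ε x z|)) := by
      rw [← sq_abs] at h2
      nlinarith [mul_le_mul_of_nonneg_left h3 hε]
    exact le_of_mul_le_mul_left this hu

end Criterion

/-! ### Deterministic bounds for admissible weights and coefficients -/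

/-- Signal coefficients and weights restricted to a finite set of frequencies, with the bounds
used in the risk expansion. -/
structure IsAdmissible (C₀ C₁ ρ ε : ℝ) (s : Finset ℕ+) (h f : ℕ+ → ℝ) : Prop where
  eps_pos : 0 < ε
  eps_lt_one : ε < 1
  one_mem : 1 ∈ s
  h_one : h 1 = 1
  h_nonneg : ∀ k, 0 ≤ h k
  h_le_one : ∀ k, h k ≤ 1
  sum_h : ε ^ 2 * ∑ k ∈ s, h k * freq k ^ 4 ≤ C₁
  sum_f : ∑ k ∈ s, f k ^ 2 * freq k ^ 4 ≤ C₀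
  le_first : ρ ≤ f 1 ^ 2

theorem summable_freq_rpow : Summable fun k : ℕ+ => (√(freq k) ^ 3)⁻¹ := by
  have h1 : Summable fun k : ℕ+ => (((k : ℕ) : ℝ) ^ (3 / 2 : ℝ))⁻¹ :=
    (Real.summable_nat_rpow_inv.2 (by norm_num : (1 : ℝ) < 3 / 2)).comp_injective
      PNat.coe_injective
  refine Summable.of_nonneg_of_le (fun k => by positivity) (fun k => ?_) h1
  have hk : (0 : ℝ) < (k : ℕ) := by exact_mod_cast k.pos
  have e : ((k : ℕ) : ℝ) ^ (3 / 2 : ℝ) = √((k : ℕ) : ℝ) ^ 3 := by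
    rw [Real.sqrt_eq_rpow, ← Real.rpow_natCast, ← Real.rpow_mul hk.le]; norm_num
  rw [e]
  gcongr
  exact le_freq k

/-- `∑ (2πk)^(-3/2)`. -/
noncomputable def freqConst : ℝ := ∑' k : ℕ+, (√(freq k) ^ 3)⁻¹

theorem freqConst_nonneg : 0 ≤ freqConst := tsum_nonneg fun k => by positivity

/-- Interpolation between `v ≤ 1` and the fourth-power weight bound, with the threshold `x = η⁻³`.
For `x = √w` the low frequencies leave the summable `w^(-3/2)`, and the high ones leave `ε² v w⁴`
when `ε = η¹⁶`. -/
theorem pow_weight_le {η v x : ℝ} (hη : 0 < η) (hv0 : 0 ≤ v) (hv1 : v ≤ 1) (hx : 0 < x) :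
    η ^ 16 * (v * x ^ 2) ≤ η * (x ^ 3)⁻¹ + η ^ 2 * ((η ^ 16) ^ 2 * (v * x ^ 8)) := by
  rcases le_total (η ^ 3 * x) 1 with hc | hc
  · have h1 : η ^ 15 * x ^ 5 ≤ 1 := by
      calc η ^ 15 * x ^ 5 = (η ^ 3 * x) ^ 5 := by ring
        _ ≤ 1 := pow_le_one₀ (by positivity) hc
    have h2 : η ^ 16 * (v * x ^ 2) ≤ η * (x ^ 3)⁻¹ := by
      rw [← div_eq_mul_inv, le_div_iff₀ (by positivity)]
      calc η ^ 16 * (v * x ^ 2) * x ^ 3 = η * (v * (η ^ 15 * x ^ 5)) := by ring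
        _ ≤ η * (1 * 1) := by gcongr
        _ = η := by ring
    exact h2.trans (le_add_of_nonneg_right (by positivity))
  · have h1 : 1 ≤ η ^ 18 * x ^ 6 := by
      calc 1 ≤ (η ^ 3 * x) ^ 6 := one_le_pow₀ hc
        _ = _ := by ring
    have h2 : η ^ 16 * (v * x ^ 2) ≤ η ^ 2 * ((η ^ 16) ^ 2 * (v * x ^ 8)) := by
      calc η ^ 16 * (v * x ^ 2) = η ^ 16 * (v * x ^ 2) * 1 := by ring
        _ ≤ η ^ 16 * (v * x ^ 2) * (η ^ 18 * x ^ 6) := by gcongr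
        _ = _ := by ring
    exact h2.trans (le_add_of_nonneg_left (by positivity))

namespace IsAdmissible

variable {C₀ C₁ ρ ε : ℝ} {s : Finset ℕ+} {h f : ℕ+ → ℝ}

theorem sum_weighted_le (H : IsAdmissible C₀ C₁ ρ ε s h f) :
    ∑ k ∈ s, h k * freq k ^ 4 * (f k ^ 2 + ε ^ 2) ≤ C₀ + C₁ := by
  calc _ ≤ ∑ k ∈ s, (f k ^ 2 * freq k ^ 4 + ε ^ 2 * (h k * freq k ^ 4)) := by
        refine Finset.sum_le_sum fun k _ => ?_
        have : h k * (f k ^ 2 * freq k ^ 4) ≤ 1 * (f k ^ 2 * freq k ^ 4) := by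
          gcongr; exact H.h_le_one k
        nlinarith
    _ ≤ _ := by
        rw [Finset.sum_add_distrib, ← Finset.mul_sum]
        exact add_le_add H.sum_f H.sum_h

theorem weighted_nonneg (H : IsAdmissible C₀ C₁ ρ ε s h f) (k : ℕ+) :
    0 ≤ h k * freq k ^ 4 * (f k ^ 2 + ε ^ 2) :=
  mul_nonneg (mul_nonneg (H.h_nonneg k) (by positivity)) (by positivity)

theorem const_nonneg (H : IsAdmissible C₀ C₁ ρ ε s h f) : 0 ≤ C₀ + C₁ :=
  (Finset.sum_nonneg fun k _ => H.weighted_nonneg k).trans H.sum_weighted_le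

theorem le_filteredInfo (H : IsAdmissible C₀ C₁ ρ ε s h f) : ρ ≤ filteredInfo s h f := by
  calc ρ ≤ 1 * 1 * f 1 ^ 2 := by linarith [H.le_first]
    _ ≤ h 1 * freq 1 ^ 2 * f 1 ^ 2 := by
      rw [H.h_one]; gcongr; exact one_le_pow₀ (one_le_freq 1)
    _ ≤ _ := Finset.single_le_sum (f := fun k => h k * freq k ^ 2 * f k ^ 2)
      (fun k _ => mul_nonneg (mul_nonneg (H.h_nonneg k) (by positivity)) (by positivity)) H.one_mem

theorem filteredInfo_le (H : IsAdmissible C₀ C₁ ρ ε s h f) : filteredInfo s h f ≤ C₀ := by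
  refine le_trans (Finset.sum_le_sum fun k _ => ?_) H.sum_f
  have h1 : freq k ^ 2 ≤ freq k ^ 4 := pow_le_pow_right₀ (one_le_freq k) (by norm_num)
  calc h k * freq k ^ 2 * f k ^ 2 ≤ 1 * freq k ^ 4 * f k ^ 2 := by gcongr; exact H.h_le_one k
    _ = _ := by ring

theorem abs_coeff_add_le (H : IsAdmissible C₀ C₁ ρ ε s h f) {k : ℕ+} (hk : k ∈ s) :
    |f k| + ε ≤ C₀ + 2 := by
  have h1 : f k ^ 2 ≤ C₀ := by
    calc f k ^ 2 ≤ f k ^ 2 * freq k ^ 4 :=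
          le_mul_of_one_le_right (sq_nonneg _) (one_le_pow₀ (one_le_freq k))
      _ ≤ ∑ k ∈ s, f k ^ 2 * freq k ^ 4 :=
          Finset.single_le_sum (f := fun k => f k ^ 2 * freq k ^ 4) (fun k _ => by positivity) hk
      _ ≤ C₀ := H.sum_f
  have := H.eps_lt_one
  nlinarith [sq_abs (f k), sq_nonneg (|f k| - 1)]

theorem const_one_nonneg (H : IsAdmissible C₀ C₁ ρ ε s h f) : 0 ≤ C₁ :=
  (mul_nonneg (sq_nonneg ε) (Finset.sum_nonneg fun k _ =>
    mul_nonneg (H.h_nonneg k) (by positivity))).trans H.sum_h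

theorem const_zero_nonneg (H : IsAdmissible C₀ C₁ ρ ε s h f) : 0 ≤ C₀ :=
  (Finset.sum_nonneg fun k _ => by positivity).trans H.sum_f

theorem eps_mul_weight_le (H : IsAdmissible C₀ C₁ ρ ε s h f) {k : ℕ+} (hk : k ∈ s) :
    ε * (h k * freq k ^ 2) ≤ 1 + C₁ := by
  have h1 : ε ^ 2 * (h k * freq k ^ 4) ≤ C₁ := by
    refine le_trans ?_ H.sum_h
    gcongr
    exact Finset.single_le_sum (f := fun k => h k * freq k ^ 4)
      (fun k _ => mul_nonneg (H.h_nonneg k) (by positivity)) hk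
  -- As `h k ≤ 1`, squaring the weight costs nothing, and the fourth-power bound controls the
  -- square.
  have h2 : (ε * (h k * freq k ^ 2)) ^ 2 ≤ C₁ := by
    refine le_trans ?_ h1
    have : h k ^ 2 ≤ h k := by nlinarith [H.h_nonneg k, H.h_le_one k]
    calc _ = ε ^ 2 * (h k ^ 2 * freq k ^ 4) := by ring
      _ ≤ _ := by gcongr
  nlinarith [sq_nonneg (ε * (h k * freq k ^ 2) - 1)]

theorem eps_mul_sum_freq_le (H : IsAdmissible C₀ C₁ ρ ε s h f) {η : ℝ} (hη : 0 < η)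
    (hηε : η ^ 16 = ε) : ε * ∑ k ∈ s, h k * freq k ≤ η * (freqConst + C₁) := by
  have hη1 : η ≤ 1 := by
    by_contra hc
    exact (one_lt_pow₀ (not_le.1 hc) (by norm_num : 16 ≠ 0)).not_gt (hηε ▸ H.eps_lt_one)
  calc ε * ∑ k ∈ s, h k * freq k ≤
        ∑ k ∈ s, (η * (√(freq k) ^ 3)⁻¹ + η ^ 2 * (ε ^ 2 * (h k * freq k ^ 4))) := by
        rw [Finset.mul_sum]
        refine Finset.sum_le_sum fun k _ => ?_
        have := pow_weight_le hη (H.h_nonneg k) (H.h_le_one k) (Real.sqrt_pos.2 (freq_pos k))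
        rw [hηε, show √(freq k) ^ 8 = (√(freq k) ^ 2) ^ 4 by ring,
          Real.sq_sqrt (freq_pos k).le] at this
        exact this
    _ = η * ∑ k ∈ s, (√(freq k) ^ 3)⁻¹ + η ^ 2 * (ε ^ 2 * ∑ k ∈ s, h k * freq k ^ 4) := by
        rw [Finset.sum_add_distrib, ← Finset.mul_sum, ← Finset.mul_sum, ← Finset.mul_sum]
    _ ≤ η * freqConst + η * C₁ := by
        have h1 : η ^ 2 ≤ η := by nlinarith
        have := H.const_one_nonneg
        refine add_le_add ?_ ?_
        · gcongr
          exact summable_freq_rpow.sum_le_tsum _ fun k _ => by positivity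
        · calc _ ≤ η ^ 2 * C₁ := by gcongr; exact H.sum_h
            _ ≤ _ := by gcongr
    _ = _ := by ring

/-- The weights of `localBound` are polynomially small in the noise level. -/
theorem eps_mul_sum_local_le (H : IsAdmissible C₀ C₁ ρ ε s h f) {η : ℝ} (hη : 0 < η)
    (hηε : η ^ 16 = ε) :
    ε * ∑ k ∈ s, (h k * freq k + h k * freq k ^ 2 * (|f k| + ε)) ≤
      3 * (freqConst + C₀ + C₁) * η := by
  have hη1 : η ≤ 1 := by
    by_contra hc
    exact (one_lt_pow₀ (not_le.1 hc) (by norm_num : 16 ≠ 0)).not_gt (hηε ▸ H.eps_lt_one)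
  have hS := H.eps_mul_sum_freq_le hη hηε
  have hC₁ := H.const_one_nonneg
  have hC₀ := H.const_zero_nonneg
  have hF := freqConst_nonneg
  -- The inequality `2ab ≤ a² + b²` with `b = η⁸ = √ε`. The leftover `h k * ε` is absorbed by `ε h k
  -- w_k`, because `w_k ≥ 1`.
  have key : ∀ k, ε * (h k * freq k ^ 2 * (|f k| + ε)) ≤
      η ^ 8 / 2 * (f k ^ 2 * freq k ^ 4 + ε ^ 2 * (h k * freq k ^ 4)
        + 2 * (ε * (h k * freq k))) := fun k => by
    have h0 := H.h_nonneg k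
    have hw := one_le_freq k
    have e8 : ε = η ^ 8 * η ^ 8 := by rw [← hηε]; ring
    have a1 : ε * (freq k ^ 2 * |f k|) ≤ η ^ 8 / 2 * (f k ^ 2 * freq k ^ 4 + ε) := by
      have : 0 ≤ η ^ 8 / 2 * (freq k ^ 2 * |f k| - η ^ 8) ^ 2 := by positivity
      rw [e8, ← sq_abs (f k)]
      nlinarith
    have a2 : ε * (freq k ^ 2 * ε) ≤ η ^ 8 / 2 * (ε ^ 2 * freq k ^ 4 + ε) := by
      have : 0 ≤ η ^ 8 / 2 * (ε * freq k ^ 2 - η ^ 8) ^ 2 := by positivity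
      have e : η ^ 8 / 2 * (ε * freq k ^ 2 - η ^ 8) ^ 2 =
        η ^ 8 / 2 * (ε ^ 2 * freq k ^ 4 + η ^ 8 * η ^ 8)
          - (η ^ 8 * η ^ 8) * (freq k ^ 2 * ε) := by ring
      rw [e, ← e8] at this
      linarith
    have hε := H.eps_pos.le
    have b : h k * ε ≤ ε * (h k * freq k) := by
      calc h k * ε = ε * (h k * 1) := by ring
        _ ≤ _ := by gcongr
    calc ε * (h k * freq k ^ 2 * (|f k| + ε)) =
          h k * (ε * (freq k ^ 2 * |f k|)) + h k * (ε * (freq k ^ 2 * ε)) := by ring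
      _ ≤ h k * (η ^ 8 / 2 * (f k ^ 2 * freq k ^ 4 + ε))
          + h k * (η ^ 8 / 2 * (ε ^ 2 * freq k ^ 4 + ε)) := by gcongr
      _ = η ^ 8 / 2 * (h k * (f k ^ 2 * freq k ^ 4) + ε ^ 2 * (h k * freq k ^ 4)
          + 2 * (h k * ε)) := by ring
      _ ≤ η ^ 8 / 2 * (1 * (f k ^ 2 * freq k ^ 4) + ε ^ 2 * (h k * freq k ^ 4)
          + 2 * (ε * (h k * freq k))) := by gcongr; exact H.h_le_one k
      _ = _ := by ring
  have hsum : ε * ∑ k ∈ s, h k * freq k ^ 2 * (|f k| + ε) ≤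
      η ^ 8 / 2 * (C₀ + C₁ + 2 * (η * (freqConst + C₁))) := by
    rw [Finset.mul_sum]
    refine (Finset.sum_le_sum fun k _ => key k).trans ?_
    rw [← Finset.mul_sum, Finset.sum_add_distrib, Finset.sum_add_distrib, ← Finset.mul_sum,
      ← Finset.mul_sum, ← Finset.mul_sum]
    have := H.sum_f
    have := H.sum_h
    gcongr
  have hη8 : η ^ 8 ≤ η := by
    calc η ^ 8 ≤ η ^ 1 := pow_le_pow_of_le_one hη.le hη1 (by norm_num)
      _ = η := pow_one η
  rw [Finset.sum_add_distrib, mul_add]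
  have h2 : η * (freqConst + C₁) ≤ 1 * (freqConst + C₁) := by gcongr
  have h3 : η ^ 8 / 2 * (C₀ + C₁ + 2 * (η * (freqConst + C₁))) ≤
      η / 2 * (C₀ + C₁ + 2 * (1 * (freqConst + C₁))) := by gcongr
  nlinarith [mul_nonneg hη.le hC₀, mul_nonneg hη.le hC₁, mul_nonneg hη.le hF]

theorem eps_sq_mul_sum_sq_le (H : IsAdmissible C₀ C₁ ρ ε s h f) {η : ℝ} (hη : 0 < η)
    (hηε : η ^ 16 = ε) :
    ε ^ 2 * ∑ k ∈ s, h k ^ 2 * freq k ^ 2 ≤ 3 * (freqConst + C₀ + C₁) * η := by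
  refine le_trans ?_ (H.eps_mul_sum_local_le hη hηε)
  rw [sq, mul_assoc]
  have := H.eps_pos
  gcongr
  rw [Finset.mul_sum]
  refine Finset.sum_le_sum fun k _ => ?_
  have h0 := H.h_nonneg k
  have hw := freq_pos k
  have h2 : h k ^ 2 ≤ h k := by nlinarith [H.h_le_one k]
  have a : ε * (h k ^ 2 * freq k ^ 2) ≤ ε * (h k * freq k ^ 2) := by gcongr
  have b : 0 ≤ h k * freq k + h k * freq k ^ 2 * |f k| := by positivity
  nlinarith

end IsAdmissible

/-! ### The exceptional event and stochastic bounds for the noise terms -/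

section

variable {Ω : Type*} [MeasurableSpace Ω] {ξ ζ : ℕ+ → Ω → ℝ} {ε : ℝ} {s : Finset ℕ+} {h f : ℕ+ → ℝ}

/-- The exceptional event on which the maximizer may fail to be close to the true shift. -/
def badEvent (s : Finset ℕ+) (h f : ℕ+ → ℝ) (ε a κ : ℝ) (ξ ζ : ℕ+ → Ω → ℝ) : Set Ω :=
  {ω | a ≤ |∑ k ∈ s, h k * freq k * f k * ζ k ω|} ∪
    {ω | κ ≤ ε * localBound s h f ε (ξ · ω) (ζ · ω)}

theorem measurableSet_badEvent {P : Measure Ω} (hG : IsGaussianPairs P ξ ζ)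
    (a κ : ℝ) :
    MeasurableSet (badEvent s h f ε a κ ξ ζ) := by
  have h1 := hG.measurable_fst
  have h2 := hG.measurable_snd
  refine MeasurableSet.union (measurableSet_le measurable_const ?_)
    (measurableSet_le measurable_const ?_)
  · exact (Finset.measurable_fun_sum s fun k _ => (h2 k).const_mul _).abs
  · unfold localBound
    exact (Finset.measurable_fun_sum s fun k _ =>
      (((measurable_const.add ((h1 k).pow_const 2)).add
        ((h2 k).pow_const 2)).const_mul _)).const_mul _

end

section

variable {Ω : Type*} [MeasurableSpace Ω] {P : Measure Ω} [IsProbabilityMeasure P]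
  {ξ ζ : ℕ+ → Ω → ℝ} {C₀ C₁ ρ ε : ℝ} {s : Finset ℕ+} {h f : ℕ+ → ℝ}

namespace IsGaussianPairs

theorem hasMoments_scoreSum (hG : IsGaussianPairs P ξ ζ) :
    HasMoments P fun ω => score s h f ε (ξ · ω) (ζ · ω) :=
  HasMoments.sum s fun _ _ => hG.hasMoments_score _ _ _ _

theorem hasMoments_thirdDeriv (hG : IsGaussianPairs P ξ ζ) :
    HasMoments P fun ω => thirdDeriv s h f ε (ξ · ω) (ζ · ω) :=
  HasMoments.sum s fun _ _ => hG.hasMoments_score _ _ _ _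

theorem hasMoments_curvatureSum (hG : IsGaussianPairs P ξ ζ) :
    HasMoments P fun ω => curvature s h f ε (ξ · ω) (ζ · ω) :=
  HasMoments.sum s fun _ _ => hG.hasMoments_curvature _ _ _ _

theorem hasMoments_fourthBound (hG : IsGaussianPairs P ξ ζ) :
    HasMoments P fun ω => fourthBound s h f ε (ξ · ω) (ζ · ω) :=
  HasMoments.sum s fun k _ => (hG.hasMoments_envelope k).const_mul _

theorem hasMoments_noiseBound (hG : IsGaussianPairs P ξ ζ) :
    HasMoments P fun ω => noiseBound s h (ξ · ω) (ζ · ω) :=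
  HasMoments.sum s fun k _ => (hG.hasMoments_envelope k).const_mul _

theorem hasMoments_localBound (hG : IsGaussianPairs P ξ ζ) :
    HasMoments P fun ω => localBound s h f ε (ξ · ω) (ζ · ω) :=
  HasMoments.sum s fun k _ => (hG.hasMoments_envelope k).const_mul _

theorem integral_score_sq (hG : IsGaussianPairs P ξ ζ) :
    ∫ ω, score s h f ε (ξ · ω) (ζ · ω) ^ 2 ∂P =
      ∑ k ∈ s, h k ^ 2 * freq k ^ 2 * (f k ^ 2 + ε ^ 2) := by
  simp_rw [score, hG.integral_sum_score_sq, mul_pow]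

end IsGaussianPairs

namespace IsAdmissible

theorem abs_integral_score_sq_mul_curvature_le (H : IsAdmissible C₀ C₁ ρ ε s h f)
    (hG : IsGaussianPairs P ξ ζ) :
    |∫ ω, score s h f ε (ξ · ω) (ζ · ω) ^ 2 * curvature s h f ε (ξ · ω) (ζ · ω) ∂P| ≤
      ε * (9 * momentConst 3 * (C₀ + C₁)) := by
  have hm := one_le_momentConst 3
  have hε := H.eps_pos
  refine (hG.abs_integral_sum_score_sq_mul_curvature_le s _ _ f hε.le).trans ?_
  gcongr
  refine le_trans (Finset.sum_le_sum fun k _ => ?_) H.sum_weighted_le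
  have h0 := H.h_nonneg k
  have hw := (freq_pos k).le
  rw [abs_of_nonneg (by positivity)]
  refine mul_le_mul_of_nonneg_right ?_ (by positivity)
  calc (h k * freq k) ^ 2 * (h k * freq k ^ 2) = h k * freq k ^ 4 * (h k ^ 2) := by ring
    _ ≤ h k * freq k ^ 4 * 1 := by gcongr; exact pow_le_one₀ h0 (H.h_le_one k)
    _ = _ := mul_one _

theorem integral_curvature_sq_le (H : IsAdmissible C₀ C₁ ρ ε s h f)
    (hG : IsGaussianPairs P ξ ζ) :
    ∫ ω, curvature s h f ε (ξ · ω) (ζ · ω) ^ 2 ∂P ≤ 2 * momentConst 2 * (C₀ + C₁) := by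
  have hm := one_le_momentConst 2
  refine (hG.integral_sum_curvature_sq_le s _ f H.eps_pos.le).trans ?_
  gcongr
  refine le_trans (Finset.sum_le_sum fun k _ => ?_) H.sum_weighted_le
  have h0 := H.h_nonneg k
  gcongr
  calc (h k * freq k ^ 2) ^ 2 = h k * freq k ^ 4 * h k := by ring
    _ ≤ h k * freq k ^ 4 * 1 := by gcongr; exact H.h_le_one k
    _ = _ := mul_one _

/-- The variance contains `h² w⁶`, while only `h w⁴` is summable with a uniform bound. The surplus
factor `h w²` is at most `(1 + C₁)/ε`. -/
theorem eps_mul_integral_thirdDeriv_sq_le (H : IsAdmissible C₀ C₁ ρ ε s h f)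
    (hG : IsGaussianPairs P ξ ζ) :
    ε * ∫ ω, thirdDeriv s h f ε (ξ · ω) (ζ · ω) ^ 2 ∂P ≤ (1 + C₁) * (C₀ + C₁) := by
  have hC := H.const_one_nonneg
  simp_rw [thirdDeriv, hG.integral_sum_score_sq]
  calc _ ≤ ∑ k ∈ s, (1 + C₁) * (h k * freq k ^ 4 * (f k ^ 2 + ε ^ 2)) := by
        rw [Finset.mul_sum]
        refine Finset.sum_le_sum fun k hk => ?_
        calc ε * ((h k * freq k ^ 3) ^ 2 * (f k ^ 2 + ε ^ 2)) =
              ε * (h k * freq k ^ 2) * (h k * freq k ^ 4 * (f k ^ 2 + ε ^ 2)) := by ring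
          _ ≤ _ := mul_le_mul_of_nonneg_right (H.eps_mul_weight_le hk) (H.weighted_nonneg k)
    _ ≤ _ := by rw [← Finset.mul_sum]; gcongr; exact H.sum_weighted_le

theorem abs_integral_score_cube_mul_thirdDeriv_le (H : IsAdmissible C₀ C₁ ρ ε s h f)
    (hG : IsGaussianPairs P ξ ζ) :
    |∫ ω, score s h f ε (ξ · ω) (ζ · ω) ^ 3 * thirdDeriv s h f ε (ξ · ω) (ζ · ω) ∂P| ≤
      momentConst 4 * (C₀ + C₁) ^ 2 + 3 * (C₀ + C₁) * (C₀ + C₁) := by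
  have hm := one_le_momentConst 4
  have hC := H.const_nonneg
  refine (hG.abs_integral_sum_score_cube_mul_le s _ _ f H.eps_pos.le).trans ?_
  have hT : ∀ k ∈ s, 0 ≤ h k * freq k ^ 4 * (f k ^ 2 + ε ^ 2) := fun k _ => H.weighted_nonneg k
  have c1 : ∑ k ∈ s, |(h k * freq k) ^ 3 * (h k * freq k ^ 3)| * (f k ^ 2 + ε ^ 2) ^ 2 ≤
      (C₀ + C₁) ^ 2 := by
    calc _ ≤ ∑ k ∈ s, (h k * freq k ^ 4 * (f k ^ 2 + ε ^ 2)) ^ 2 := by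
          refine Finset.sum_le_sum fun k _ => ?_
          have h0 := H.h_nonneg k
          have hw := one_le_freq k
          have hw0 := (freq_pos k).le
          rw [abs_of_nonneg (by positivity)]
          calc _ = h k ^ 2 * freq k ^ 6 * (f k ^ 2 + ε ^ 2) ^ 2 * h k ^ 2 := by ring
            _ ≤ h k ^ 2 * freq k ^ 8 * (f k ^ 2 + ε ^ 2) ^ 2 * 1 := by
                gcongr
                · norm_num
                · exact pow_le_one₀ h0 (H.h_le_one k)
            _ = _ := by ring
      _ ≤ (∑ k ∈ s, h k * freq k ^ 4 * (f k ^ 2 + ε ^ 2)) ^ 2 :=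
          Finset.sum_sq_le_sq_sum_of_nonneg hT
      _ ≤ _ := by
          have := Finset.sum_nonneg hT
          gcongr; exact H.sum_weighted_le
  have c2 : ∑ k ∈ s, (h k * freq k) ^ 2 * (f k ^ 2 + ε ^ 2) ≤ C₀ + C₁ := by
    refine le_trans (Finset.sum_le_sum fun k _ => ?_) H.sum_weighted_le
    have h0 := H.h_nonneg k
    have hw := one_le_freq k
    gcongr
    calc (h k * freq k) ^ 2 = h k * freq k ^ 2 * h k := by ring
      _ ≤ h k * freq k ^ 4 * 1 := by
          gcongr
          · norm_num
          · exact H.h_le_one k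
      _ = _ := mul_one _
  have c3 : ∑ k ∈ s, |h k * freq k * (h k * freq k ^ 3)| * (f k ^ 2 + ε ^ 2) ≤ C₀ + C₁ := by
    refine le_trans (Finset.sum_le_sum fun k _ => ?_) H.sum_weighted_le
    have h0 := H.h_nonneg k
    have hw := (freq_pos k).le
    rw [abs_of_nonneg (by positivity)]
    refine mul_le_mul_of_nonneg_right ?_ (by positivity)
    calc h k * freq k * (h k * freq k ^ 3) = h k * freq k ^ 4 * h k := by ring
      _ ≤ h k * freq k ^ 4 * 1 := by gcongr; exact H.h_le_one k
      _ = _ := mul_one _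
  gcongr

theorem integral_fourthBound_sq_le (H : IsAdmissible C₀ C₁ ρ ε s h f)
    (hG : IsGaussianPairs P ξ ζ) :
    ∫ ω, fourthBound s h f ε (ξ · ω) (ζ · ω) ^ 2 ∂P ≤
      (10 * (C₀ + C₁)) ^ 2 * momentConst 2 := by
  have hm := one_le_momentConst 2
  refine (hG.integral_weighted_envelope_pow_le s
    (fun k _ => mul_nonneg (by norm_num) (H.weighted_nonneg k)) 2).trans ?_
  rw [← Finset.mul_sum]
  have := Finset.sum_nonneg fun k (_ : k ∈ s) => H.weighted_nonneg k
  gcongr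
  exact H.sum_weighted_le

theorem integral_noiseBound_pow_le (H : IsAdmissible C₀ C₁ ρ ε s h f)
    (hG : IsGaussianPairs P ξ ζ) (p : ℕ) :
    ∫ ω, noiseBound s h (ξ · ω) (ζ · ω) ^ p ∂P ≤ (C₁ / ε ^ 2) ^ p * momentConst p := by
  have hm := one_le_momentConst p
  have h0 : ∀ k ∈ s, 0 ≤ h k * freq k ^ 4 := fun k _ => mul_nonneg (H.h_nonneg k) (by positivity)
  refine (hG.integral_weighted_envelope_pow_le s h0 p).trans ?_
  have := Finset.sum_nonneg h0
  have hε := H.eps_pos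
  gcongr
  rw [le_div_iff₀ (by positivity), mul_comm]
  exact H.sum_h

variable {x z : ℕ+ → ℝ}

theorem one_le_noiseBound (H : IsAdmissible C₀ C₁ ρ ε s h f) : 1 ≤ noiseBound s h x z := by
  have h0 := H.h_nonneg
  calc 1 ≤ freq 1 ^ 4 * (1 + x 1 ^ 2 + z 1 ^ 2) :=
        one_le_mul_of_one_le_of_one_le (one_le_pow₀ (one_le_freq 1))
          (by nlinarith [sq_nonneg (x 1), sq_nonneg (z 1)])
    _ = h 1 * freq 1 ^ 4 * (1 + x 1 ^ 2 + z 1 ^ 2) := by rw [H.h_one, one_mul]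
    _ ≤ _ := Finset.single_le_sum (f := fun k => h k * freq k ^ 4 * (1 + x k ^ 2 + z k ^ 2))
      (fun k _ => by have := h0 k; positivity) H.one_mem

theorem abs_sum_le_noiseBound (H : IsAdmissible C₀ C₁ ρ ε s h f) {j : ℕ} (hj : j ≤ 4)
    {g : ℕ+ → ℝ} (hg : ∀ k ∈ s, |g k| ≤ (|f k| + ε) * (1 + x k ^ 2 + z k ^ 2)) :
    |∑ k ∈ s, h k * freq k ^ j * g k| ≤ (C₀ + 2) * noiseBound s h x z := by
  rw [noiseBound, Finset.mul_sum]
  refine (Finset.abs_sum_le_sum_abs _ _).trans (Finset.sum_le_sum fun k hk => ?_)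
  have h0 := H.h_nonneg k
  have hw := one_le_freq k
  have hw0 := (freq_pos k).le
  have hε := H.eps_pos
  rw [abs_mul, abs_of_nonneg (by positivity)]
  calc h k * freq k ^ j * |g k| ≤
        h k * freq k ^ 4 * ((C₀ + 2) * (1 + x k ^ 2 + z k ^ 2)) := by
        gcongr
        exact (hg k hk).trans
          (mul_le_mul_of_nonneg_right (H.abs_coeff_add_le hk) (by positivity))
    _ = _ := by ring

theorem abs_score_le (H : IsAdmissible C₀ C₁ ρ ε s h f) :
    |score s h f ε x z| ≤ (C₀ + 2) * noiseBound s h x z := by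
  have := H.abs_sum_le_noiseBound (x := x) (z := z) (j := 1) (by norm_num)
    (g := fun k => (f k + ε * x k) * z k) fun k _ => by
      have hε := H.eps_pos
      refine (abs_score_noise_le hε.le).trans (half_le_self (by positivity))
  simpa only [score, pow_one] using this

theorem abs_curvature_le (H : IsAdmissible C₀ C₁ ρ ε s h f) :
    |curvature s h f ε x z| ≤ (C₀ + 2) * noiseBound s h x z :=
  H.abs_sum_le_noiseBound (by norm_num) fun _ _ => abs_curvature_noise_le H.eps_pos.le

theorem abs_thirdDeriv_le (H : IsAdmissible C₀ C₁ ρ ε s h f) :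
    |thirdDeriv s h f ε x z| ≤ (C₀ + 2) * noiseBound s h x z :=
  H.abs_sum_le_noiseBound (by norm_num) fun k _ => by
    have hε := H.eps_pos
    exact (abs_score_noise_le hε.le).trans (half_le_self (by positivity))

/-- The score splits into a Gaussian linear form, which has an exponential tail, and a quadratic
form in the noise. The latter is small enough to be controlled by high moments alone. -/
theorem abs_score_le_linear_add (H : IsAdmissible C₀ C₁ ρ ε s h f) :
    |score s h f ε x z| ≤
      |∑ k ∈ s, h k * freq k * f k * z k| + ε * localBound s h f ε x z := by
  have hε := H.eps_pos
  have e : score s h f ε x z = (∑ k ∈ s, h k * freq k * f k * z k)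
      + ε * ∑ k ∈ s, h k * freq k * (x k * z k) := by
    rw [score, Finset.mul_sum, ← Finset.sum_add_distrib]
    exact Finset.sum_congr rfl fun k _ => by ring
  rw [e]
  refine (abs_add_le _ _).trans ?_
  rw [abs_mul, abs_of_pos hε, localBound]
  gcongr
  refine (Finset.abs_sum_le_sum_abs _ _).trans (Finset.sum_le_sum fun k _ => ?_)
  have h0 := H.h_nonneg k
  have hw := (freq_pos k).le
  rw [abs_mul, abs_of_nonneg (by positivity : 0 ≤ h k * freq k)]
  have hxz : |x k * z k| ≤ 1 + x k ^ 2 + z k ^ 2 := by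
    rw [abs_le]; constructor <;> nlinarith [sq_nonneg (x k - z k), sq_nonneg (x k + z k)]
  have h2 : h k * freq k ≤ h k * freq k + h k * freq k ^ 2 * (|f k| + ε) :=
    le_add_of_nonneg_right (by positivity)
  gcongr

/-- The power `24` is chosen to beat a loss of `ε⁻²⁰` and still leave `ε⁴`. For the linear form, the
threshold `12 (1 + C₀) l` makes the Gaussian exponent at least `12 l² = 24 log ε⁻¹`. -/
theorem measureReal_badEvent_le (H : IsAdmissible C₀ C₁ ρ ε s h f) (hC₀ : 0 < C₀)
    (hG : IsGaussianPairs P ξ ζ) {κ l : ℝ} (hκ : 0 < κ) (hl : 0 ≤ l)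
    (hlog : l ^ 2 = Real.log (ε ^ (-2 : ℤ))) :
    P.real (badEvent s h f ε (12 * (1 + C₀) * l) κ ξ ζ) ≤
      (2 + (3 * (freqConst + C₀ + C₁) / κ) ^ 384 * momentConst 384) * ε ^ 24 := by
  have hε := H.eps_pos
  have hexp : Real.exp (-(12 * l ^ 2)) = ε ^ 24 := by
    rw [hlog, Real.log_zpow, show -(12 * (((-2 : ℤ) : ℝ) * Real.log ε)) = (24 : ℕ) * Real.log ε by
      push_cast; ring, Real.exp_nat_mul, Real.exp_log hε]
  refine (measureReal_union_le _ _).trans ?_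
  rw [add_mul]
  refine add_le_add ?_ ?_
  · have hc : ∑ k ∈ s, (h k * freq k * f k) ^ 2 ≤ C₀ := by
      refine le_trans (Finset.sum_le_sum fun k _ => ?_) H.sum_f
      have h0 := H.h_nonneg k
      have hw := one_le_freq k
      calc _ = f k ^ 2 * freq k ^ 2 * h k ^ 2 := by ring
        _ ≤ f k ^ 2 * freq k ^ 4 * 1 := by
          gcongr
          · norm_num
          · exact pow_le_one₀ h0 (H.h_le_one k)
        _ = _ := mul_one _
    refine (hG.measureReal_abs_sum_snd_ge_le s (fun k => h k * freq k * f k) hC₀ hc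
      (by positivity)).trans ?_
    rw [← hexp]
    gcongr
    rw [neg_div, neg_le_neg_iff, le_div_iff₀ (by positivity)]
    have : 24 * C₀ ≤ (12 * (1 + C₀)) ^ 2 := by nlinarith
    calc 12 * l ^ 2 * (2 * C₀) = 24 * C₀ * l ^ 2 := by ring
      _ ≤ (12 * (1 + C₀)) ^ 2 * l ^ 2 := by gcongr
      _ = _ := by ring
  -- The weights of `ε * localBound` sum to `O(ε^(1/16))`, so Markov's inequality for the moment of
  -- order `384 = 16 · 24` gives `ε²⁴`.
  · set η : ℝ := ε ^ ((1 : ℝ) / 16)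
    have hη : 0 < η := Real.rpow_pos_of_pos hε _
    have hηε : η ^ 16 = ε := by
      rw [← Real.rpow_natCast, ← Real.rpow_mul hε.le]; norm_num
    set W : Ω → ℝ := fun ω => ε * localBound s h f ε (ξ · ω) (ζ · ω) with hW
    have h0 : ∀ k ∈ s, 0 ≤ h k * freq k + h k * freq k ^ 2 * (|f k| + ε) := fun k _ => by
      have := H.h_nonneg k
      have := (freq_pos k).le
      positivity
    have hW0 : ∀ ω, 0 ≤ W ω := fun ω =>
      mul_nonneg hε.le (Finset.sum_nonneg fun k hk => mul_nonneg (h0 k hk) (by positivity))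
    have hmom : ∫ ω, W ω ^ 384 ∂P ≤
        (3 * (freqConst + C₀ + C₁) * η) ^ 384 * momentConst 384 := by
      have h1 : ∫ ω, W ω ^ 384 ∂P = ε ^ 384 * ∫ ω, localBound s h f ε (ξ · ω) (ζ · ω) ^ 384 ∂P := by
        rw [← integral_const_mul]
        exact integral_congr_ae (Eventually.of_forall fun ω => mul_pow _ _ _)
      have h2 := hG.integral_weighted_envelope_pow_le s h0 384
      have hm := one_le_momentConst 384
      have h3 := Finset.sum_nonneg h0
      calc _ ≤ ε ^ 384 * ((∑ k ∈ s, (h k * freq k + h k * freq k ^ 2 * (|f k| + ε))) ^ 384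
            * momentConst 384) := by rw [h1]; gcongr; exact h2
        _ = (ε * ∑ k ∈ s, (h k * freq k + h k * freq k ^ 2 * (|f k| + ε))) ^ 384
            * momentConst 384 := by rw [mul_pow]; ring
        _ ≤ _ := mul_le_mul_of_nonneg_right (pow_le_pow_left₀
            (mul_nonneg hε.le h3) (H.eps_mul_sum_local_le hη hηε) 384) (by positivity)
    have hmarkov := mul_meas_ge_le_integral_of_nonneg
      (Eventually.of_forall fun ω => pow_nonneg (hW0 ω) 384)
      ((hG.hasMoments_localBound (s := s) (h := h) (f := f) (ε := ε)).const_mul ε |>.pow 384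
        |>.integrable) (κ ^ 384)
    have hsub : P.real {ω | κ ≤ W ω} ≤ P.real {ω | κ ^ 384 ≤ W ω ^ 384} :=
      measureReal_mono fun ω hω => pow_le_pow_left₀ hκ.le hω 384
    have hκp : 0 < κ ^ 384 := by positivity
    have h4 : P.real {ω | κ ≤ W ω} ≤
        (3 * (freqConst + C₀ + C₁) * η) ^ 384 * momentConst 384 / κ ^ 384 := by
      rw [le_div_iff₀ hκp, mul_comm]
      exact (mul_le_mul_of_nonneg_left hsub hκp.le).trans (hmarkov.trans hmom)
    refine h4.trans (le_of_eq ?_)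
    have hη24 : η ^ 384 = ε ^ 24 := by rw [← hηε]; ring
    rw [mul_pow _ η, hη24, div_pow]
    field_simp

end IsAdmissible

end

/-! ### Second-order expansion of the mean squared error -/

/-- A crude bound for the remainder of the expansion of the squared error. -/
theorem abs_sq_expansion_le_pow_four {C₀ ρ a D u N Z V Y ε : ℝ} (hρ : 0 < ρ) (hD : ρ ≤ D)
    (hD' : D ≤ C₀) (ha : 0 ≤ a) (hu : |u| ≤ 1) (hY : 1 ≤ Y) (hN : |N| ≤ a * Y)
    (hZ : |Z| ≤ a * Y) (hV : |V| ≤ a * Y) (hε : 0 ≤ ε) (hε1 : ε ≤ 1) :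
    |D ^ 2 * u ^ 2 - ε ^ 2 * N ^ 2 + 2 * ε ^ 3 / D * (N ^ 2 * Z) + 4 * ε ^ 4 / D ^ 2 * (N ^ 3 * V)|
      ≤ (C₀ ^ 2 + a ^ 2 + 2 * a ^ 3 / ρ + 4 * a ^ 4 / ρ ^ 2) * Y ^ 4 := by
  have hD0 : 0 < D := hρ.trans_le hD
  have hY0 : 0 ≤ Y := by linarith
  have b1 : |D ^ 2 * u ^ 2| ≤ C₀ ^ 2 * Y ^ 4 := by
    rw [abs_mul, abs_pow, abs_pow, abs_of_pos hD0]
    calc D ^ 2 * |u| ^ 2 ≤ C₀ ^ 2 * 1 := by gcongr; exact pow_le_one₀ (abs_nonneg u) hu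
      _ ≤ _ := by gcongr; exact one_le_pow₀ hY
  have b2 : |ε ^ 2 * N ^ 2| ≤ a ^ 2 * Y ^ 4 := by
    rw [abs_mul, abs_pow, abs_pow, abs_of_nonneg hε]
    calc ε ^ 2 * |N| ^ 2 ≤ 1 * (a * Y) ^ 2 := by gcongr; exact pow_le_one₀ hε hε1
      _ = a ^ 2 * Y ^ 2 := by ring
      _ ≤ _ := by gcongr; norm_num
  have b3 : |2 * ε ^ 3 / D * (N ^ 2 * Z)| ≤ 2 * a ^ 3 / ρ * Y ^ 4 := by
    rw [abs_mul, abs_mul, abs_pow, abs_of_nonneg (by positivity : 0 ≤ 2 * ε ^ 3 / D)]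
    calc 2 * ε ^ 3 / D * (|N| ^ 2 * |Z|) ≤ 2 * 1 / ρ * ((a * Y) ^ 2 * (a * Y)) := by
          gcongr; exact pow_le_one₀ hε hε1
      _ = 2 * a ^ 3 / ρ * Y ^ 3 := by ring
      _ ≤ _ := by gcongr; norm_num
  have b4 : |4 * ε ^ 4 / D ^ 2 * (N ^ 3 * V)| ≤ 4 * a ^ 4 / ρ ^ 2 * Y ^ 4 := by
    rw [abs_mul, abs_mul, abs_pow, abs_of_nonneg (by positivity : 0 ≤ 4 * ε ^ 4 / D ^ 2)]
    calc 4 * ε ^ 4 / D ^ 2 * (|N| ^ 3 * |V|) ≤ 4 * 1 / ρ ^ 2 * ((a * Y) ^ 3 * (a * Y)) := by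
          gcongr; exact pow_le_one₀ hε hε1
      _ = _ := by ring
  calc _ ≤ C₀ ^ 2 * Y ^ 4 + a ^ 2 * Y ^ 4 + 2 * a ^ 3 / ρ * Y ^ 4 + 4 * a ^ 4 / ρ ^ 2 * Y ^ 4 :=
        (abs_add_le _ _).trans (add_le_add ((abs_add_le _ _).trans (add_le_add
          ((abs_sub _ _).trans (add_le_add b1 b2)) b3)) b4)
    _ = _ := by ring

/-- Localization radius of the maximizer, in units of `ε √(log ε⁻²)`. -/
noncomputable def locRadius (C₀ ρ c : ℝ) : ℝ := 4 / (ρ * c) * (12 * (1 + C₀) + 1)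

/-- The constant in the expansion of the error on the good event. -/
noncomputable def goodConst (A B d : ℝ) : ℝ :=
  3 * (2 * A * (B + 2 * B ^ 2 + B ^ 3) / d
    + 4 * A * (B + 2 * B ^ 2 + B ^ 3) * (B + A / d) / d + (B + 2 * B ^ 2 + B ^ 3) ^ 2)
    + 2 * A * B ^ 3

section

variable {Ω : Type*} [MeasurableSpace Ω] {P : Measure Ω} [IsProbabilityMeasure P]
  {ξ ζ : ℕ+ → Ω → ℝ} {C₀ C₁ ρ ε : ℝ} {s : Finset ℕ+} {h f : ℕ+ → ℝ}

/-- The remainder in the second-order expansion of `D² u²`. -/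
noncomputable def expansionError (s : Finset ℕ+) (h f : ℕ+ → ℝ) (ε u : ℝ) (x z : ℕ+ → ℝ) : ℝ :=
  filteredInfo s h f ^ 2 * u ^ 2 - ε ^ 2 * score s h f ε x z ^ 2
    + 2 * ε ^ 3 / filteredInfo s h f * (score s h f ε x z ^ 2 * curvature s h f ε x z)
    + 4 * ε ^ 4 / filteredInfo s h f ^ 2 * (score s h f ε x z ^ 3 * thirdDeriv s h f ε x z)

namespace IsAdmissible

/-- Maximality localizes `u` first; only then is the derivative known to vanish, which is why `hder`
is conditional. Off the exceptional event the quadratic part of the score is below `κ ≤ 1 ≤ l`,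
which explains the `+ 1` in the constants. -/
theorem abs_expansionError_le_of_notMem {Ω : Type*} {ξ ζ : ℕ+ → Ω → ℝ} {c e l κ u : ℝ} {ω : Ω}
    (H : IsAdmissible C₀ C₁ ρ ε s h f) (hC₀ : 0 < C₀)
    (hρ : 0 < ρ) (hc : 0 < c) (he : 0 < e) (hl : 1 ≤ l) (hel : e * l ≤ 1) (heε : e ^ 2 = ε)
    (hκ1 : κ ≤ 1) (hκ2 : 8 * κ ≤ ρ * c)
    (hω : ω ∉ badEvent s h f ε (12 * (1 + C₀) * l) κ ξ ζ)
    (hsin : c * u ^ 2 ≤ Real.sin (freq 1 * u) ^ 2)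
    (hmax : crit s h f ε (ξ · ω) (ζ · ω) 0 ≤ crit s h f ε (ξ · ω) (ζ · ω) u)
    (hder : |u| ≤ locRadius C₀ ρ c * (ε * l) → deriv (crit s h f ε (ξ · ω) (ζ · ω)) u = 0) :
    |expansionError s h f ε u (ξ · ω) (ζ · ω)| ≤
      goodConst (12 * (1 + C₀) + 1) (locRadius C₀ ρ c) ρ * (ε ^ 4 * l ^ 4) *
        (1 + curvature s h f ε (ξ · ω) (ζ · ω) ^ 2
          + ε * thirdDeriv s h f ε (ξ · ω) (ζ · ω) ^ 2
          + fourthBound s h f ε (ξ · ω) (ζ · ω) ^ 2) := by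
  simp only [badEvent, mem_union, mem_ofPred_eq, not_or, not_le] at hω
  obtain ⟨hω1, hω2⟩ := hω
  have hε := H.eps_pos
  have hρc : 0 < ρ * c := mul_pos hρ hc
  have hN : |score s h f ε (ξ · ω) (ζ · ω)| ≤ (12 * (1 + C₀) + 1) * l := by
    refine H.abs_score_le_linear_add.trans ?_
    linarith
  have hu : |u| ≤ locRadius C₀ ρ c * (ε * l) := by
    refine (abs_le_of_crit_zero_le hε.le H.h_nonneg H.one_mem H.h_one hρ hc H.le_first hsin hmax
      (by linarith)).trans ?_
    rw [locRadius]
    calc _ ≤ 4 / (ρ * c) * (ε * ((12 * (1 + C₀) + 1) * l)) := by gcongr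
      _ = _ := by ring
  have hroot := abs_root_equation_le H.h_nonneg (hder hu)
  have hQ : 0 ≤ fourthBound s h f ε (ξ · ω) (ζ · ω) :=
    Finset.sum_nonneg fun k _ => mul_nonneg (mul_nonneg (by norm_num) (H.weighted_nonneg k))
      (by positivity)
  subst heε
  have hB : 0 ≤ locRadius C₀ ρ c := by unfold locRadius; positivity
  exact abs_sq_root_expansion_le hρ H.le_filteredInfo he hl hel (by positivity) hB
    hQ hN hu hroot

theorem abs_expansionError_le (H : IsAdmissible C₀ C₁ ρ ε s h f) (hρ : 0 < ρ) {u : ℝ}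
    {x z : ℕ+ → ℝ} (hu : |u| ≤ 1) :
    |expansionError s h f ε u x z| ≤
      (C₀ ^ 2 + (C₀ + 2) ^ 2 + 2 * (C₀ + 2) ^ 3 / ρ + 4 * (C₀ + 2) ^ 4 / ρ ^ 2) *
        noiseBound s h x z ^ 4 :=
  abs_sq_expansion_le_pow_four hρ H.le_filteredInfo H.filteredInfo_le
    (by linarith [H.const_zero_nonneg]) hu H.one_le_noiseBound H.abs_score_le H.abs_curvature_le
    H.abs_thirdDeriv_le H.eps_pos.le H.eps_lt_one.le

theorem _root_.ShiftModel.IsGaussianPairs.integral_expansionError (hG : IsGaussianPairs P ξ ζ)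
    {u : Ω → ℝ} (hum : Measurable u) (hu : ∀ ω, |u ω| ≤ 1) :
    Integrable (fun ω => expansionError s h f ε (u ω) (ξ · ω) (ζ · ω)) P ∧
    ∫ ω, expansionError s h f ε (u ω) (ξ · ω) (ζ · ω) ∂P =
      filteredInfo s h f ^ 2 * ∫ ω, u ω ^ 2 ∂P
        - ε ^ 2 * ∑ k ∈ s, h k ^ 2 * freq k ^ 2 * (f k ^ 2 + ε ^ 2)
        + 2 * ε ^ 3 / filteredInfo s h f *
          ∫ ω, score s h f ε (ξ · ω) (ζ · ω) ^ 2 * curvature s h f ε (ξ · ω) (ζ · ω) ∂P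
        + 4 * ε ^ 4 / filteredInfo s h f ^ 2 *
          ∫ ω, score s h f ε (ξ · ω) (ζ · ω) ^ 3 * thirdDeriv s h f ε (ξ · ω) (ζ · ω) ∂P := by
  have iN : HasMoments P fun ω => score s h f ε (ξ · ω) (ζ · ω) := hG.hasMoments_scoreSum
  have iZ : HasMoments P fun ω => curvature s h f ε (ξ · ω) (ζ · ω) := hG.hasMoments_curvatureSum
  have iV : HasMoments P fun ω => thirdDeriv s h f ε (ξ · ω) (ζ · ω) := hG.hasMoments_thirdDeriv
  have i1 : Integrable (fun ω => filteredInfo s h f ^ 2 * u ω ^ 2) P := by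
    refine Integrable.const_mul (Integrable.of_bound (hum.pow_const 2).aestronglyMeasurable 1
      (Eventually.of_forall fun ω => ?_)) _
    rw [Real.norm_eq_abs, abs_pow]
    exact pow_le_one₀ (abs_nonneg _) (hu ω)
  have i2 := ((iN.pow 2).const_mul (ε ^ 2)).integrable
  have i3 := (((iN.pow 2).mul iZ).const_mul (2 * ε ^ 3 / filteredInfo s h f)).integrable
  have i4 := (((iN.pow 3).mul iV).const_mul (4 * ε ^ 4 / filteredInfo s h f ^ 2)).integrable
  have i12 : Integrable (fun ω => filteredInfo s h f ^ 2 * u ω ^ 2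
      - ε ^ 2 * score s h f ε (ξ · ω) (ζ · ω) ^ 2) P := i1.sub i2
  refine ⟨(i12.fun_add i3).fun_add i4, ?_⟩
  unfold expansionError
  rw [integral_add (i12.fun_add i3) i4, integral_add i12 i3, integral_sub i1 i2,
    integral_const_mul, integral_const_mul, integral_const_mul, integral_const_mul,
    hG.integral_score_sq]

end IsAdmissible

end

/-- The constant in the bound for the probability of the exceptional event. -/
noncomputable def tailConst (C₀ C₁ κ : ℝ) : ℝ :=
  2 + (3 * (freqConst + C₀ + C₁) / κ) ^ 384 * momentConst 384

/-- The constant in the second-order expansion of the risk. -/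
noncomputable def riskConst (C₀ C₁ ρ c : ℝ) : ℝ :=
  goodConst (12 * (1 + C₀) + 1) (locRadius C₀ ρ c) ρ *
      (1 + 2 * momentConst 2 * (C₀ + C₁) + (1 + C₁) * (C₀ + C₁)
        + (10 * (C₀ + C₁)) ^ 2 * momentConst 2)
    + (C₀ ^ 2 + (C₀ + 2) ^ 2 + 2 * (C₀ + 2) ^ 3 / ρ + 4 * (C₀ + 2) ^ 4 / ρ ^ 2) *
      (tailConst C₀ C₁ (min 1 (ρ * c / 8))
        + C₁ ^ 8 * momentConst 8)
    + 2 / ρ * (9 * momentConst 3 * (C₀ + C₁))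
    + 4 / ρ ^ 2 * (momentConst 4 * (C₀ + C₁) ^ 2 + 3 * (C₀ + C₁) * (C₀ + C₁))

section

variable {Ω : Type*} [MeasurableSpace Ω] {P : Measure Ω} [IsProbabilityMeasure P]
  {ξ ζ : ℕ+ → Ω → ℝ} {C₀ C₁ ρ ε : ℝ} {s : Finset ℕ+} {h f : ℕ+ → ℝ}

theorem tailConst_nonneg {κ : ℝ} : 0 ≤ tailConst C₀ C₁ κ := by
  have := one_le_momentConst 384
  unfold tailConst
  positivity

theorem goodConst_nonneg {A B d : ℝ} (hA : 0 ≤ A) (hB : 0 ≤ B) (hd : 0 < d) :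
    0 ≤ goodConst A B d := by unfold goodConst; positivity

set_option maxHeartbeats 1000000 in
/-- Second-order expansion of the mean squared error of a maximizer of the criterion. -/
theorem IsAdmissible.abs_integral_sq_sub_le {c e l : ℝ}
    (H : IsAdmissible C₀ C₁ ρ ε s h f) (hG : IsGaussianPairs P ξ ζ) (hC₀ : 0 < C₀)
    (hρ : 0 < ρ) (hc : 0 < c) (he : 0 < e) (hl : 1 ≤ l) (hel : e * l ≤ 1) (heε : e ^ 2 = ε)
    (hlog : l ^ 2 = Real.log (ε ^ (-2 : ℤ)))
    {u : Ω → ℝ} (hum : Measurable u) (hu : ∀ ω, |u ω| ≤ 1)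
    (hsin : ∀ ω, c * u ω ^ 2 ≤ Real.sin (freq 1 * u ω) ^ 2)
    (hmax : ∀ ω, crit s h f ε (ξ · ω) (ζ · ω) 0 ≤ crit s h f ε (ξ · ω) (ζ · ω) (u ω))
    (hder : ∀ ω, |u ω| ≤ locRadius C₀ ρ c * (ε * l) →
      deriv (crit s h f ε (ξ · ω) (ζ · ω)) (u ω) = 0) :
    |filteredInfo s h f ^ 2 * ∫ ω, u ω ^ 2 ∂P
      - ε ^ 2 * ∑ k ∈ s, h k ^ 2 * freq k ^ 2 * (f k ^ 2 + ε ^ 2)| ≤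
      riskConst C₀ C₁ ρ c * (ε ^ 4 * l ^ 4) := by
  have hε := H.eps_pos
  have hC₁ := H.const_one_nonneg
  set κ := min 1 (ρ * c / 8) with hκ
  have hκ0 : 0 < κ := lt_min one_pos (by positivity)
  have hκ2 : 8 * κ ≤ ρ * c := by have : κ ≤ ρ * c / 8 := min_le_right _ _
                                 linarith
  set bad := badEvent s h f ε (12 * (1 + C₀) * l) κ ξ ζ with hbad
  have hbm : MeasurableSet bad := measurableSet_badEvent hG _ _
  set G := goodConst (12 * (1 + C₀) + 1) (locRadius C₀ ρ c) ρ with hGdef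
  have hG0 : 0 ≤ G := goodConst_nonneg (by positivity) (by unfold locRadius; positivity) hρ
  set K := C₀ ^ 2 + (C₀ + 2) ^ 2 + 2 * (C₀ + 2) ^ 3 / ρ + 4 * (C₀ + 2) ^ 4 / ρ ^ 2 with hK
  have hK0 : 0 ≤ K := by positivity
  have hD := H.le_filteredInfo
  have hD0 := hρ.trans_le hD
  have hl4 : 1 ≤ l ^ 4 := one_le_pow₀ hl
  have iZ : HasMoments P fun ω => curvature s h f ε (ξ · ω) (ζ · ω) := hG.hasMoments_curvatureSum
  have iV : HasMoments P fun ω => thirdDeriv s h f ε (ξ · ω) (ζ · ω) := hG.hasMoments_thirdDeriv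
  have iQ : HasMoments P fun ω => fourthBound s h f ε (ξ · ω) (ζ · ω) :=
    hG.hasMoments_fourthBound
  have iY : HasMoments P fun ω => noiseBound s h (ξ · ω) (ζ · ω) := hG.hasMoments_noiseBound
  have j0 : Integrable (fun _ : Ω => (1 : ℝ)) P := integrable_const 1
  have j1 := (iZ.pow 2).integrable
  have j2 := ((iV.pow 2).const_mul ε).integrable
  have j3 := (iQ.pow 2).integrable
  have jg := ((((j0.fun_add j1).fun_add j2).fun_add j3).const_mul (G * (ε ^ 4 * l ^ 4)))
  have jb : Integrable (bad.indicator fun _ => (1 : ℝ)) P := j0.indicator hbm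
  have jY := ((iY.pow 8).const_mul (ε ^ 20)).integrable
  have jc := ((jb.const_mul (ε ^ 20)⁻¹).fun_add jY).const_mul K
  obtain ⟨iE, hE⟩ := hG.integral_expansionError (s := s) (h := h) (f := f) (ε := ε) hum hu
  have hpt : ∀ ω, |expansionError s h f ε (u ω) (ξ · ω) (ζ · ω)| ≤
      G * (ε ^ 4 * l ^ 4) * (1 + curvature s h f ε (ξ · ω) (ζ · ω) ^ 2
          + ε * thirdDeriv s h f ε (ξ · ω) (ζ · ω) ^ 2
          + fourthBound s h f ε (ξ · ω) (ζ · ω) ^ 2)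
        + K * ((ε ^ 20)⁻¹ * bad.indicator (fun _ => (1 : ℝ)) ω
          + ε ^ 20 * noiseBound s h (ξ · ω) (ζ · ω) ^ 8) := by
    intro ω
    by_cases hω : ω ∈ bad
    · refine le_add_of_nonneg_of_le (by positivity) ?_
      refine (H.abs_expansionError_le hρ (hu ω)).trans ?_
      rw [indicator_of_mem hω, mul_one, ← hK]
      gcongr
      set Y := noiseBound s h (ξ · ω) (ζ · ω)
      -- Splitting `Y⁴ = ε⁻¹⁰ · (ε¹⁰ Y⁴)` by `ab ≤ a² + b²` separates the indicator from the noise.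
      -- The costs are `ε⁻²⁰ · ε²⁴` for the probability and `ε²⁰ · ε⁻¹⁶` for the eighth moment, both
      -- equal to `ε⁴`.
      have h1 : ε ^ 20 * Y ^ 8 = (ε ^ 10 * Y ^ 4) ^ 2 := by ring
      have h2 : (ε ^ 20)⁻¹ = ((ε ^ 10)⁻¹) ^ 2 := by rw [← inv_pow]; ring
      have h3 : Y ^ 4 = (ε ^ 10)⁻¹ * (ε ^ 10 * Y ^ 4) := by field_simp
      rw [h1, h2, h3]
      have : ε ^ 10 * ((ε ^ 10)⁻¹ * (ε ^ 10 * Y ^ 4)) = ε ^ 10 * Y ^ 4 := by rw [← h3]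
      rw [this]
      nlinarith [sq_nonneg ((ε ^ 10)⁻¹ - ε ^ 10 * Y ^ 4), sq_nonneg ((ε ^ 10)⁻¹),
        sq_nonneg (ε ^ 10 * Y ^ 4)]
    · refine le_add_of_le_of_nonneg (H.abs_expansionError_le_of_notMem hC₀ hρ hc he hl hel heε
        (min_le_left _ _) hκ2 hω (hsin ω) (hmax ω) (hder ω)) ?_
      rw [indicator_of_notMem hω]
      have := (zero_le_one.trans (H.one_le_noiseBound (x := (ξ · ω)) (z := (ζ · ω))))
      positivity
  have hint : |∫ ω, expansionError s h f ε (u ω) (ξ · ω) (ζ · ω) ∂P| ≤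
      G * (ε ^ 4 * l ^ 4) * (1 + 2 * momentConst 2 * (C₀ + C₁) + (1 + C₁) * (C₀ + C₁)
          + (10 * (C₀ + C₁)) ^ 2 * momentConst 2)
        + K * ((tailConst C₀ C₁ κ
          + C₁ ^ 8 * momentConst 8) * (ε ^ 4 * l ^ 4)) := by
    refine abs_integral_le_integral_abs.trans ((integral_mono iE.abs (jg.fun_add jc) hpt).trans ?_)
    rw [integral_add jg jc]
    refine add_le_add ?_ ?_
    · rw [integral_const_mul]
      refine mul_le_mul_of_nonneg_left ?_ (by positivity)
      rw [integral_add ((j0.fun_add j1).fun_add j2) j3, integral_add (j0.fun_add j1) j2, integral_add j0 j1,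
        integral_const_mul]
      refine add_le_add (add_le_add (add_le_add (by simp) (H.integral_curvature_sq_le hG))
        (H.eps_mul_integral_thirdDeriv_sq_le hG)) (H.integral_fourthBound_sq_le hG)
    · rw [integral_const_mul]
      refine mul_le_mul_of_nonneg_left ?_ hK0
      rw [integral_add (jb.const_mul _) jY, integral_const_mul, integral_const_mul,
        integral_indicator_const _ hbm, smul_eq_mul, mul_one]
      have b1 : (ε ^ 20)⁻¹ * P.real bad ≤ (ε ^ 20)⁻¹ *
          (tailConst C₀ C₁ κ * ε ^ 24) := by
        gcongr
        exact H.measureReal_badEvent_le hC₀ hG hκ0 (by linarith) hlog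
      have b2 : ε ^ 20 * ∫ ω, noiseBound s h (ξ · ω) (ζ · ω) ^ 8 ∂P ≤
          ε ^ 20 * ((C₁ / ε ^ 2) ^ 8 * momentConst 8) := by
        gcongr
        exact_mod_cast H.integral_noiseBound_pow_le hG 8
      have hF := freqConst_nonneg
      have hm1 : 0 ≤ tailConst C₀ C₁ κ := tailConst_nonneg
      have hm2 := one_le_momentConst 8
      calc _ ≤ _ := add_le_add b1 b2
        _ = (tailConst C₀ C₁ κ
          + C₁ ^ 8 * momentConst 8) * (ε ^ 4 * 1) := by field_simp
        _ ≤ _ := by gcongr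
  have c3 : |2 * ε ^ 3 / filteredInfo s h f *
      ∫ ω, score s h f ε (ξ · ω) (ζ · ω) ^ 2 * curvature s h f ε (ξ · ω) (ζ · ω) ∂P| ≤
      2 / ρ * (9 * momentConst 3 * (C₀ + C₁)) * (ε ^ 4 * l ^ 4) := by
    have hm := one_le_momentConst 3
    rw [abs_mul, abs_of_nonneg (by positivity : 0 ≤ 2 * ε ^ 3 / filteredInfo s h f)]
    calc _ ≤ 2 * ε ^ 3 / ρ * (ε * (9 * momentConst 3 * (C₀ + C₁))) :=
          mul_le_mul (by gcongr) (H.abs_integral_score_sq_mul_curvature_le hG) (abs_nonneg _)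
            (by positivity)
      _ = 2 / ρ * (9 * momentConst 3 * (C₀ + C₁)) * (ε ^ 4 * 1) := by ring
      _ ≤ _ := by gcongr
  have c4 : |4 * ε ^ 4 / filteredInfo s h f ^ 2 *
      ∫ ω, score s h f ε (ξ · ω) (ζ · ω) ^ 3 * thirdDeriv s h f ε (ξ · ω) (ζ · ω) ∂P| ≤
      4 / ρ ^ 2 * (momentConst 4 * (C₀ + C₁) ^ 2 + 3 * (C₀ + C₁) * (C₀ + C₁)) *
        (ε ^ 4 * l ^ 4) := by
    have hm := one_le_momentConst 4
    rw [abs_mul, abs_of_nonneg (by positivity : 0 ≤ 4 * ε ^ 4 / filteredInfo s h f ^ 2)]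
    calc _ ≤ 4 * ε ^ 4 / ρ ^ 2 *
          (momentConst 4 * (C₀ + C₁) ^ 2 + 3 * (C₀ + C₁) * (C₀ + C₁)) :=
          mul_le_mul (by gcongr) (H.abs_integral_score_cube_mul_thirdDeriv_le hG) (abs_nonneg _)
            (by positivity)
      _ = 4 / ρ ^ 2 * (momentConst 4 * (C₀ + C₁) ^ 2 + 3 * (C₀ + C₁) * (C₀ + C₁)) *
        (ε ^ 4 * 1) := by ring
      _ ≤ _ := by gcongr
  rw [hE] at hint
  rw [riskConst, ← hK, ← hGdef, ← hκ]
  rw [abs_le] at hint c3 c4 ⊢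
  constructor <;> linarith [hint.1, hint.2, c3.1, c3.2, c4.1, c4.2]

end

/-! ### Orthogonality and absolutely convergent cosine series with phases -/

theorem integral_cos_two_pi_mul_add {m : ℤ} (hm : m ≠ 0) (p : ℝ) :
    ∫ t in (-1 / 2 : ℝ)..(1 / 2), Real.cos (2 * Real.pi * m * t + p) = 0 := by
  have hw : 2 * Real.pi * (m : ℝ) ≠ 0 := by positivity
  rw [intervalIntegral.integral_comp_mul_add (fun x => Real.cos x) hw, integral_cos,
    show 2 * Real.pi * (m : ℝ) * (1 / 2) + p = 2 * Real.pi * m * (-1 / 2) + p + m * (2 * Real.pi)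
      by ring, Real.sin_add_int_mul_two_pi, sub_self, smul_zero]

theorem integral_cos_mul_cos (j k : ℕ+) (p q : ℝ) :
    ∫ t in (-1 / 2 : ℝ)..(1 / 2), Real.cos (freq j * t + p) * Real.cos (freq k * t + q) =
      if j = k then Real.cos (p - q) / 2 else 0 := by
  have e : ∀ t, Real.cos (freq j * t + p) * Real.cos (freq k * t + q) =
      (Real.cos (2 * Real.pi * ((j : ℤ) - (k : ℤ) : ℤ) * t + (p - q))
        + Real.cos (2 * Real.pi * ((j : ℤ) + (k : ℤ) : ℤ) * t + (p + q))) / 2 := fun t => by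
    have e1 : 2 * Real.pi * (((j : ℤ) - (k : ℤ) : ℤ) : ℝ) * t + (p - q) =
        (freq j * t + p) - (freq k * t + q) := by
      rw [freq, freq]; push_cast; ring
    have e2 : 2 * Real.pi * (((j : ℤ) + (k : ℤ) : ℤ) : ℝ) * t + (p + q) =
        (freq j * t + p) + (freq k * t + q) := by
      rw [freq, freq]; push_cast; ring
    rw [e1, e2, Real.cos_sub (freq j * t + p), Real.cos_add (freq j * t + p)]
    ring
  simp_rw [e]
  rw [intervalIntegral.integral_div, intervalIntegral.integral_add
    (Continuous.intervalIntegrable (by fun_prop) _ _)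
    (Continuous.intervalIntegrable (by fun_prop) _ _), integral_cos_two_pi_mul_add
      (m := (j : ℤ) + (k : ℤ)) (by have := j.pos; have := k.pos; omega), add_zero]
  split_ifs with hjk
  · subst hjk
    simp
    norm_num
  · rw [integral_cos_two_pi_mul_add, zero_div]
    rw [sub_ne_zero]
    exact_mod_cast fun h => hjk (PNat.coe_injective h)

section Series

variable {c p : ℕ+ → ℝ} {g : ℝ → ℝ}

theorem integral_series_mul (hc : Summable fun k => |c k|)
    (hg : ∀ t, HasSum (fun k => c k * Real.cos (freq k * t + p k)) (g t)) {ψ : ℝ → ℝ}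
    (hψ : Continuous ψ) {M : ℝ} (hM : ∀ t, |ψ t| ≤ M) :
    HasSum (fun k => c k * ∫ t in (-1 / 2 : ℝ)..(1 / 2), Real.cos (freq k * t + p k) * ψ t)
      (∫ t in (-1 / 2 : ℝ)..(1 / 2), g t * ψ t) := by
  have h1 := intervalIntegral.hasSum_integral_of_dominated_convergence (μ := volume)
    (a := (-1 / 2 : ℝ)) (b := 1 / 2)
    (F := fun k t => c k * (Real.cos (freq k * t + p k) * ψ t)) (f := fun t => g t * ψ t)
    (fun k _ => |c k| * M) (fun k => (Continuous.aestronglyMeasurable (by fun_prop)))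
    (fun k => Eventually.of_forall fun t _ => by
      rw [Real.norm_eq_abs, abs_mul, abs_mul]
      gcongr
      calc _ ≤ 1 * M := mul_le_mul (Real.abs_cos_le_one _) (hM t) (abs_nonneg _) zero_le_one
        _ = M := one_mul M)
    (Eventually.of_forall fun t _ => hc.mul_right M) (by simp)
    (Eventually.of_forall fun t _ => by simpa only [mul_assoc] using (hg t).mul_right (ψ t))
  simpa only [intervalIntegral.integral_const_mul] using h1

theorem integral_series_mul_cos (hc : Summable fun k => |c k|)
    (hg : ∀ t, HasSum (fun k => c k * Real.cos (freq k * t + p k)) (g t)) (k : ℕ+) (q : ℝ) :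
    ∫ t in (-1 / 2 : ℝ)..(1 / 2), g t * Real.cos (freq k * t + q) =
      c k * (Real.cos (p k - q) / 2) := by
  have h1 := integral_series_mul hc hg (ψ := fun t => Real.cos (freq k * t + q)) (by fun_prop)
    fun t => Real.abs_cos_le_one _
  simp_rw [integral_cos_mul_cos] at h1
  rw [← h1.tsum_eq, tsum_eq_single k fun j hj => by rw [if_neg hj, mul_zero], if_pos rfl]

theorem continuous_of_hasSum_cos (hc : Summable fun k => |c k|)
    (hg : ∀ t, HasSum (fun k => c k * Real.cos (freq k * t + p k)) (g t)) : Continuous g := by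
  have : g = fun t => ∑' k, c k * Real.cos (freq k * t + p k) :=
    funext fun t => (hg t).tsum_eq.symm
  rw [this]
  refine continuous_tsum (fun k => by fun_prop) hc fun k t => ?_
  rw [Real.norm_eq_abs, abs_mul]
  exact mul_le_of_le_one_right (abs_nonneg _) (Real.abs_cos_le_one _)

theorem abs_le_of_hasSum_cos (hc : Summable fun k => |c k|)
    (hg : ∀ t, HasSum (fun k => c k * Real.cos (freq k * t + p k)) (g t)) (t : ℝ) :
    |g t| ≤ ∑' k, |c k| := by
  rw [← (hg t).tsum_eq, ← Real.norm_eq_abs]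
  refine tsum_of_norm_bounded hc.hasSum fun k => ?_
  rw [Real.norm_eq_abs, abs_mul]
  exact mul_le_of_le_one_right (abs_nonneg _) (Real.abs_cos_le_one _)

theorem integral_series_sq (hc : Summable fun k => |c k|)
    (hg : ∀ t, HasSum (fun k => c k * Real.cos (freq k * t + p k)) (g t)) :
    ∫ t in (-1 / 2 : ℝ)..(1 / 2), g t ^ 2 = ∑' k, c k ^ 2 / 2 := by
  have h1 := integral_series_mul hc hg (continuous_of_hasSum_cos hc hg)
    (abs_le_of_hasSum_cos hc hg)
  simp_rw [sq (g _)]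
  rw [← h1.tsum_eq]
  refine tsum_congr fun k => ?_
  have : ∫ t in (-1 / 2 : ℝ)..(1 / 2), Real.cos (freq k * t + p k) * g t =
      ∫ t in (-1 / 2 : ℝ)..(1 / 2), g t * Real.cos (freq k * t + p k) :=
    intervalIntegral.integral_congr fun t _ => mul_comm _ _
  rw [this, integral_series_mul_cos hc hg, sub_self, Real.cos_zero]
  ring

/-- Writing `-sin x = cos (x + π/2)` keeps the derivative within cosine series with phases, so that
`integral_series_sq` applies to it as well. -/
theorem hasSum_deriv_of_hasSum_cos (hc : Summable fun k => |c k * freq k|)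
    (hg : ∀ t, HasSum (fun k => c k * Real.cos (freq k * t + p k)) (g t)) (t : ℝ) :
    HasSum (fun k => c k * freq k * Real.cos (freq k * t + (p k + Real.pi / 2))) (deriv g t) := by
  have hgt : g = fun t => ∑' k, c k * Real.cos (freq k * t + p k) :=
    funext fun t => (hg t).tsum_eq.symm
  have hb : ∀ k t, ‖c k * freq k * Real.cos (freq k * t + (p k + Real.pi / 2))‖ ≤
      |c k * freq k| := fun k t => by
    rw [Real.norm_eq_abs, abs_mul]
    exact mul_le_of_le_one_right (abs_nonneg _) (Real.abs_cos_le_one _)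
  have h1 : ∀ k t, HasDerivAt (fun t => c k * Real.cos (freq k * t + p k))
      (c k * freq k * Real.cos (freq k * t + (p k + Real.pi / 2))) t := fun k t => by
    have h1 : HasDerivAt (fun t => freq k * t + p k) (freq k) t := by
      simpa using ((hasDerivAt_id t).const_mul (freq k)).add_const (p k)
    have h2 := h1.cos.const_mul (c k)
    have e : c k * freq k * Real.cos (freq k * t + (p k + Real.pi / 2)) =
        c k * (-Real.sin (freq k * t + p k) * freq k) := by
      rw [← add_assoc, Real.cos_add_pi_div_two]; ring
    rw [e]
    exact h2
  have hd : HasDerivAt g (∑' k, c k * freq k * Real.cos (freq k * t + (p k + Real.pi / 2))) t := by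
    rw [hgt]
    exact hasDerivAt_tsum (y₀ := 0) hc h1 hb (hg 0).summable t
  rw [hd.deriv]
  exact (Summable.of_norm_bounded hc fun k => hb k t).hasSum

end Series

/-! ### Fourier analysis of the signals -/

namespace signalClass

variable {ρ C₀ : ℝ} {f : ℝ → ℝ}

theorem hasSum (hf : f ∈ signalClass ρ C₀) (θ t : ℝ) :
    HasSum (fun k : ℕ+ => √2 * coeff f k * Real.cos (freq k * t + -(freq k * θ))) (f (t - θ)) := by
  refine (hf.1 (t - θ)).congr_fun fun k => ?_
  rw [freq]; ring_nf

theorem hasSum_zero_phase (hf : f ∈ signalClass ρ C₀) (t : ℝ) :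
    HasSum (fun k : ℕ+ => √2 * coeff f k * Real.cos (freq k * t + 0)) (f t) := by
  refine (hf.1 t).congr_fun fun k => ?_
  rw [freq, add_zero]

theorem summable_four (hf : f ∈ signalClass ρ C₀) :
    Summable fun k => coeff f k ^ 2 * freq k ^ 4 := hf.2.2.1

theorem summable_abs_mul_freq (hf : f ∈ signalClass ρ C₀) :
    Summable fun k => |√2 * coeff f k * freq k| := by
  refine Summable.of_nonneg_of_le (fun k => abs_nonneg _) (fun k => ?_)
    ((summable_four hf).add summable_freq_rpow)
  have hw := one_le_freq k
  have hw0 := freq_pos k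
  have hs : √(freq k) ^ 3 ≤ freq k ^ 2 := by
    have h1 : 1 ≤ √(freq k) := Real.one_le_sqrt.2 hw
    calc √(freq k) ^ 3 ≤ √(freq k) ^ 4 := pow_le_pow_right₀ h1 (by norm_num)
      _ = (√(freq k) ^ 2) ^ 2 := by ring
      _ = _ := by rw [Real.sq_sqrt hw0.le]
  have h2 : √2 ≤ 2 := by rw [Real.sqrt_le_left (by norm_num)]; norm_num
  have h3 : |√2 * coeff f k * freq k| ≤ 2 * (|coeff f k| * freq k) := by
    rw [abs_mul, abs_mul, abs_of_pos hw0, abs_of_nonneg (Real.sqrt_nonneg 2), mul_assoc]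
    gcongr
  -- The inequality `2ab ≤ a² + b²` with `a = |f_k| w_k²` and `b = w_k⁻¹`. By `hs`, the term `w_k⁻²`
  -- is dominated by the summable `w_k^(-3/2)`.
  have h4 : 2 * (|coeff f k| * freq k) ≤ coeff f k ^ 2 * freq k ^ 4 + (freq k ^ 2)⁻¹ := by
    have e : |coeff f k| * freq k = (|coeff f k| * freq k ^ 2) * (freq k)⁻¹ := by field_simp
    rw [e, ← sq_abs (coeff f k), ← inv_pow]
    nlinarith [sq_nonneg (|coeff f k| * freq k ^ 2 - (freq k)⁻¹)]
  exact h3.trans (h4.trans (by gcongr))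

theorem summable_abs (hf : f ∈ signalClass ρ C₀) : Summable fun k => |√2 * coeff f k| := by
  refine Summable.of_nonneg_of_le (fun k => abs_nonneg _) (fun k => ?_) (summable_abs_mul_freq hf)
  rw [abs_mul _ (freq k), abs_of_pos (freq_pos k)]
  exact le_mul_of_one_le_right (abs_nonneg _) (one_le_freq k)

theorem continuous (hf : f ∈ signalClass ρ C₀) : Continuous f :=
  continuous_of_hasSum_cos (p := fun _ => 0) (summable_abs hf) (hasSum_zero_phase hf)

theorem abs_le (hf : f ∈ signalClass ρ C₀) (t : ℝ) : |f t| ≤ ∑' k, |√2 * coeff f k| :=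
  abs_le_of_hasSum_cos (p := fun _ => 0) (summable_abs hf) (hasSum_zero_phase hf) t

theorem fisherInfo_eq (hf : f ∈ signalClass ρ C₀) (ε : ℝ) :
    fisherInfo ε f = (ε ^ 2)⁻¹ * normSqD1 (coeff f) := by
  rw [fisherInfo, integral_series_sq (summable_abs_mul_freq hf)
    (p := fun _ => 0 + Real.pi / 2)
    (hasSum_deriv_of_hasSum_cos (p := fun _ => 0) (summable_abs_mul_freq hf) (hasSum_zero_phase hf)), normSqD1]
  congr 1
  refine tsum_congr fun k => ?_
  rw [mul_pow, mul_pow, Real.sq_sqrt (by norm_num), freq]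
  ring

theorem integral_cosTest_mul (hf : f ∈ signalClass ρ C₀) (k : ℕ+) (θ τ : ℝ) :
    ∫ t, cosTest k τ t * f (t - θ) ∂μI =
      coeff f k / √2 * Real.cos (freq k * (τ - θ)) := by
  have h1 : ∫ t, cosTest k τ t * f (t - θ) ∂μI =
      ∫ t, f (t - θ) * Real.cos (freq k * t + -(freq k * τ)) ∂μI := by
    refine integral_congr_ae ?_
    filter_upwards [(memLp_cos k τ).coeFn_toLp] with t ht
    rw [cosTest, ht, mul_comm, freq]
    ring_nf
  rw [h1, integral_Icc_eq_integral_Ioc, ← intervalIntegral.integral_of_le (by norm_num),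
    integral_series_mul_cos (summable_abs hf) (hasSum hf θ)]
  rw [show -(freq k * θ) - -(freq k * τ) = freq k * (τ - θ) by ring, div_mul_eq_mul_div,
    eq_div_iff (by positivity)]
  have := Real.mul_self_sqrt (by norm_num : (0 : ℝ) ≤ 2)
  linear_combination (coeff f k * Real.cos (freq k * (τ - θ)) / 2) * this

theorem integrable_mul (hf : f ∈ signalClass ρ C₀) (θ : ℝ) (φ : L2I) :
    Integrable (fun t => φ t * f (t - θ)) μI := by
  have h1 : MemLp (fun t => f (t - θ)) 2 μI := by
    refine MemLp.of_bound ((continuous hf).comp (continuous_id.sub continuous_const)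
      |>.aestronglyMeasurable) (∑' k, |√2 * coeff f k|) (Eventually.of_forall fun t => ?_)
    exact abs_le hf _
  exact (Lp.memLp φ).integrable_mul h1

theorem isLinearMap_observe {Ω : Type*} [MeasurableSpace Ω] {P : Measure Ω} {n : L2I → Ω → ℝ}
    (hn : IsWhiteNoise P n) (hf : f ∈ signalClass ρ C₀) (ε θ : ℝ) (ω : Ω) :
    IsLinearMap ℝ (observe n ε f θ ω) where
  map_add φ ψ := by
    have h1 : ∫ t, (φ + ψ : L2I) t * f (t - θ) ∂μI =
        ∫ t, φ t * f (t - θ) ∂μI + ∫ t, ψ t * f (t - θ) ∂μI := by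
      rw [← integral_add (integrable_mul hf θ φ) (integrable_mul hf θ ψ)]
      refine integral_congr_ae ?_
      filter_upwards [Lp.coeFn_add φ ψ] with t ht
      rw [ht, Pi.add_apply, add_mul]
    simp only [observe]
    rw [h1, (hn.linear ω).map_add]
    ring
  map_smul c φ := by
    have h1 : ∫ t, (c • φ : L2I) t * f (t - θ) ∂μI = c * ∫ t, φ t * f (t - θ) ∂μI := by
      rw [← integral_const_mul]
      refine integral_congr_ae ?_
      filter_upwards [Lp.coeFn_smul c φ] with t ht
      rw [ht, Pi.smul_apply, smul_eq_mul, mul_assoc]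
    simp only [observe]
    rw [h1, (hn.linear ω).map_smul, smul_eq_mul, smul_eq_mul]
    ring

theorem summable_two (hf : f ∈ signalClass ρ C₀) :
    Summable fun k => coeff f k ^ 2 * freq k ^ 2 :=
  Summable.of_nonneg_of_le (fun k => by positivity) (fun k => mul_le_mul_of_nonneg_left
    (pow_le_pow_right₀ (one_le_freq k) (by norm_num)) (sq_nonneg _)) (summable_four hf)

theorem sum_four_le (hf : f ∈ signalClass ρ C₀) (s : Finset ℕ+) :
    ∑ k ∈ s, coeff f k ^ 2 * freq k ^ 4 ≤ C₀ :=
  ((summable_four hf).sum_le_tsum s fun k _ => by positivity).trans hf.2.2.2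

theorem normSqD1_le (hf : f ∈ signalClass ρ C₀) : normSqD1 (coeff f) ≤ C₀ :=
  ((summable_two hf).tsum_le_tsum (fun k => mul_le_mul_of_nonneg_left
    (pow_le_pow_right₀ (one_le_freq k) (by norm_num)) (sq_nonneg _)) (summable_four hf)).trans
    hf.2.2.2

theorem le_normSqD1 (hf : f ∈ signalClass ρ C₀) : ρ ≤ normSqD1 (coeff f) := by
  calc ρ ≤ coeff f 1 ^ 2 := hf.2.1
    _ ≤ coeff f 1 ^ 2 * freq 1 ^ 2 :=
      le_mul_of_one_le_right (sq_nonneg _) (one_le_pow₀ (one_le_freq 1))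
    _ ≤ _ := (summable_two hf).le_tsum 1 fun k _ => by positivity

end signalClass

/-! ### From white noise to independent Gaussian pairs -/

namespace IsWhiteNoise

variable {Ω : Type*} [MeasurableSpace Ω] {P : Measure Ω} {n : L2I → Ω → ℝ}

/-- By linearity every linear functional of finitely many values is itself a value of the noise,
hence Gaussian by `law`; this is the characterization of Gaussian vectors by their one-dimensional
projections. -/
theorem isGaussianProcess (hn : IsWhiteNoise P n) : IsGaussianProcess n P where
  hasGaussianLaw I := by
    classical
    refine ⟨isGaussian_of_map_eq_gaussianReal fun L =>
      ⟨0, ‖∑ i : I, L (Pi.single i 1) • (i : L2I)‖₊ ^ 2, ?_⟩⟩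
    have hm : Measurable fun ω => I.restrict (n · ω) :=
      measurable_pi_lambda _ fun i => hn.measurable i
    rw [Measure.map_map L.continuous.measurable hm, ← hn.law]
    congr 1
    ext ω
    have hlin := hn.linear ω
    have e : n (∑ i : I, L (Pi.single i 1) • (i : L2I)) ω =
        ∑ i : I, L (Pi.single i 1) * n i ω := by
      have := map_sum (hlin.mk' _) (fun i : I => L (Pi.single i 1) • (i : L2I)) Finset.univ
      simp only [IsLinearMap.mk'_apply] at this
      rw [this]
      exact Finset.sum_congr rfl fun i _ => hlin.map_smul _ _
    have hL := LinearMap.pi_apply_eq_sum_univ (L : (I → ℝ) →ₗ[ℝ] ℝ) (I.restrict (n · ω))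
    rw [e, Function.comp_apply]
    refine hL.trans (Finset.sum_congr rfl fun i _ => ?_)
    rw [smul_eq_mul, mul_comm]
    have hs : (fun j => if i = j then (1 : ℝ) else 0) = Pi.single i 1 :=
      funext fun j => by simp [Pi.single_apply, eq_comm]
    rw [hs]
    rfl

theorem memLp (hn : IsWhiteNoise P n) (φ : L2I) : MemLp (n φ) 2 P :=
  (hn.isGaussianProcess.hasGaussianLaw_eval φ).memLp_two

theorem variance (hn : IsWhiteNoise P n) (φ : L2I) : Var[n φ; P] = ‖φ‖ ^ 2 := by
  have h := variance_fun_id_gaussianReal (μ := 0) (v := ‖φ‖₊ ^ 2)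
  rw [← hn.law φ, variance_map measurable_id'.aemeasurable (hn.measurable φ).aemeasurable] at h
  simpa using! h

/-- Polarization of the variance. -/
theorem covariance (hn : IsWhiteNoise P n) [IsProbabilityMeasure P] (φ ψ : L2I) :
    cov[n φ, n ψ; P] = inner ℝ φ ψ := by
  have h1 := variance_add (hn.memLp φ) (hn.memLp ψ)
  have h2 : n φ + n ψ = n (φ + ψ) := funext fun ω => ((hn.linear ω).map_add φ ψ).symm
  rw [h2, hn.variance, hn.variance, hn.variance] at h1
  have h3 := norm_add_sq_real φ ψ
  linarith

end IsWhiteNoise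

theorem inner_cosTest (j k : ℕ+) (a b : ℝ) :
    inner ℝ (cosTest j a) (cosTest k b) = if j = k then Real.cos (freq j * (a - b)) / 2 else 0 := by
  rw [L2.inner_def]
  have h1 : ∫ t, inner ℝ (cosTest j a t) (cosTest k b t) ∂μI =
      ∫ t, Real.cos (freq j * t + -(freq j * a)) * Real.cos (freq k * t + -(freq k * b)) ∂μI := by
    refine integral_congr_ae ?_
    filter_upwards [(memLp_cos j a).coeFn_toLp, (memLp_cos k b).coeFn_toLp] with t h1 h2
    rw [cosTest, cosTest, h1, h2, freq, freq]
    rw [RCLike.inner_apply, conj_trivial]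
    ring_nf
  rw [h1, integral_Icc_eq_integral_Ioc, ← intervalIntegral.integral_of_le (by norm_num),
    integral_cos_mul_cos]
  split_ifs with h
  · subst h
    rw [← Real.cos_neg]
    ring_nf
  · rfl

/-- The normalized cosine and sine test functions, centred at `θ`. -/
noncomputable def pairTest (θ : ℝ) (k : ℕ+) (b : Bool) : L2I :=
  √2 • cosTest k (if b then θ + 1 / (4 * k) else θ)

theorem inner_pairTest (θ : ℝ) (j k : ℕ+) (a b : Bool) :
    inner ℝ (pairTest θ j a) (pairTest θ k b) = if j = k ∧ a = b then 1 else 0 := by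
  have h2 := Real.mul_self_sqrt (by norm_num : (0 : ℝ) ≤ 2)
  rw [pairTest, pairTest, real_inner_smul_left, real_inner_smul_right, inner_cosTest]
  by_cases hjk : j = k
  · subst hjk
    -- A shift by a quarter of the period turns the cosine into the sine.
    have hq : freq j * (1 / (4 * (j : ℝ))) = Real.pi / 2 := by
      have : (j : ℝ) ≠ 0 := by exact_mod_cast j.ne_zero
      rw [freq]; field_simp; norm_num
    have c1 : Real.cos (freq j * (θ + 1 / (4 * (j : ℝ)) - θ)) = 0 := by
      rw [add_sub_cancel_left, hq, Real.cos_pi_div_two]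
    have c2 : Real.cos (freq j * (θ - (θ + 1 / (4 * (j : ℝ))))) = 0 := by
      rw [sub_add_cancel_left, mul_neg, hq, Real.cos_neg, Real.cos_pi_div_two]
    cases a <;> cases b
    · simp only [Bool.false_eq_true, if_false, sub_self, mul_zero, Real.cos_zero, and_self, if_true]
      linarith
    · simp only [Bool.false_eq_true, if_false, if_true, c2]
      simp
    · simp only [Bool.false_eq_true, if_false, if_true, c1]
      simp
    · simp only [sub_self, mul_zero, Real.cos_zero, and_self, if_true]
      linarith
  · simp [hjk]

theorem cosTest_add (k : ℕ+) (θ u : ℝ) :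
    cosTest k (θ + u) = Real.cos (freq k * u) • cosTest k θ
      + Real.sin (freq k * u) • cosTest k (θ + 1 / (4 * k)) := by
  refine Lp.ext ?_
  filter_upwards [(memLp_cos k (θ + u)).coeFn_toLp, (memLp_cos k θ).coeFn_toLp,
    (memLp_cos k (θ + 1 / (4 * k))).coeFn_toLp,
    Lp.coeFn_add (Real.cos (freq k * u) • cosTest k θ)
      (Real.sin (freq k * u) • cosTest k (θ + 1 / (4 * k))),
    Lp.coeFn_smul (Real.cos (freq k * u)) (cosTest k θ),
    Lp.coeFn_smul (Real.sin (freq k * u)) (cosTest k (θ + 1 / (4 * k)))] with t h1 h2 h3 h4 h5 h6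
  rw [h4, Pi.add_apply, h5, h6, Pi.smul_apply, Pi.smul_apply, cosTest, cosTest, cosTest, h1, h2,
    h3, smul_eq_mul, smul_eq_mul, freq]
  have hk : (k : ℝ) ≠ 0 := by exact_mod_cast k.ne_zero
  have e : 2 * Real.pi * (k : ℝ) * (t - (θ + 1 / (4 * k))) =
      2 * Real.pi * k * (t - θ) - Real.pi / 2 := by field_simp; ring
  rw [e, Real.cos_sub_pi_div_two, show 2 * Real.pi * (k : ℝ) * (t - (θ + u)) =
    2 * Real.pi * k * (t - θ) - 2 * Real.pi * k * u by ring, Real.cos_sub]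
  ring

/-- The test functions are orthonormal, so the noise values are uncorrelated. For jointly Gaussian
variables this is independence, both across frequencies and inside each pair. -/
theorem IsWhiteNoise.isGaussianPairs {Ω : Type*} [MeasurableSpace Ω] {P : Measure Ω}
    [IsProbabilityMeasure P] {n : L2I → Ω → ℝ} (hn : IsWhiteNoise P n) (θ : ℝ) :
    IsGaussianPairs P (fun k => n (pairTest θ k false)) (fun k => n (pairTest θ k true)) where
  measurable_fst k := hn.measurable _
  measurable_snd k := hn.measurable _
  indep := by
    have h := IsGaussianProcess.iIndepFun_of_covariance_eq_zero (P := P)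
      (X := fun k b => n (pairTest θ k b))
      (hn.isGaussianProcess.comp_right fun p : (_ : ℕ+) × Bool => pairTest θ p.1 p.2)
      (fun k b => (hn.measurable _).aemeasurable) fun j k hjk a b => by
        rw [hn.covariance, inner_pairTest, if_neg fun h => hjk h.1]
    exact h.comp (fun _ v => (v false, v true)) fun _ => by fun_prop
  map_eq k := by
    have hlaw : ∀ b, P.map (n (pairTest θ k b)) = gaussianReal 0 1 := fun b => by
      have h1 : ‖pairTest θ k b‖₊ = 1 := by
        have h := inner_pairTest θ k k b b
        rw [real_inner_self_eq_norm_sq, if_pos ⟨rfl, rfl⟩] at h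
        exact NNReal.coe_injective (by
          simpa using (pow_eq_one_iff_of_nonneg (norm_nonneg _) two_ne_zero).1 h)
      rw [hn.law, h1, one_pow]
    have hind : IndepFun (n (pairTest θ k false)) (n (pairTest θ k true)) P :=
      (hn.isGaussianProcess.hasGaussianLaw_prodMk).indepFun_of_covariance_eq_zero (by
        rw [hn.covariance, inner_pairTest, if_neg (by simp)])
    rw [(indepFun_iff_map_prod_eq_prod_map_map (hn.measurable _).aemeasurable
      (hn.measurable _).aemeasurable).1 hind, hlaw, hlaw]

/-- Write `sin(2πu) = 2 sin(πu) cos(πu)` and use `|sin(πu)| ≥ 2|u|` and `cos(πu) ≥ cos(2πτ₀)`. Since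
`τ₀ < 1/4`, the zero of the left-hand sine at `|u| = 1/2` stays out of reach. -/
theorem mul_sq_le_sin_sq {τ₀ u : ℝ} (hτ₀ : τ₀ < 1 / 4) (hu : |u| ≤ 2 * τ₀) :
    16 * Real.cos (2 * Real.pi * τ₀) ^ 2 * u ^ 2 ≤ Real.sin (freq 1 * u) ^ 2 := by
  have hpi := Real.pi_pos
  have hpu : |Real.pi * u| ≤ 2 * Real.pi * τ₀ := by
    rw [abs_mul, abs_of_pos hpi]; nlinarith
  have hτ : 2 * Real.pi * τ₀ ≤ Real.pi / 2 := by nlinarith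
  have h1 := Real.mul_abs_le_abs_sin (hpu.trans hτ)
  have h2 : Real.cos (2 * Real.pi * τ₀) ≤ Real.cos (Real.pi * u) := by
    rw [← Real.cos_abs (Real.pi * u)]
    exact Real.cos_le_cos_of_nonneg_of_le_pi (abs_nonneg _) (by linarith) hpu
  have h3 : 0 ≤ Real.cos (2 * Real.pi * τ₀) :=
    Real.cos_nonneg_of_neg_pi_div_two_le_of_le (by linarith [abs_nonneg (Real.pi * u)]) hτ
  have h4 : 2 * |u| ≤ |Real.sin (Real.pi * u)| := by
    rw [abs_mul, abs_of_pos hpi] at h1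
    calc 2 * |u| = 2 / Real.pi * (Real.pi * |u|) := by field_simp
      _ ≤ _ := h1
  have e : freq 1 * u = 2 * (Real.pi * u) := by simp [freq]; ring
  rw [e, Real.sin_two_mul]
  calc _ = 4 * ((2 * |u|) ^ 2 * Real.cos (2 * Real.pi * τ₀) ^ 2) := by
        rw [mul_pow 2 |u|, sq_abs]; ring
    _ ≤ 4 * (|Real.sin (Real.pi * u)| ^ 2 * Real.cos (Real.pi * u) ^ 2) := by gcongr
    _ = _ := by rw [sq_abs]; ring

/-! ### Algebra of the normalized risk -/

/-- From the expansion of the mean squared error `I` to the second-order normalized risk. -/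
theorem exists_risk_ratio {A B C D S I ε ρ C₀ η κ : ℝ} (hρ : 0 < ρ) (hD : ρ ≤ D) (hDA : D ≤ A)
    (hA : A ≤ C₀) (hB : B = A - D) (hB2 : B ^ 2 ≤ η * C) (hC : 0 ≤ C) (hCB : C ≤ B) (hε : 0 < ε)
    (hS : 0 < S) (hη : 0 < η) (hκ : 0 ≤ κ)
    (hE : |D ^ 2 * I - ε ^ 2 * (A - 2 * B + C + ε ^ 2 * S)| ≤ ε ^ 2 * (κ * (ε ^ 2 * S))) :
    ∃ r, |r| ≤ (3 * C₀ * η + C₀ ^ 2 * κ) / ρ ^ 2 ∧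
      (ε ^ 2)⁻¹ * A * I = 1 + (1 + r) * ((C + ε ^ 2 * S) / A) ∧ C ≤ η := by
  have hD0 : 0 < D := hρ.trans_le hD
  have hA0 : 0 < A := hD0.trans_le hDA
  have hC₀ : 0 < C₀ := hA0.trans_le hA
  set R := C + ε ^ 2 * S with hR
  have hR0 : 0 < R := by positivity
  have hCR : C ≤ R := by rw [hR]; exact le_add_of_nonneg_right (by positivity)
  have hSR : ε ^ 2 * S ≤ R := by rw [hR]; exact le_add_of_nonneg_left hC
  have hB0 : 0 ≤ B := by linarith
  -- From `B² ≤ η C ≤ η B`.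
  have hBη : B ≤ η := by
    rcases hB0.eq_or_lt with h | h
    · rw [← h]; exact hη.le
    · have : B * B ≤ η * B := by nlinarith
      exact le_of_mul_le_mul_right this h
  set E := D ^ 2 * I - ε ^ 2 * (A - 2 * B + C + ε ^ 2 * S) with hEdef
  have hI : I = (ε ^ 2 * (A - 2 * B + R) + E) / D ^ 2 := by
    rw [eq_div_iff (by positivity), hEdef, hR]; ring
  -- Obtained by solving for `r` with `A (A - 2B) = D² - B²`. The first term is `A²/D² - 1`, the
  -- second comes from `B²`, and the third from the expansion error.
  refine ⟨B * (A + D) / D ^ 2 - A * B ^ 2 / (D ^ 2 * R) + A ^ 2 * E / (ε ^ 2 * D ^ 2 * R), ?_, ?_,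
    hCB.trans hBη⟩
  · have b1 : |B * (A + D) / D ^ 2| ≤ 2 * C₀ * η / ρ ^ 2 := by
      rw [abs_of_nonneg (by positivity)]
      calc B * (A + D) / D ^ 2 ≤ η * (C₀ + C₀) / ρ ^ 2 := by gcongr; linarith
        _ = _ := by ring
    have b2 : |A * B ^ 2 / (D ^ 2 * R)| ≤ C₀ * η / ρ ^ 2 := by
      rw [abs_of_nonneg (by positivity)]
      have : B ^ 2 ≤ η * R := hB2.trans (by gcongr)
      calc A * B ^ 2 / (D ^ 2 * R) ≤ C₀ * (η * R) / (ρ ^ 2 * R) := by gcongr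
        _ = _ := by field_simp
    have b3 : |A ^ 2 * E / (ε ^ 2 * D ^ 2 * R)| ≤ C₀ ^ 2 * κ / ρ ^ 2 := by
      rw [abs_div, abs_mul, abs_of_pos (by positivity : 0 < A ^ 2),
        abs_of_pos (by positivity : 0 < ε ^ 2 * D ^ 2 * R)]
      calc A ^ 2 * |E| / (ε ^ 2 * D ^ 2 * R) ≤
            C₀ ^ 2 * (ε ^ 2 * (κ * R)) / (ε ^ 2 * ρ ^ 2 * R) := by
            gcongr
            exact hE.trans (by gcongr)
        _ = _ := by field_simp
    calc _ ≤ 2 * C₀ * η / ρ ^ 2 + C₀ * η / ρ ^ 2 + C₀ ^ 2 * κ / ρ ^ 2 :=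
          (abs_add_le _ _).trans (add_le_add ((abs_sub _ _).trans (add_le_add b1 b2)) b3)
      _ = _ := by ring
  · have hAB : A = B + D := by rw [hB]; ring
    rw [hI]
    field_simp
    rw [hAB]
    ring

/-! ### The estimator as a maximizer of the rotated criterion -/

section Observation

variable {Ω : Type*} [MeasurableSpace Ω] {P : Measure Ω} {n : L2I → Ω → ℝ}
  {ρ C₀ ε θ : ℝ} {f : ℝ → ℝ} {h : ℕ+ → ℝ}

theorem observe_cosTest (hn : IsWhiteNoise P n) (hf : f ∈ signalClass ρ C₀) (k : ℕ+) (u : ℝ)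
    (ω : Ω) :
    √2 * observe n ε f θ ω (cosTest k (θ + u)) =
      (coeff f k + ε * n (pairTest θ k false) ω) * Real.cos (freq k * u)
        + ε * n (pairTest θ k true) ω * Real.sin (freq k * u) := by
  have hlin := hn.linear ω
  have h1 : n (cosTest k (θ + u)) ω = Real.cos (freq k * u) * n (cosTest k θ) ω
      + Real.sin (freq k * u) * n (cosTest k (θ + 1 / (4 * k))) ω := by
    rw [cosTest_add, hlin.map_add, hlin.map_smul, hlin.map_smul, smul_eq_mul, smul_eq_mul]
  have h2 : n (pairTest θ k false) ω = √2 * n (cosTest k θ) ω := by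
    rw [pairTest, hlin.map_smul]; rfl
  have h3 : n (pairTest θ k true) ω = √2 * n (cosTest k (θ + 1 / (4 * k))) ω := by
    rw [pairTest, hlin.map_smul]; rfl
  rw [observe, signalClass.integral_cosTest_mul hf, h1, h2, h3, add_sub_cancel_left]
  field_simp
  ring

theorem two_mul_contrast_observe (hn : IsWhiteNoise P n) (hf : f ∈ signalClass ρ C₀)
    (hfin : {k | h k ≠ 0}.Finite) (u : ℝ) (ω : Ω) :
    2 * contrast h (observe n ε f θ ω) (θ + u) =
      crit hfin.toFinset h (coeff f) ε (fun k => n (pairTest θ k false) ω)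
        (fun k => n (pairTest θ k true) ω) u := by
  rw [contrast, tsum_eq_sum (s := hfin.toFinset) fun k hk => by
    have : h k = 0 := by simpa using hk
    rw [this, zero_mul], crit, Finset.mul_sum]
  refine Finset.sum_congr rfl fun k _ => ?_
  rw [← observe_cosTest hn hf, mul_pow, Real.sq_sqrt (by norm_num)]
  ring

theorem measurable_observe (hn : IsWhiteNoise P n) : Measurable (observe n ε f θ) :=
  measurable_pi_lambda _ fun φ => ((hn.measurable φ).const_mul ε).const_add _

theorem abs_mse_sub_le [IsProbabilityMeasure P] (hn : IsWhiteNoise P n) {τ₀ C₁ δ l : ℝ}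
    (hτ₀ : 0 < τ₀) (hτ₀' : τ₀ < 1 / 4) (hρ : 0 < ρ) (hC₀ : 0 < C₀)
    (hfin : {k | h k ≠ 0}.Finite) {T : Observation → ℝ} (hT : IsEstimatorAD τ₀ h T)
    (hf : f ∈ signalClass ρ C₀)
    (H : IsAdmissible C₀ C₁ ρ ε hfin.toFinset h (coeff f)) (hl : 1 ≤ l) (hεl : ε * l ^ 2 ≤ 1)
    (hlog : l ^ 2 = Real.log (ε ^ (-2 : ℤ)))
    (hδ : locRadius C₀ ρ (16 * Real.cos (2 * Real.pi * τ₀) ^ 2) * (ε * l) < δ)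
    (hθ : |θ| ≤ τ₀ - δ) :
    |filteredInfo hfin.toFinset h (coeff f) ^ 2 * ∫ ω, (T (observe n ε f θ ω) - θ) ^ 2 ∂P
      - ε ^ 2 * ∑ k ∈ hfin.toFinset, h k ^ 2 * freq k ^ 2 * (coeff f k ^ 2 + ε ^ 2)| ≤
      riskConst C₀ C₁ ρ (16 * Real.cos (2 * Real.pi * τ₀) ^ 2) * (ε ^ 4 * l ^ 4) := by
  have hε := H.eps_pos
  have hc : 0 < 16 * Real.cos (2 * Real.pi * τ₀) ^ 2 := by
    have : 0 < Real.cos (2 * Real.pi * τ₀) :=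
      Real.cos_pos_of_mem_Ioo ⟨by nlinarith [Real.pi_pos], by nlinarith [Real.pi_pos]⟩
    positivity
  have hδ0 : 0 < δ := lt_of_le_of_lt (by unfold locRadius; positivity) hδ
  have hlin := fun ω => signalClass.isLinearMap_observe hn hf ε θ ω
  have hmem : ∀ ω, |T (observe n ε f θ ω)| ≤ τ₀ := fun ω => abs_le.2 (hT.mem _ (hlin ω))
  have hu : ∀ ω, |T (observe n ε f θ ω) - θ| ≤ 2 * τ₀ := fun ω =>
    (abs_sub _ _).trans (by linarith [hmem ω])
  have hcrit : ∀ ω u, crit hfin.toFinset h (coeff f) ε (fun k => n (pairTest θ k false) ω)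
      (fun k => n (pairTest θ k true) ω) u = 2 * contrast h (observe n ε f θ ω) (θ + u) :=
    fun ω u => (two_mul_contrast_observe hn hf hfin u ω).symm
  refine H.abs_integral_sq_sub_le (hn.isGaussianPairs θ) hC₀ hρ hc (Real.sqrt_pos.2 hε) hl ?_
    (Real.sq_sqrt hε.le) hlog ((hT.measurable.comp (measurable_observe hn)).sub_const θ)
    (fun ω => (hu ω).trans (by linarith)) (fun ω => mul_sq_le_sin_sq hτ₀' (hu ω)) (fun ω => ?_)
    fun ω hω => ?_
  · rw [← sq_le_one_iff₀ (by positivity), mul_pow, Real.sq_sqrt hε.le]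
    exact hεl
  · rw [hcrit, hcrit, add_zero, add_sub_cancel]
    have := hT.isMaxOn _ (hlin ω) (show θ ∈ Icc (-τ₀) τ₀ from abs_le.1 (by linarith))
    have h3 : contrast h (observe n ε f θ ω) θ ≤
      contrast h (observe n ε f θ ω) (T (observe n ε f θ ω)) := this
    linarith
  -- The localization radius is below the distance from `θ` to the boundary, so the maximizer is
  -- interior.
  · have hu := hω.trans_lt hδ
    have hint : T (observe n ε f θ ω) ∈ Ioo (-τ₀) τ₀ := by
      rw [mem_Ioo, ← abs_lt]
      calc |T (observe n ε f θ ω)| = |(T (observe n ε f θ ω) - θ) + θ| := by rw [sub_add_cancel]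
        _ ≤ _ := abs_add_le _ _
        _ < τ₀ := by linarith
    refine IsLocalMax.deriv_eq_zero ?_
    have hev : ∀ᶠ v in 𝓝 (T (observe n ε f θ ω) - θ), θ + v ∈ Icc (-τ₀) τ₀ := by
      have hcont : ContinuousAt (fun v => θ + v) (T (observe n ε f θ ω) - θ) := by fun_prop
      refine hcont.eventually_mem ?_
      rw [add_sub_cancel]
      exact Icc_mem_nhds hint.1 hint.2
    filter_upwards [hev] with v hv
    rw [hcrit, hcrit, add_sub_cancel]
    have h3 : contrast h (observe n ε f θ ω) (θ + v) ≤
      contrast h (observe n ε f θ ω) (T (observe n ε f θ ω)) := hT.isMaxOn _ (hlin ω) hv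
    linarith

end Observation

/-! ### Identities for the weighted series -/

section Sums

variable {ρ C₀ ε : ℝ} {f : ℝ → ℝ} {h : ℕ+ → ℝ}

theorem hasSum_of_support (hfin : {k | h k ≠ 0}.Finite) {g : ℕ+ → ℝ} (hg : ∀ k, h k = 0 → g k = 0) :
    HasSum g (∑ k ∈ hfin.toFinset, g k) :=
  hasSum_sum_of_ne_finset_zero fun k hk => hg k (by simpa using hk)

theorem normSqD1_eq_sum (hfin : {k | h k ≠ 0}.Finite) :
    normSqD1 h = ∑ k ∈ hfin.toFinset, h k ^ 2 * freq k ^ 2 :=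
  (hasSum_of_support hfin (g := fun k => h k ^ 2 * freq k ^ 2) fun k hk => by simp [hk]).tsum_eq

theorem signalClass.hasSum_one_sub (hf : f ∈ signalClass ρ C₀) (hfin : {k | h k ≠ 0}.Finite) :
    HasSum (fun k => (1 - h k) * freq k ^ 2 * coeff f k ^ 2)
      (normSqD1 (coeff f) - filteredInfo hfin.toFinset h (coeff f)) := by
  have hA : HasSum (fun k => coeff f k ^ 2 * freq k ^ 2) (normSqD1 (coeff f)) :=
    (signalClass.summable_two hf).hasSum
  have hD : HasSum (fun k => h k * freq k ^ 2 * coeff f k ^ 2)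
      (filteredInfo hfin.toFinset h (coeff f)) := hasSum_of_support hfin fun k hk => by simp [hk]
  exact (hA.sub hD).congr_fun fun k => by ring

/-- Termwise `(1 - h)² = 2(1 - h) - 1 + h²`. Solved for the `h²` sum, this is what brings the bias
terms `B` and `C` into the variance of the score. -/
theorem signalClass.hasSum_one_sub_sq (hf : f ∈ signalClass ρ C₀) (hfin : {k | h k ≠ 0}.Finite) :
    HasSum (fun k => (1 - h k) ^ 2 * freq k ^ 2 * coeff f k ^ 2)
      (2 * (normSqD1 (coeff f) - filteredInfo hfin.toFinset h (coeff f)) - normSqD1 (coeff f)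
        + ∑ k ∈ hfin.toFinset, h k ^ 2 * freq k ^ 2 * coeff f k ^ 2) := by
  have hA : HasSum (fun k => coeff f k ^ 2 * freq k ^ 2) (normSqD1 (coeff f)) :=
    (signalClass.summable_two hf).hasSum
  have h2 : HasSum (fun k => h k ^ 2 * freq k ^ 2 * coeff f k ^ 2)
      (∑ k ∈ hfin.toFinset, h k ^ 2 * freq k ^ 2 * coeff f k ^ 2) :=
    hasSum_of_support hfin fun k hk => by simp [hk]
  exact ((((hasSum_one_sub hf hfin).mul_left 2).sub hA).add h2).congr_fun fun k => by ring

theorem signalClass.secondOrder_eq (hf : f ∈ signalClass ρ C₀) (hfin : {k | h k ≠ 0}.Finite) :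
    secondOrder ε f h = (∑' k, (1 - h k) ^ 2 * freq k ^ 2 * coeff f k ^ 2)
      + ε ^ 2 * ∑ k ∈ hfin.toFinset, h k ^ 2 * freq k ^ 2 := by
  have h2 : HasSum (fun k => h k ^ 2 * freq k ^ 2) (∑ k ∈ hfin.toFinset, h k ^ 2 * freq k ^ 2) :=
    hasSum_of_support hfin fun k hk => by simp [hk]
  refine HasSum.tsum_eq (((hasSum_one_sub_sq hf hfin).summable.hasSum.add
    (h2.mul_left (ε ^ 2))).congr_fun fun k => ?_)
  rw [freq]; ring

theorem AssumptionB.isAdmissible {ρ₁ C₁ : ℝ} {h : ℝ → ℕ+ → ℝ} (hB : AssumptionB ρ₁ C₁ h)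
    (hε : ε ∈ Ioo (0 : ℝ) 1) (hf : f ∈ signalClass ρ C₀) :
    IsAdmissible C₀ C₁ ρ ε (hB.finite ε hε).toFinset (h ε) (coeff f) where
  eps_pos := hε.1
  eps_lt_one := hε.2
  one_mem := by simp [hB.one ε hε]
  h_one := hB.one ε hε
  h_nonneg k := (hB.mem ε hε k).1
  h_le_one k := (hB.mem ε hε k).2
  sum_h := by
    rw [← (hasSum_of_support (hB.finite ε hε) (g := fun k => h ε k * freq k ^ 4)
      fun k hk => by simp [hk]).tsum_eq]
    exact hB.b2 ε hε
  sum_f := signalClass.sum_four_le hf _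
  le_first := hf.2.1

/-- The frequency `k = 1` has weight one, so the supremum in `b1` is at least one. Finiteness of the
support keeps the supremum from degenerating to its default value. -/
theorem AssumptionB.le_sum_sq {ρ₁ C₁ : ℝ} {h : ℝ → ℕ+ → ℝ} (hB : AssumptionB ρ₁ C₁ h)
    (hρ₁ : 0 < ρ₁) (hε : ε ∈ Ioo (0 : ℝ) 1) :
    ρ₁ ^ 2 * Real.log (ε ^ (-2 : ℤ)) ^ 4 ≤
      ∑ k ∈ (hB.finite ε hε).toFinset, h ε k ^ 2 * freq k ^ 2 := by
  have hbdd : BddAbove (range fun k : ℕ+ => h ε k * (2 * Real.pi * k)) := by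
    refine Set.Finite.bddAbove ((((hB.finite ε hε).image
      fun k : ℕ+ => h ε k * (2 * Real.pi * k)).union (finite_singleton 0)).subset ?_)
    rintro _ ⟨k, rfl⟩
    by_cases hk : h ε k = 0
    · right; simp [hk]
    · left; exact ⟨k, hk, rfl⟩
  have hsup : 1 ≤ ⨆ k : ℕ+, h ε k * (2 * Real.pi * k) := by
    refine le_trans ?_ (le_ciSup hbdd 1)
    rw [hB.one ε hε, one_mul]
    exact one_le_freq 1
  have h1 : ρ₁ * Real.log (ε ^ (-2 : ℤ)) ^ 2 ≤ √(normSqD1 (h ε)) := by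
    refine le_trans ?_ (hB.b1 ε hε)
    exact le_mul_of_one_le_right (by positivity) hsup
  rw [← normSqD1_eq_sum]
  have h0 : 0 ≤ normSqD1 (h ε) := tsum_nonneg fun k => by positivity
  calc _ = (ρ₁ * Real.log (ε ^ (-2 : ℤ)) ^ 2) ^ 2 := by ring
    _ ≤ √(normSqD1 (h ε)) ^ 2 := by gcongr
    _ = _ := Real.sq_sqrt h0

end Sums

/-! ### Uniform asymptotics as the noise level tends to zero -/

theorem log_zpow_neg_two (ε : ℝ) : Real.log (ε ^ (-2 : ℤ)) = -2 * Real.log ε := by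
  rw [Real.log_zpow]; norm_num

theorem tendsto_log_zpow_neg_two :
    Tendsto (fun ε : ℝ => Real.log (ε ^ (-2 : ℤ))) (𝓝[>] 0) atTop := by
  simp_rw [log_zpow_neg_two]
  exact Real.tendsto_log_nhdsGT_zero.const_mul_atBot_of_neg (by norm_num)

theorem tendsto_mul_log_zpow_neg_two :
    Tendsto (fun ε : ℝ => ε * Real.log (ε ^ (-2 : ℤ))) (𝓝[>] 0) (𝓝 0) := by
  have h := (tendsto_log_mul_rpow_nhdsGT_zero zero_lt_one).const_mul (-2 : ℝ)
  simp only [mul_zero, Real.rpow_one] at h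
  refine h.congr fun ε => ?_
  rw [log_zpow_neg_two]; ring

/-- Second-order expansion of the risk, together with the smallness of the second-order term. -/
theorem eventually_risk_expansion {Ω : Type*} [MeasurableSpace Ω] {P : Measure Ω}
    [IsProbabilityMeasure P] {n : L2I → Ω → ℝ} (hn : IsWhiteNoise P n)
    {τ₀ ρ C₀ ρ₁ C₁ : ℝ} (hτ₀ : 0 < τ₀) (hτ₀' : τ₀ < 1 / 4)
    (hρ : 0 < ρ) (hC₀ : 0 < C₀) (hρ₁ : 0 < ρ₁) {h : ℝ → ℕ+ → ℝ}
    (hB : AssumptionB ρ₁ C₁ h) (hC : AssumptionC ρ C₀ h) {T : ℝ → Observation → ℝ}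
    (hT : ∀ ε ∈ Ioo (0 : ℝ) 1, IsEstimatorAD τ₀ (h ε) (T ε)) {δ : ℝ → ℝ}
    (hδ : Tendsto (fun ε => δ ε / (ε * √(Real.log (ε ^ (-2 : ℤ))))) (𝓝[>] 0) atTop)
    {η : ℝ} (hη : 0 < η) :
    ∀ᶠ ε in 𝓝[>] (0 : ℝ), ∀ f ∈ signalClass ρ C₀, ∀ θ : ℝ, |θ| ≤ τ₀ - δ ε →
      ∃ r : ℝ, |r| ≤ η ∧
        risk P n ε (T ε) f θ =
          1 + (1 + r) * (secondOrder ε f (h ε) / normSqD1 (coeff f)) ∧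
        |secondOrder ε f (h ε) / normSqD1 (coeff f)| ≤ η := by
  set M := locRadius C₀ ρ (16 * Real.cos (2 * Real.pi * τ₀) ^ 2)
  set K := |riskConst C₀ C₁ ρ (16 * Real.cos (2 * Real.pi * τ₀) ^ 2)|
  -- The first entry bounds the bias part of `r` by `η/2`; the second bounds `C / A` by `η/2`, as `A
  -- ≥ ρ`.
  set η₁ := min (ρ ^ 2 * η / (6 * C₀)) (ρ * η / 2)
  have hη₁ : 0 < η₁ := lt_min (by positivity) (by positivity)
  have hη₁a : 3 * C₀ * η₁ ≤ ρ ^ 2 * η / 2 := by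
    calc 3 * C₀ * η₁ ≤ 3 * C₀ * (ρ ^ 2 * η / (6 * C₀)) := by gcongr; exact min_le_left _ _
      _ = _ := by field_simp; norm_num
  have hη₁b : η₁ ≤ ρ * η / 2 := min_le_right _ _
  have hL := tendsto_log_zpow_neg_two
  have e1 : ∀ᶠ ε in 𝓝[>] (0 : ℝ), ε ∈ Ioo (0 : ℝ) 1 := Ioo_mem_nhdsGT one_pos
  have e2 := hL.eventually_ge_atTop 1
  have e3 : ∀ᶠ ε in 𝓝[>] (0 : ℝ), ε * Real.log (ε ^ (-2 : ℤ)) ≤ 1 :=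
    tendsto_mul_log_zpow_neg_two.eventually_le_const one_pos
  have e4 := hδ.eventually_gt_atTop M
  -- With `L = log ε⁻²`, the expansion error is of order `ε⁴ L²`, while `ε² · ε² S ≥ ρ₁² ε⁴ L⁴`. The
  -- ratio therefore decays like `L⁻²`.
  have e5 : ∀ᶠ ε in 𝓝[>] (0 : ℝ),
      C₀ ^ 2 * (K / (ρ₁ ^ 2 * Real.log (ε ^ (-2 : ℤ)) ^ 2)) ≤ ρ ^ 2 * η / 2 := by
    have h1 : Tendsto (fun ε : ℝ => ρ₁ ^ 2 * Real.log (ε ^ (-2 : ℤ)) ^ 2) (𝓝[>] 0) atTop :=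
      ((tendsto_pow_atTop two_ne_zero).comp hL).const_mul_atTop (by positivity)
    have h2 := (h1.const_div_atTop K).const_mul (C₀ ^ 2)
    rw [mul_zero] at h2
    exact h2.eventually_le_const (by positivity)
  have e6 : ∀ᶠ ε in 𝓝[>] (0 : ℝ),
      3 * (freqConst + C₀ + C₁) * ε ^ ((1 : ℝ) / 16) ≤ ρ * η / 2 := by
    have h1 : Tendsto (fun ε : ℝ => ε ^ ((1 : ℝ) / 16)) (𝓝[>] 0) (𝓝 0) := by
      have := (Real.continuousAt_rpow_const 0 ((1 : ℝ) / 16) (Or.inr (by norm_num))).tendsto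
      rw [Real.zero_rpow (by norm_num)] at this
      exact this.mono_left nhdsWithin_le_nhds
    have h2 := h1.const_mul (3 * (freqConst + C₀ + C₁))
    rw [mul_zero] at h2
    exact h2.eventually_le_const (by positivity)
  filter_upwards [e1, e2, e3, e4, e5, e6, hC η₁ hη₁] with ε hε hL1 hεL hδε h5 h6 hCε f hf θ hθ
  have hε0 := hε.1
  have hfin := hB.finite ε hε
  have H := hB.isAdmissible hε hf
  set L := Real.log (ε ^ (-2 : ℤ))
  have hl : √L ^ 2 = L := Real.sq_sqrt (by linarith)
  have hl1 : 1 ≤ √L := Real.one_le_sqrt.2 hL1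
  have hmse := abs_mse_sub_le hn hτ₀ hτ₀' hρ hC₀ hfin (hT ε hε) hf H hl1 (by rwa [hl]) hl
    ((lt_div_iff₀ (by positivity)).1 hδε) hθ
  have hS := hB.le_sum_sq hρ₁ hε
  set s := hfin.toFinset
  set S := ∑ k ∈ s, h ε k ^ 2 * freq k ^ 2 with hSdef
  have hS0 : 0 < S := lt_of_lt_of_le (by positivity) hS
  have hBsum := signalClass.hasSum_one_sub hf hfin
  have hCsum := signalClass.hasSum_one_sub_sq hf hfin
  set A := normSqD1 (coeff f) with hAdef
  set D := filteredInfo s (h ε) (coeff f) with hDdef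
  set C := ∑' k, (1 - h ε k) ^ 2 * freq k ^ 2 * coeff f k ^ 2 with hCdef
  have hterm0 : ∀ k, 0 ≤ (1 - h ε k) ^ 2 * freq k ^ 2 * coeff f k ^ 2 := fun k => by positivity
  have hterm : ∀ k, (1 - h ε k) ^ 2 * freq k ^ 2 * coeff f k ^ 2 ≤
      (1 - h ε k) * freq k ^ 2 * coeff f k ^ 2 := fun k => by
    have h0 := H.h_nonneg k
    have h1 := H.h_le_one k
    have : (1 - h ε k) ^ 2 ≤ 1 - h ε k := by nlinarith
    gcongr
  have hC0 : 0 ≤ C := tsum_nonneg hterm0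
  have hCB : C ≤ A - D := by
    rw [← hBsum.tsum_eq]
    exact hCsum.summable.tsum_le_tsum hterm hBsum.summable
  have hB2 : (A - D) ^ 2 ≤ η₁ * C := by
    have := hCε f hf
    rw [show (∑' k : ℕ+, (1 - h ε k) * (2 * Real.pi * k) ^ 2 * coeff f k ^ 2) = A - D from
      hBsum.tsum_eq] at this
    exact this
  have hN : ∑ k ∈ s, h ε k ^ 2 * freq k ^ 2 * (coeff f k ^ 2 + ε ^ 2) =
      A - 2 * (A - D) + C + ε ^ 2 * S := by
    rw [hCdef, hCsum.tsum_eq, hSdef, Finset.mul_sum]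
    simp_rw [mul_add]
    rw [Finset.sum_add_distrib]
    have : ∀ k, h ε k ^ 2 * freq k ^ 2 * ε ^ 2 = ε ^ 2 * (h ε k ^ 2 * freq k ^ 2) :=
      fun k => mul_comm _ _
    simp_rw [this]
    ring
  rw [hN] at hmse
  have hL0 : 0 < L := by linarith
  have hκ : riskConst C₀ C₁ ρ (16 * Real.cos (2 * Real.pi * τ₀) ^ 2) * (ε ^ 4 * √L ^ 4) ≤
      ε ^ 2 * (K / (ρ₁ ^ 2 * L ^ 2) * (ε ^ 2 * S)) := by
    calc _ ≤ K * (ε ^ 4 * √L ^ 4) := by gcongr; exact le_abs_self _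
      _ = K * (ε ^ 4 * L ^ 2) := by rw [show √L ^ 4 = (√L ^ 2) ^ 2 by ring, hl]
      _ = ε ^ 2 * (K / (ρ₁ ^ 2 * L ^ 2) * (ε ^ 2 * (ρ₁ ^ 2 * L ^ 4))) := by field_simp
      _ ≤ _ := by gcongr
  have hAC := signalClass.normSqD1_le hf
  have hρA := signalClass.le_normSqD1 hf
  obtain ⟨r, hr, hrisk, hCη⟩ := exists_risk_ratio hρ H.le_filteredInfo (by linarith) hAC rfl hB2
    hC0 hCB hε0 hS0 hη₁ (by positivity) (hmse.trans hκ)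
  have hR : secondOrder ε f (h ε) = C + ε ^ 2 * S := signalClass.secondOrder_eq hf hfin
  refine ⟨r, hr.trans ?_, ?_, ?_⟩
  · rw [div_le_iff₀ (by positivity)]
    linarith
  · rw [hR, ← hrisk, risk, signalClass.fisherInfo_eq hf, integral_mul_const]
    ring
  · have hη6 : (ε ^ ((1 : ℝ) / 16)) ^ 16 = ε := by
      rw [← Real.rpow_natCast, ← Real.rpow_mul hε0.le]; norm_num
    have hS6 := (H.eps_sq_mul_sum_sq_le (Real.rpow_pos_of_pos hε0 _) hη6).trans h6
    have hA0 : 0 < A := hρ.trans_le hρA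
    rw [hR, abs_of_nonneg (by positivity), div_le_iff₀ hA0]
    calc C + ε ^ 2 * S ≤ ρ * η / 2 + ρ * η / 2 := add_le_add (hCη.trans hη₁b) hS6
      _ = η * ρ := by ring
      _ ≤ _ := by gcongr

end ShiftModel

theorem theorem1
    {Ω : Type*} [MeasurableSpace Ω] (P : Measure Ω) [IsProbabilityMeasure P]
    (n : ShiftModel.L2I → Ω → ℝ) (hn : ShiftModel.IsWhiteNoise P n)
    (τ₀ ρ C₀ ρ₁ C₁ : ℝ) (hτ₀ : 0 < τ₀) (hτ₀' : τ₀ < 1 / 4)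
    (hρ : 0 < ρ) (hC₀ : 0 < C₀) (hρ₁ : 0 < ρ₁)
    (h : ℝ → ℕ+ → ℝ)
    (hB : ShiftModel.AssumptionB ρ₁ C₁ h) (hC : ShiftModel.AssumptionC ρ C₀ h)
    (T : ℝ → ShiftModel.Observation → ℝ)
    (hT : ∀ ε ∈ Ioo (0 : ℝ) 1, ShiftModel.IsEstimatorAD τ₀ (h ε) (T ε))
    (δ : ℝ → ℝ)
    (hδ : Tendsto (fun ε => δ ε / (ε * √(Real.log (ε ^ (-2 : ℤ))))) (𝓝[>] 0) atTop) :
    (∀ η > (0 : ℝ), ∀ᶠ ε in 𝓝[>] (0 : ℝ),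
      ∀ f ∈ ShiftModel.signalClass ρ C₀, ∀ θ : ℝ, |θ| ≤ τ₀ - δ ε →
        ∃ r : ℝ, |r| ≤ η ∧
          ShiftModel.risk P n ε (T ε) f θ =
            1 + (1 + r) * (ShiftModel.secondOrder ε f (h ε) /
              ShiftModel.normSqD1 (ShiftModel.coeff f))) ∧
    (∀ η > (0 : ℝ), ∀ᶠ ε in 𝓝[>] (0 : ℝ),
      ∀ f ∈ ShiftModel.signalClass ρ C₀, ∀ θ : ℝ, |θ| ≤ τ₀ - δ ε →
        |ShiftModel.risk P n ε (T ε) f θ - 1| ≤ η) := by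

  constructor
  · intro η hη
    filter_upwards [ShiftModel.eventually_risk_expansion hn hτ₀ hτ₀' hρ hC₀ hρ₁ hB hC hT hδ hη]
      with ε hε f hf θ hθ
    obtain ⟨r, hr, hrisk, -⟩ := hε f hf θ hθ
    exact ⟨r, hr, hrisk⟩
  · intro η hη
    -- Tolerance `min 1 (η/2)`: the `1` gives `|1 + r| ≤ 2`, which the `η/2` compensates.
    filter_upwards [ShiftModel.eventually_risk_expansion hn hτ₀ hτ₀' hρ hC₀ hρ₁ hB hC hT hδ
      (lt_min one_pos (half_pos hη))] with ε hε f hf θ hθ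
    obtain ⟨r, hr, hrisk, hsmall⟩ := hε f hf θ hθ
    rw [hrisk, add_sub_cancel_left, abs_mul]
    have h1 : |1 + r| ≤ 2 := by
      have := hr.trans (min_le_left _ _)
      rw [abs_le] at this ⊢
      constructor <;> linarith
    calc _ ≤ 2 * (η / 2) :=
          mul_le_mul h1 (hsmall.trans (min_le_right _ _)) (abs_nonneg _) zero_le_two
      _ = η := by ring
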